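/- **Setting.** Let $K\subset\mathbb R^3$ be an oriented knot with a smooth injective arclength parametrization $\gamma:\mathbb R/L\mathbb Z\to\mathbb R^3$ and base point $\gamma(0)$. A cord is a point $c=(s,t)$ of $T^2=(\mathbb R/L\mathbb Z)^2\cong K\times K$, regarded as the segment from $\gamma(s)$ to $\gamma(t)$; its energy is $\frac12|\gamma(s)-\gamma(t)|^2$. Let $\nu$ be a framing (a smooth unit normal field along $K$) and $h:T^2\to\mathbb R$ a smooth perturbation; put $E=\frac12|\gamma(s)-\gamma(t)|^2+h$. Let $\varphi^\tau$ be the flow of $-\nabla E$ and $Crit_k$ the set of critical points of $E$ of Morse index $k$. Define: * $B$: the cords with $s=0$ or $t=0$. * $S$: the cords with $s\ne t$ that meet $K$ in their interior. $\partial S$: the cords with $s\neq t$ tangent to $K$ at an endpoint. $S_2$: the cords meeting $K$ at least twice in their interior. * $F=F^s\cup F^e$, where $F^s$ is the set of cords whose projection to the normal plane at $\gamma(s)$ is a positive multiple of $\nu(s)$, extended to the diagonal by the points $(s,s)$ where $\ddot\gamma(s)$ is a positive multiple of $\nu(s)$; $F^e=\{(s,t):(t,s)\in F^s\}$. $\partial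 F=(\overline{F^s}\setminus F^s)\cup(\overline{F^e}\setminus F^e)$. When a cord $(s,t)$ on a trajectory meets $K$ at an interior point $\gamma(u)$ it is split into the parts $(s,u)$ and $(u,t)$. **The exceptional set.** $A\subset T^2$ is the set of cords $c$ such that $c$, or a cord obtained from $c$ by (possibly repeatedly) flowing for a positive time along $-\nabla E$ and splitting, has one of these properties: it lies in $Crit_0\cup Crit_2$ or in the stable manifold of a point of $Crit_1$; it lies in $S\cup F\cup B$; its forward trajectory is not transverse to $B$, $F$ or $S$; its forward trajectory meets $\partial S$, $\partial F$ or $S_2$. **The map $\widehat D$.** $C_0$ is the unital ring generated by $\lambda^{\pm1},\mu^{\pm1}$ and the elements of $Crit_0$, where $\lambda,\mu$ commute with each other, with the relation $d=1-\mu$ for $d\in Crit_0$ on the diagonal. For $c\in T^2\setminus A$ whose trajectory tends to $d\in Crit_0$, and which meets $S$ at the finite set $P$ of times, $\widehat D(c)$ is defined recursively by $$\widehat D(c)=\ell_\infty\, d\, r_\infty+\sum_{\tau\in P}\sigma_\tau\,\ell_\tau\,\widehat D(c_{\tau,1})\,\mu^{\kappa_\tau}\,\widehat D(c_{\tau,2})\,r_\tau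 .$$ Here $c_{\tau,1},c_{\tau,2}$ are the two parts of $(s,t)=\varphi^\tau(c)$, split at $\gamma(u)$. The monomials $\ell_\tau$, $r_\tau$ in $\lambda,\mu$ collect the crossings before time $\tau$: $\ell_\tau$ gets $\lambda$ when the startpoint crosses the base point in the direction of $K$, and $\mu$ when the cord crosses the framing at its startpoint counterclockwise in the normal plane oriented by $\dot\gamma$ (inverses for the opposite directions); $r_\tau$ gets the inverse factors for the crossings at the endpoint. With $n=\dot\gamma(u)\times(\gamma(t)-\gamma(s))$, the sign $\sigma_\tau$ is $-1$ if the point of the moving cord at $\gamma(u)$ has velocity $p$ with $\langle p,n\rangle>0$, and $+1$ if $\langle p,n\rangle<0$; and $\kappa_\tau=-1$ if $\langle\nu(u),n\rangle>0$, $\kappa_\tau=0$ if $\langle\nu(u),n\rangle<0$. **Genericity.** The knot is generic in the following sense: $\ddot\gamma$ vanishes nowhere; $S$ is regularly cut out and immersed, i.e. whenever $(s,t)\in S$ meets $K$ at the interior point $\gamma(u)$, one of $\langle\dot\gamma(s),n\rangle,\langle\dot\gamma(t),n\rangle$ is nonzero; and if $s\ne t$ and $\gamma(t)-\gamma(s)$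 is parallel to $\dot\gamma(s)$, then $\dot\gamma(s),\ddot\gamma(s),\dot\gamma(t)$ are linearly independent. The framing, base point and perturbation are generic in the following sense: $F^s$ is regularly cut out by the component of the cord orthogonal to $\nu(s)$ in the normal plane at $\gamma(s)$ (divided by $|\gamma(s)-\gamma(t)|^2$ and extended smoothly to the diagonal); $E$ is a Morse function; off the diagonal every critical point of $E$ is one of $\frac12|\gamma(s)-\gamma(t)|^2$, and $h$ vanishes near each off-diagonal critical point of the latter; on the diagonal $E$ has exactly two critical points, one of index $0$ and one of index $1$; and $(Crit_0\cup Crit_1)\cap(B\cup F\cup S)=\emptyset$. **Statement.** For every generic knot $K$ there is an $\varepsilon>0$, depending only on $K$, such that for every framing $\nu$ and perturbation $h$ that are generic as above, with $|h|,|\partial_sh|,|\partial_th|<\varepsilon$ everywhere, the following holds. For every $q\in(K\times K)\setminus A$ there is an open neighbourhood $V\subset K\times K$ of $q$ with $V\cap A=\emptyset$ such that, for every $x\in V$, $\widehat D(x)$ is well defined and $\widehat D(x)=\widehat D(q)$. -/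

import Mathlib

open scoped ContDiff Topology

noncomputable section

namespace CordAlgebra

/-- Euclidean three-space. -/
abbrev E3 := EuclideanSpace ℝ (Fin 3)

/-- The cross product of Euclidean three-space. -/
def cross (v w : E3) : E3 := WithLp.toLp 2 (crossProduct v.ofLp w.ofLp)

/-- The torus `(ℝ / L ℤ) × (ℝ / L ℤ)`. -/
abbrev Torus (L : ℝ) := AddCircle L × AddCircle L

/-- The derivative of a function on the circle `ℝ / L ℤ`. -/
def cderiv {L : ℝ} {V : Type*} [NormedAddCommGroup V] [NormedSpace ℝ V]
    (f : AddCircle L → V) (s : AddCircle L) : V :=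
  deriv (fun a : ℝ => f (s + (a : AddCircle L))) 0

/-- The partial derivative in the first variable of a function on the torus. -/
def dS {L : ℝ} (f : Torus L → ℝ) (c : Torus L) : ℝ := cderiv (fun s => f (s, c.2)) c.1

/-- The partial derivative in the second variable of a function on the torus. -/
def dT {L : ℝ} (f : Torus L → ℝ) (c : Torus L) : ℝ := cderiv (fun t => f (c.1, t)) c.2

/-- Critical points of a function on the torus. -/
def IsCrit {L : ℝ} (f : Torus L → ℝ) (c : Torus L) : Prop := dS f c = 0 ∧ dT f c = 0

/-- The Hessian matrix of a function on the torus. -/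
def hessian {L : ℝ} (f : Torus L → ℝ) (c : Torus L) : Matrix (Fin 2) (Fin 2) ℝ :=
  !![dS (dS f) c, dS (dT f) c; dT (dS f) c, dT (dT f) c]

/-- An oriented knot of length `L` in three-space, given by a smooth injective arclength
parametrization on `ℝ / L ℤ`. The base point of the knot is `γ 0`. -/
structure Knot (L : ℝ) where
  γ : AddCircle L → E3
  length_pos : 0 < L
  smooth : ContDiff ℝ ∞ (fun a : ℝ => γ (a : AddCircle L))
  injective : Function.Injective γ
  arclength : ∀ s, ‖cderiv γ s‖ = 1

namespace Knot

variable {L : ℝ} (K : Knot L)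

/-- The unit tangent vector. -/
def tan (s : AddCircle L) : E3 := cderiv K.γ s

/-- The second derivative of the parametrization. -/
def acc (s : AddCircle L) : E3 := cderiv K.tan s

/-- The vector from the startpoint to the endpoint of a cord `c = (s, t)`. -/
def chord (c : Torus L) : E3 := K.γ c.2 - K.γ c.1

/-- The energy `E (s, t) = |γ s - γ t| ^ 2 / 2` of a cord. -/
def energy (c : Torus L) : ℝ := (1 / 2) * ‖K.γ c.1 - K.γ c.2‖ ^ 2

/-- The cord `c` meets the knot in its interior at the point `γ u`, which divides the cord in the
ratio `r : 1 - r`. -/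
def Hit (c : Torus L) (u : AddCircle L) (r : ℝ) : Prop :=
  c.1 ≠ c.2 ∧ 0 < r ∧ r < 1 ∧ K.γ u = (1 - r) • K.γ c.1 + r • K.γ c.2

/-- The set `S` of cords that meet the knot in their interior. -/
def S : Set (Torus L) := {c | ∃ u r, K.Hit c u r}

/-- The set of cords that meet the knot at least twice in their interior. -/
def S₂ : Set (Torus L) := {c | ∃ u r u' r', K.Hit c u r ∧ K.Hit c u' r' ∧ u ≠ u'}

/-- The boundary of `S`: the cords that are tangent to the knot at their startpoint or at their
endpoint. -/
def bdryS : Set (Torus L) :=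
  {c | c.1 ≠ c.2 ∧ ((∃ a : ℝ, K.chord c = a • K.tan c.1) ∨ ∃ a : ℝ, K.chord c = a • K.tan c.2)}

/-- Where the cord `c` meets the knot at `γ u` in its interior, this vector is normal to the plane
spanned by the knot and the cord there. -/
def conormal (c : Torus L) (u : AddCircle L) : E3 := cross (K.tan u) (K.chord c)

/-- Nondegeneracy of a knot: the curvature vanishes nowhere; the equations
`γ u = (1 - r) γ s + r γ t` cut out `S` as an immersed curve; and at each cord that is tangent to the
knot at one end, the knot at the other end is transverse to the osculating plane, so that `S` is
a curve with boundary there. -/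
structure Generic : Prop where
  curvature : ∀ s, K.acc s ≠ 0
  immersed : ∀ c u r, K.Hit c u r →
    inner ℝ (K.tan c.1) (K.conormal c u) ≠ 0 ∨ inner ℝ (K.tan c.2) (K.conormal c u) ≠ 0
  tangent : ∀ s t, s ≠ t → (∃ a : ℝ, K.γ t - K.γ s = a • K.tan s) →
    inner ℝ (cross (K.tan s) (K.acc s)) (K.tan t) ≠ 0

open Classical in
/-- A positive multiple of the cord `(s, t)`, scaled such that its component normal to the knot at
`γ s` extends smoothly to the diagonal `s = t`. -/
def scaledChord (c : Torus L) : E3 :=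
  if c.1 = c.2 then (1 / 2 : ℝ) • K.acc c.1 else (‖K.chord c‖ ^ 2)⁻¹ • K.chord c

/-- The orthogonal projection to the normal plane of the knot at `γ s`. -/
def normalProj (s : AddCircle L) (v : E3) : E3 := v - inner ℝ v (K.tan s) • K.tan s

end Knot

/-- A framing `ν` of the knot `K`, that is, a smooth unit normal field, together with a smooth
perturbation `h` of the energy function. -/
structure CordData {L : ℝ} (K : Knot L) where
  ν : AddCircle L → E3
  ν_smooth : ContDiff ℝ ∞ (fun a : ℝ => ν (a : AddCircle L))
  ν_unit : ∀ s, ‖ν s‖ = 1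
  ν_normal : ∀ s, inner ℝ (ν s) (K.tan s) = 0
  h : Torus L → ℝ
  h_smooth : ContDiff ℝ ∞ (fun p : ℝ × ℝ => h ((p.1 : AddCircle L), (p.2 : AddCircle L)))

/-- Names for the generators of the algebra `C0` below. -/
inductive Gen (Y : Type*) where
  | lam | lamInv | mu | muInv
  | cord (d : Y)

namespace CordData

variable {L : ℝ} {K : Knot L} (X : CordData K)

/-- The perturbed energy function. -/
def E (c : Torus L) : ℝ := K.energy c + X.h c

/-- The critical points of index 0. -/
def Crit0 : Set (Torus L) := {c | IsCrit X.E c ∧ (hessian X.E c).PosDef}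
/-- The critical points of index 1. -/
def Crit1 : Set (Torus L) := {c | IsCrit X.E c ∧ (hessian X.E c).det < 0}
/-- The critical points of index 2. -/
def Crit2 : Set (Torus L) := {c | IsCrit X.E c ∧ (-hessian X.E c).PosDef}

/-! ### The negative gradient flow -/

/-- The vector field `-∇E` on the torus. -/
def vel (c : Torus L) : ℝ × ℝ := (-dS X.E c, -dT X.E c)

/-- The derivative of `f` in the direction of `-∇E`. -/
def along (f : Torus L → ℝ) (c : Torus L) : ℝ := (X.vel c).1 * dS f c + (X.vel c).2 * dT f c

/-- The translate of a point of the torus by a vector. -/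
def shift (c : Torus L) (p : ℝ × ℝ) : Torus L :=
  (c.1 + (p.1 : AddCircle L), c.2 + (p.2 : AddCircle L))

/-- The path `τ ↦ c + x τ` is the trajectory of `-∇E` that starts at `c`. -/
def IsTrajectory (c : Torus L) (x : ℝ → ℝ × ℝ) : Prop :=
  x 0 = 0 ∧ ∀ τ, HasDerivAt x (X.vel (shift c (x τ))) τ

/-- The flow of `-∇E` (the trajectory from `c` exists for all times and is unique, as the torus is
compact). -/
def flow (τ : ℝ) (c : Torus L) : Torus L :=
  shift c (Classical.epsilon (fun x : ℝ → ℝ × ℝ => X.IsTrajectory c x) τ)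

/-- The stable manifold of a point. -/
def stable (k : Torus L) : Set (Torus L) :=
  {c | Filter.Tendsto (fun τ => X.flow τ c) Filter.atTop (𝓝 k)}

/-! ### Base point and framing -/

/-- The cords that start or end at the base point. -/
def B : Set (Torus L) := {c | c.1 = 0 ∨ c.2 = 0}

/-- The cords that intersect the framing at their startpoint: the normal projection of the cord
at its startpoint is a positive multiple of `ν` (extended by continuity to the diagonal). -/
def Fs : Set (Torus L) :=
  {c | ∃ α : ℝ, 0 < α ∧ K.normalProj c.1 (K.scaledChord c) = α • X.ν c.1}

/-- The cords that intersect the framing at their endpoint. -/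
def Fe : Set (Torus L) := {c | c.swap ∈ X.Fs}

/-- The cords that intersect the framing. -/
def F : Set (Torus L) := X.Fs ∪ X.Fe

/-- The boundary of the set of cords that intersect the framing. -/
def bdryF : Set (Torus L) := (closure X.Fs \ X.Fs) ∪ (closure X.Fe \ X.Fe)

/-- The component of the scaled cord that is orthogonal to `ν` in the normal plane at its
startpoint, the normal plane being oriented by the knot. It is a defining function of `Fs`, and it
increases when the cord crosses the framing counterclockwise. -/
def offS (c : Torus L) : ℝ :=
  inner ℝ (K.scaledChord c) (cross (K.tan c.1) (X.ν c.1))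

/-- The same at the endpoint. -/
def offE (c : Torus L) : ℝ := X.offS c.swap

/-- When the cord `c`, moving along `-∇E`, meets the knot at `γ u` in its interior, this is the
component of the velocity of the cord there which is normal to the cord and to the knot. -/
def crossRate (c : Torus L) (u : AddCircle L) (r : ℝ) : ℝ :=
  inner ℝ (((1 - r) * (X.vel c).1) • K.tan c.1 + (r * (X.vel c).2) • K.tan c.2) (K.conormal c u)

/-- The forward trajectory of `c` is transverse to `B` (to each of its two branches). -/
def TransB (c : Torus L) : Prop :=
  ∀ τ : ℝ, 0 ≤ τ → ((X.flow τ c).1 = 0 → (X.vel (X.flow τ c)).1 ≠ 0) ∧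
    ((X.flow τ c).2 = 0 → (X.vel (X.flow τ c)).2 ≠ 0)

/-- The forward trajectory of `c` is transverse to `F` (to each of its two branches). -/
def TransF (c : Torus L) : Prop :=
  ∀ τ : ℝ, 0 ≤ τ → (X.flow τ c ∈ X.Fs → X.along X.offS (X.flow τ c) ≠ 0) ∧
    (X.flow τ c ∈ X.Fe → X.along X.offE (X.flow τ c) ≠ 0)

/-- The forward trajectory of `c` is transverse to `S`: its velocity is not in the tangent line
`{(a, b) | (1 - r) a ⟪γ' s, n⟫ + r b ⟪γ' t, n⟫ = 0}`, with the vector `n = γ' u × (γ t - γ s)`. -/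
def TransS (c : Torus L) : Prop :=
  ∀ τ : ℝ, 0 ≤ τ → ∀ u r, K.Hit (X.flow τ c) u r → X.crossRate (X.flow τ c) u r ≠ 0

/-! ### The exceptional set -/

/-- The immediate obstructions for a cord `c`: it is a critical point of index 0 or 2 or flows to one
of index 1; it is in `S`, `F` or `B`; its forward trajectory is not transverse to one of these sets;
or its forward trajectory meets the boundary of `S` or of `F`, or `S₂`. -/
def Bad (c : Torus L) : Prop :=
  (c ∈ X.Crit2 ∪ (⋃ k ∈ X.Crit1, X.stable k) ∪ X.Crit0) ∨
  (c ∈ K.S ∪ X.F ∪ B) ∨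
  (¬ X.TransB c ∨ ¬ X.TransF c ∨ ¬ X.TransS c) ∨
  (∃ τ : ℝ, 0 ≤ τ ∧ X.flow τ c ∈ K.bdryS ∪ X.bdryF ∪ K.S₂)

/-- The cord `c'` is one of the two parts into which the cord `c` is split when it meets the knot
in its interior on its way along `-∇E`. -/
def Split (c c' : Torus L) : Prop :=
  ∃ τ : ℝ, 0 < τ ∧ ∃ u r, K.Hit (X.flow τ c) u r ∧
    (c' = ((X.flow τ c).1, u) ∨ c' = (u, (X.flow τ c).2))

/-- The exceptional set: `c` itself or a cord resulting from `c` by (possibly multiple) splitting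
is obstructed. -/
def A : Set (Torus L) := {c | ∃ c', Relation.ReflTransGen X.Split c c' ∧ X.Bad c'}

/-! ### The algebra of cords of index 0 -/

/-- The relations of the algebra `C0`: `λ` and `μ` are invertible and commute with each other, and
the contractible cord of index 0 is identified with `1 - μ`. -/
inductive C0Rel : FreeAlgebra ℤ (Gen X.Crit0) → FreeAlgebra ℤ (Gen X.Crit0) → Prop
  | lam_inv : C0Rel (FreeAlgebra.ι ℤ Gen.lam * FreeAlgebra.ι ℤ Gen.lamInv) 1
  | inv_lam : C0Rel (FreeAlgebra.ι ℤ Gen.lamInv * FreeAlgebra.ι ℤ Gen.lam) 1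
  | mu_inv : C0Rel (FreeAlgebra.ι ℤ Gen.mu * FreeAlgebra.ι ℤ Gen.muInv) 1
  | inv_mu : C0Rel (FreeAlgebra.ι ℤ Gen.muInv * FreeAlgebra.ι ℤ Gen.mu) 1
  | comm : C0Rel (FreeAlgebra.ι ℤ Gen.lam * FreeAlgebra.ι ℤ Gen.mu)
      (FreeAlgebra.ι ℤ Gen.mu * FreeAlgebra.ι ℤ Gen.lam)
  | contractible (d : X.Crit0) : d.1.1 = d.1.2 →
      C0Rel (FreeAlgebra.ι ℤ (Gen.cord d)) (1 - FreeAlgebra.ι ℤ Gen.mu)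

/-- The noncommutative algebra generated by `λ`, `μ`, their inverses and the critical points of
index 0. -/
abbrev C0 := RingQuot X.C0Rel

/-- The image in `C0` of a generator. -/
def gen (g : Gen X.Crit0) : X.C0 := RingQuot.mkRingHom X.C0Rel (FreeAlgebra.ι ℤ g)

/-- The unit `λ` of `C0`. -/
def lam : X.C0ˣ where
  val := X.gen Gen.lam
  inv := X.gen Gen.lamInv
  val_inv := by
    rw [gen, gen, ← map_mul, RingQuot.mkRingHom_rel C0Rel.lam_inv, map_one]
  inv_val := by
    rw [gen, gen, ← map_mul, RingQuot.mkRingHom_rel C0Rel.inv_lam, map_one]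

/-- The unit `μ` of `C0`. -/
def mu : X.C0ˣ where
  val := X.gen Gen.mu
  inv := X.gen Gen.muInv
  val_inv := by
    rw [gen, gen, ← map_mul, RingQuot.mkRingHom_rel C0Rel.mu_inv, map_one]
  inv_val := by
    rw [gen, gen, ← map_mul, RingQuot.mkRingHom_rel C0Rel.inv_mu, map_one]

/-! ### The map `D̂` -/

/-- The number, counted with the sign of `rate`, of the times in `I` at which the trajectory
of `c` is in `M`. -/
def count (M : Set (Torus L)) (rate : Torus L → ℝ) (I : Set ℝ) (c : Torus L) : ℤ :=
  ∑ᶠ τ ∈ {τ | τ ∈ I ∧ X.flow τ c ∈ M}, (SignType.sign (rate (X.flow τ c)) : ℤ)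

/-- The factor `λ ^ α₁ μ ^ β₁` that the startpoint of `c` collects during the times in `I`: `λ` for each
crossing of the base point in the direction of the knot, `μ` for each counterclockwise crossing of
the framing, and the inverses for crossings in the opposite direction. -/
def left (I : Set ℝ) (c : Torus L) : X.C0ˣ :=
  X.lam ^ X.count {x | x.1 = 0} (fun x => (X.vel x).1) I c *
    X.mu ^ X.count X.Fs (X.along X.offS) I c

/-- The factor `λ ^ α₂ μ ^ β₂` that the endpoint of `c` collects during the times in `I`, with the
opposite exponents. -/
def right (I : Set ℝ) (c : Torus L) : X.C0ˣ :=
  X.lam ^ (-X.count {x | x.2 = 0} (fun x => (X.vel x).2) I c) *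
    X.mu ^ (-X.count X.Fe (X.along X.offE) I c)

/-- The sign of the product of the two parts when the cord `c` is split at `γ u`: it is `+1` if the
cord moves against `γ' u × (γ t - γ s)`. -/
def splitSign (c : Torus L) (u : AddCircle L) (r : ℝ) : ℤ :=
  -(SignType.sign (X.crossRate c u r) : ℤ)

/-- The exponent of `μ` between the two parts of a cord `c` that is split at `γ u`; it accounts for
the position of the framing at `γ u` relative to the two parts. -/
def splitExp (c : Torus L) (u : AddCircle L) : ℤ :=
  if 0 < inner ℝ (X.ν u) (K.conormal c u) then -1 else 0

/-- The term `∂ c`, for a cord `c` whose trajectory tends to the critical point `d` of index 0. -/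
def bdryTerm (c : Torus L) (d : X.Crit0) : X.C0 :=
  (X.left (Set.Ici 0) c : X.C0) * X.gen (Gen.cord d) * (X.right (Set.Ici 0) c : X.C0)

/-- The contribution to `δ c` of a splitting of `c` at the time `τ` at the point `γ u`, where `z₁` and
`z₂` are the values of `D̂` on the first and the second part. -/
def splitTerm (c : Torus L) (τ : ℝ) (u : AddCircle L) (r : ℝ) (z₁ z₂ : X.C0) : X.C0 :=
  X.splitSign (X.flow τ c) u r •
    ((X.left (Set.Ico 0 τ) c : X.C0) * z₁ *
      ((X.mu ^ X.splitExp (X.flow τ c) u : X.C0ˣ) : X.C0) * z₂ *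
      (X.right (Set.Ico 0 τ) c : X.C0))

/-- The recursive definition of `D̂ c = ∂ c + δ c`, as the relation that `z` is the value of `D̂` at `c`.
Here `P` is the finite set of times at which the trajectory of `c` meets `S`; at the time `τ` in `P` the
cord meets the knot at `γ (u τ)` and is split into two parts with the values `z₁ τ` and `z₂ τ`. -/
inductive IsDhat : Torus L → X.C0 → Prop
  | intro (c : Torus L) (d : X.Crit0) (P : Finset ℝ) (u : ℝ → AddCircle L) (r : ℝ → ℝ)
      (z₁ z₂ : ℝ → X.C0)
      (hd : c ∈ X.stable d)
      (hP : ∀ τ, τ ∈ P ↔ 0 ≤ τ ∧ X.flow τ c ∈ K.S)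
      (hu : ∀ τ ∈ P, K.Hit (X.flow τ c) (u τ) (r τ))
      (h₁ : ∀ τ ∈ P, IsDhat ((X.flow τ c).1, u τ) (z₁ τ))
      (h₂ : ∀ τ ∈ P, IsDhat (u τ, (X.flow τ c).2) (z₂ τ)) :
      IsDhat c (X.bdryTerm c d + ∑ τ ∈ P, X.splitTerm c τ (u τ) (r τ) (z₁ τ) (z₂ τ))

/-- The map `D̂`. -/
def Dhat (c : Torus L) : X.C0 := Classical.epsilon (fun z => X.IsDhat c z)

/-- Genericity of the framing, the base point and the perturbation:
the defining function of `Fs` is regular on `Fs`; the perturbed energy is a Morse function;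
its critical points off the diagonal are those of the energy, and the perturbation vanishes near
these; on the diagonal it has exactly two critical points, one of index 0 and one of index 1;
and no critical point of index 0 or 1 is in one of the sets `B`, `F` and `S`. -/
structure Generic : Prop where
  framing_regular : ∀ c ∈ X.Fs, dS X.offS c ≠ 0 ∨ dT X.offS c ≠ 0
  morse : ∀ c, IsCrit X.E c → (hessian X.E c).det ≠ 0
  crit_offDiag : ∀ c : Torus L, c.1 ≠ c.2 → IsCrit X.E c → IsCrit K.energy c
  vanishes : ∀ c : Torus L, c.1 ≠ c.2 → IsCrit K.energy c → ∀ᶠ x in 𝓝 c, X.h x = 0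
  crit_diag : ∃ m M : AddCircle L, (m, m) ∈ X.Crit0 ∧ (M, M) ∈ X.Crit1 ∧
    ∀ s, IsCrit X.E (s, s) → s = m ∨ s = M
  disjoint : Disjoint (X.Crit0 ∪ X.Crit1) (B ∪ X.F ∪ K.S)

/-- The perturbation is smaller than `ε` in the `C¹` norm. -/
def PerturbationLT (ε : ℝ) : Prop := ∀ c, |X.h c| < ε ∧ |dS X.h c| < ε ∧ |dT X.h c| < ε

end CordData

end CordAlgebra

end

/-!
# Local constancy of the cord algebra map `D̂`

Let `q` be a cord outside the exceptional set. Its trajectory tends to a critical point `d` of index 0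
(`Generic.tendsto_crit0`), and `d` attracts a whole neighbourhood (`attracts_nhds`). Therefore only a compact
interval of times matters. On it the trajectory crosses the walls `B`, `F^s`, `F^e` and `S`. Near a transverse
crossing a wall is the zero set of a differentiable function with nonzero derivative in the direction of the
flow (`LocalWall`), so that the time of crossing is a continuous function of the initial cord
(`exists_crossing_time`). The closures of the walls contain no further cords except cords tangent to the knot at an
endpoint (`closure_Fs_subset`, `Generic.isClosed_S_union`), which the trajectory avoids. By compactness there are
finitely many crossings and no new ones arise nearby (`exists_crossing_times`). Hence the signed numbers of
crossings are locally constant, also those before the time of another crossing (`count_locally_constant`). At a time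
of splitting the cord crosses neither the base point nor the framing at its ends, since otherwise one of its parts
would be exceptional (`mem_Fs_of_hit`); for the same reason the exponent of `μ` at the splitting point does not jump
(`inner_ν_conormal_ne_zero`). Together this shows that `D̂` is locally constant at `q` if it is locally constant at
all cords obtained from `q` by one splitting (`eventually_isDhat`). Uniqueness of the value of `D̂` is an induction
over its construction (`IsDhat.unique`).

The theorem follows by induction along the splittings, provided that no cord can be split infinitely often
(`exists_wellFounded_split`). This is where `ε` is chosen. Let `κ` be a lower bound for the ratio of chord
length and arc length of the knot, and `ℓ` a lower bound for the length of the cords in `S ∪ ∂S`. If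
`ε ≤ κ ℓ / 4`, a splitting lowers the energy at least in proportion to the distance by which an end of the cord jumps
(`E_split_le`). In an infinite chain of splittings one of the ends, say the startpoint, is replaced infinitely
often, and the energies converge. So the jumps tend to zero, and the cords accumulate at a cord tangent to the knot
at its startpoint. If `ε ≤ ℓ`, the gradient does not vanish there, and it moves the startpoint in the direction of
the cord; a splitting near the startpoint does the same (`Knot.hit_direction`). Once close enough, the chain stays
near the tangent cord, because its movement is controlled by the loss of energy (`lflow_trapped`). Thus from one
replacement of the startpoint to the next, both the startpoint and the intersection point have moved in the same
direction. But near the tangent cord they move in opposite directions along `S`, like the two intersection points of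
a curve with a varying chord close to a tangent (`Generic.hits_near_tangent`), a contradiction
(`not_frequently_start_split`).

Functions and flows on the torus are studied through their lifts to the plane (`tc`). The behaviour of
cords near the diagonal, and of intersection points near an end of the cord, is controlled by the divided difference
`(γ b - γ a) / (b - a)` and its second order analogue, which extend differentiably to the diagonal (`Knot.dd`,
`Knot.rr`).
-/

open scoped ContDiff Topology

namespace CordAlgebra

open Filter Set

/-! ### Functions on the torus and their lifts to the plane -/

/-- The covering map from the plane to the torus. -/
def tc (L : ℝ) (p : ℝ × ℝ) : Torus L := ((p.1 : AddCircle L), (p.2 : AddCircle L))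

section Torus

variable {L : ℝ}

lemma tc_surjective : Function.Surjective (tc L) := by
  rintro ⟨s, t⟩
  obtain ⟨a, rfl⟩ := QuotientAddGroup.mk_surjective s
  obtain ⟨b, rfl⟩ := QuotientAddGroup.mk_surjective t
  exact ⟨(a, b), rfl⟩

lemma continuous_circle_coe : Continuous (fun a : ℝ => (a : AddCircle L)) :=
  AddCircle.continuous_mk' L

lemma continuous_tc : Continuous (tc L) :=
  (continuous_circle_coe.comp continuous_fst).prodMk (continuous_circle_coe.comp continuous_snd)

lemma map_coe_nhds (a : ℝ) : map (fun x : ℝ => (x : AddCircle L)) (𝓝 a) = 𝓝 (a : AddCircle L) :=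
  (QuotientAddGroup.isOpenQuotientMap_mk).map_nhds_eq a

lemma map_tc_nhds (p : ℝ × ℝ) : map (tc L) (𝓝 p) = 𝓝 (tc L p) := by
  obtain ⟨a, b⟩ := p
  rw [nhds_prod_eq]
  change map (Prod.map (fun x : ℝ => (x : AddCircle L)) (fun x : ℝ => (x : AddCircle L))) _
    = 𝓝 ((a : AddCircle L), (b : AddCircle L))
  rw [← prod_map_map_eq', map_coe_nhds, map_coe_nhds, nhds_prod_eq]

lemma eventually_nhds_tc {P : Torus L → Prop} {p : ℝ × ℝ} :
    (∀ᶠ x in 𝓝 (tc L p), P x) ↔ ∀ᶠ y in 𝓝 p, P (tc L y) := by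
  rw [← map_tc_nhds, eventually_map]

lemma continuous_of_comp_tc {Y : Type*} [TopologicalSpace Y] {f : Torus L → Y}
    (hf : Continuous (fun p => f (tc L p))) : Continuous f := by
  refine continuous_iff_continuousAt.2 fun c => ?_
  obtain ⟨p, rfl⟩ := tc_surjective c
  unfold ContinuousAt
  rw [← map_tc_nhds, tendsto_map'_iff]
  exact hf.continuousAt

lemma continuous_of_comp_coe {Y : Type*} [TopologicalSpace Y] {f : AddCircle L → Y}
    (hf : Continuous (fun a : ℝ => f (a : AddCircle L))) : Continuous f := by
  refine continuous_iff_continuousAt.2 fun c => ?_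
  obtain ⟨p, rfl⟩ := QuotientAddGroup.mk_surjective c
  unfold ContinuousAt
  have := map_coe_nhds (L := L) p
  change Tendsto f (𝓝 (p : AddCircle L)) (𝓝 (f (p : AddCircle L)))
  rw [← this, tendsto_map'_iff]
  exact hf.continuousAt

lemma shift_tc (p x : ℝ × ℝ) : CordData.shift (tc L p) x = tc L (p + x) := rfl

lemma tc_add_period (p : ℝ × ℝ) (m n : ℤ) : tc L (p + (m * L, n * L)) = tc L p := by
  unfold tc
  ext
  · simp only [Prod.fst_add, AddCircle.coe_add]
    have : ((m * L : ℝ) : AddCircle L) = 0 := by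
      rw [AddCircle.coe_eq_zero_iff]; exact ⟨m, by simp⟩
    rw [this, add_zero]
  · simp only [Prod.snd_add, AddCircle.coe_add]
    have : ((n * L : ℝ) : AddCircle L) = 0 := by
      rw [AddCircle.coe_eq_zero_iff]; exact ⟨n, by simp⟩
    rw [this, add_zero]

lemma exists_period_of_coe_eq {a b : ℝ} (h : (a : AddCircle L) = b) :
    ∃ n : ℤ, b = a + n * L := by
  have := (QuotientAddGroup.eq_iff_sub_mem (x := b) (y := a)).1 h.symm
  obtain ⟨n, hn⟩ := AddSubgroup.mem_zmultiples_iff.1 this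
  exact ⟨n, by rw [zsmul_eq_mul] at hn; linarith⟩

lemma exists_period_of_tc_eq {p q : ℝ × ℝ} (h : tc L p = tc L q) :
    ∃ m n : ℤ, q = p + (m * L, n * L) := by
  obtain ⟨m, hm⟩ := exists_period_of_coe_eq (congrArg Prod.fst h)
  obtain ⟨n, hn⟩ := exists_period_of_coe_eq (congrArg Prod.snd h)
  exact ⟨m, n, Prod.ext hm hn⟩

/-- Every point of the circle has a lift within half a period of a given lift of another point, at
the distance of the two points. -/
lemma exists_lift_near (hL : 0 < L) (a : ℝ) (u : AddCircle L) :
    ∃ b : ℝ, (b : AddCircle L) = u ∧ |b - a| = ‖u - (a : AddCircle L)‖ ∧ |b - a| ≤ L / 2 := by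
  obtain ⟨x, rfl⟩ := QuotientAddGroup.mk_surjective u
  refine ⟨x - L * round (L⁻¹ * (x - a)), ?_, ?_, ?_⟩
  · rw [AddCircle.coe_sub, sub_eq_self, AddCircle.coe_eq_zero_iff]
    exact ⟨_, by rw [zsmul_eq_mul, mul_comm]⟩
  · change _ = ‖(x : AddCircle L) - (a : AddCircle L)‖
    rw [← AddCircle.coe_sub, AddCircle.norm_eq]
    congr 1; ring
  · have h1 := AddCircle.norm_eq L (x := x - a)
    have h2 := AddCircle.norm_le_half_period L hL.ne' (x := ((x - a : ℝ) : AddCircle L))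
    rw [h1, abs_of_pos hL] at h2
    convert h2 using 1
    congr 1; ring

/-! ### Derivatives -/

lemma cderiv_coe {V : Type*} [NormedAddCommGroup V] [NormedSpace ℝ V]
    (f : AddCircle L → V) (a : ℝ) :
    cderiv f (a : AddCircle L) = deriv (fun x : ℝ => f (x : AddCircle L)) a := by
  unfold cderiv
  have : (fun x : ℝ => f ((a : AddCircle L) + (x : AddCircle L)))
      = fun x : ℝ => (fun y : ℝ => f (y : AddCircle L)) (a + x) := by
    ext x; simp
  rw [this, deriv_comp_const_add (fun y : ℝ => f (y : AddCircle L)), add_zero]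

lemma dS_tc {f : Torus L → ℝ} {p : ℝ × ℝ} (hf : DifferentiableAt ℝ (fun x => f (tc L x)) p) :
    dS f (tc L p) = fderiv ℝ (fun x => f (tc L x)) p (1, 0) := by
  unfold dS
  rw [show (tc L p).1 = (p.1 : AddCircle L) from rfl, cderiv_coe]
  have h : HasDerivAt (fun x : ℝ => (x, p.2)) ((1 : ℝ), (0 : ℝ)) p.1 :=
    (hasDerivAt_id _).prodMk (hasDerivAt_const _ _)
  have hf' : HasFDerivAt (fun x => f (tc L x)) (fderiv ℝ (fun x => f (tc L x)) p) (p.1, p.2) :=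
    hf.hasFDerivAt
  exact (hf'.comp_hasDerivAt p.1 h).deriv

lemma dT_tc {f : Torus L → ℝ} {p : ℝ × ℝ} (hf : DifferentiableAt ℝ (fun x => f (tc L x)) p) :
    dT f (tc L p) = fderiv ℝ (fun x => f (tc L x)) p (0, 1) := by
  unfold dT
  rw [show (tc L p).2 = (p.2 : AddCircle L) from rfl, cderiv_coe]
  have h : HasDerivAt (fun x : ℝ => (p.1, x)) ((0 : ℝ), (1 : ℝ)) p.2 :=
    (hasDerivAt_const _ _).prodMk (hasDerivAt_id _)
  have hf' : HasFDerivAt (fun x => f (tc L x)) (fderiv ℝ (fun x => f (tc L x)) p) (p.1, p.2) :=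
    hf.hasFDerivAt
  exact (hf'.comp_hasDerivAt p.2 h).deriv

lemma fderiv_tc_apply {f : Torus L → ℝ} {p : ℝ × ℝ}
    (hf : DifferentiableAt ℝ (fun x => f (tc L x)) p) (v : ℝ × ℝ) :
    fderiv ℝ (fun x => f (tc L x)) p v = v.1 * dS f (tc L p) + v.2 * dT f (tc L p) := by
  rw [dS_tc hf, dT_tc hf, ← smul_eq_mul, ← smul_eq_mul, ← map_smul, ← map_smul, ← map_add]
  simp

/-- A function on the torus is smooth if its lift to the plane is. -/
def TSmooth (f : Torus L → ℝ) : Prop := ContDiff ℝ ∞ (fun p => f (tc L p))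

lemma TSmooth.differentiableAt {f : Torus L → ℝ} (hf : TSmooth f) (p : ℝ × ℝ) :
    DifferentiableAt ℝ (fun x => f (tc L x)) p :=
  (ContDiff.differentiable hf (by simp)).differentiableAt

lemma TSmooth.continuous {f : Torus L → ℝ} (hf : TSmooth f) : Continuous f :=
  continuous_of_comp_tc (ContDiff.continuous hf)

lemma TSmooth.dS {f : Torus L → ℝ} (hf : TSmooth f) : TSmooth (dS f) := by
  unfold TSmooth
  have : (fun p => CordAlgebra.dS f (tc L p))
      = fun p => fderiv ℝ (fun x => f (tc L x)) p (1, 0) := by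
    ext p; exact dS_tc (hf.differentiableAt p)
  rw [this]
  exact (hf.fderiv_right (m := ∞) (by simp)).clm_apply contDiff_const

lemma TSmooth.dT {f : Torus L → ℝ} (hf : TSmooth f) : TSmooth (dT f) := by
  unfold TSmooth
  have : (fun p => CordAlgebra.dT f (tc L p))
      = fun p => fderiv ℝ (fun x => f (tc L x)) p (0, 1) := by
    ext p; exact dT_tc (hf.differentiableAt p)
  rw [this]
  exact (hf.fderiv_right (m := ∞) (by simp)).clm_apply contDiff_const

lemma TSmooth.dS_dT_comm {f : Torus L → ℝ} (hf : TSmooth f) (c : Torus L) :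
    CordAlgebra.dS (CordAlgebra.dT f) c = CordAlgebra.dT (CordAlgebra.dS f) c := by
  obtain ⟨p, rfl⟩ := tc_surjective c
  rw [dS_tc (hf.dT.differentiableAt p), dT_tc (hf.dS.differentiableAt p)]
  have e1 : (fun p => CordAlgebra.dS f (tc L p))
      = fun p => fderiv ℝ (fun x => f (tc L x)) p (1, 0) := by
    ext p; exact dS_tc (hf.differentiableAt p)
  have e2 : (fun p => CordAlgebra.dT f (tc L p))
      = fun p => fderiv ℝ (fun x => f (tc L x)) p (0, 1) := by
    ext p; exact dT_tc (hf.differentiableAt p)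
  have hd : DifferentiableAt ℝ (fderiv ℝ (fun x => f (tc L x))) p :=
    ((hf.fderiv_right (m := ∞) (by simp)).differentiable (by simp)).differentiableAt
  have hsymm : IsSymmSndFDerivAt ℝ (fun x => f (tc L x)) p :=
    (ContDiff.contDiffAt hf).isSymmSndFDerivAt
      (by rw [minSmoothness_of_isRCLikeNormedField]; exact WithTop.coe_le_coe.2 le_top)
  rw [e1, e2, fderiv_clm_apply hd (differentiableAt_const _),
    fderiv_clm_apply hd (differentiableAt_const _)]
  simp [hsymm (0, 1) (1, 0)]

end Torus

/-! ### Smoothness of the knot and of the energy -/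

namespace Knot

variable {L : ℝ} (K : Knot L)

/-- The parametrization of the knot, lifted to the real line. -/
noncomputable def lift (a : ℝ) : E3 := K.γ (a : AddCircle L)

lemma contDiff_lift : ContDiff ℝ ∞ K.lift := K.smooth

lemma tan_coe (a : ℝ) : K.tan (a : AddCircle L) = deriv K.lift a := cderiv_coe _ _

lemma contDiff_deriv_lift : ContDiff ℝ ∞ (deriv K.lift) :=
  (contDiff_infty_iff_deriv.1 K.contDiff_lift).2

lemma acc_coe (a : ℝ) : K.acc (a : AddCircle L) = deriv (deriv K.lift) a := by
  rw [acc, cderiv_coe]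
  congr 1
  ext x : 1
  exact K.tan_coe x

lemma contDiff_deriv2_lift : ContDiff ℝ ∞ (deriv (deriv K.lift)) :=
  (contDiff_infty_iff_deriv.1 K.contDiff_deriv_lift).2

lemma hasDerivAt_lift (a : ℝ) : HasDerivAt K.lift (deriv K.lift a) a :=
  ((K.contDiff_lift.differentiable (by simp)).differentiableAt).hasDerivAt

lemma hasDerivAt_deriv_lift (a : ℝ) : HasDerivAt (deriv K.lift) (deriv (deriv K.lift) a) a :=
  ((K.contDiff_deriv_lift.differentiable (by simp)).differentiableAt).hasDerivAt

lemma norm_tan (s : AddCircle L) : ‖K.tan s‖ = 1 := K.arclength s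

lemma norm_deriv_lift (a : ℝ) : ‖deriv K.lift a‖ = 1 := by rw [← K.tan_coe, K.norm_tan]

lemma inner_tan_self (s : AddCircle L) : inner ℝ (K.tan s) (K.tan s) = 1 := by
  rw [real_inner_self_eq_norm_sq, K.norm_tan]; norm_num

lemma inner_acc_tan (s : AddCircle L) : inner ℝ (K.acc s) (K.tan s) = 0 := by
  obtain ⟨a, rfl⟩ := QuotientAddGroup.mk_surjective s
  rw [K.acc_coe, K.tan_coe]
  have h1 := (K.hasDerivAt_deriv_lift a).inner ℝ (K.hasDerivAt_deriv_lift a)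
  have h2 : (fun t => inner ℝ (deriv K.lift t) (deriv K.lift t)) = fun _ => (1 : ℝ) := by
    ext t; rw [real_inner_self_eq_norm_sq, K.norm_deriv_lift]; norm_num
  rw [h2] at h1
  have h3 := h1.unique (hasDerivAt_const a (1 : ℝ))
  rw [real_inner_comm (deriv (deriv K.lift) a) (deriv K.lift a)] at h3
  linarith

lemma continuous_γ : Continuous K.γ := continuous_of_comp_coe K.contDiff_lift.continuous

lemma continuous_tan : Continuous K.tan := by
  refine continuous_of_comp_coe ?_
  simp only [K.tan_coe]
  exact K.contDiff_deriv_lift.continuous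

lemma continuous_chord : Continuous K.chord :=
  (K.continuous_γ.comp continuous_snd).sub (K.continuous_γ.comp continuous_fst)

lemma chord_tc (p : ℝ × ℝ) : K.chord (tc L p) = K.lift p.2 - K.lift p.1 := rfl

lemma chord_swap (c : Torus L) : K.chord c.swap = -K.chord c := by
  simp [chord]

lemma chord_ne_zero {c : Torus L} (h : c.1 ≠ c.2) : K.chord c ≠ 0 := by
  intro h0
  exact h (K.injective (sub_eq_zero.1 h0).symm)

lemma energy_eq (c : Torus L) : K.energy c = (1 / 2) * ‖K.chord c‖ ^ 2 := by
  rw [energy, chord, norm_sub_rev]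

lemma energy_swap (c : Torus L) : K.energy c.swap = K.energy c := by
  rw [energy_eq, energy_eq, chord_swap, norm_neg]

lemma tsmooth_energy : TSmooth K.energy := by
  unfold TSmooth energy
  have h : ContDiff ℝ ∞ (fun p : ℝ × ℝ => K.lift p.1 - K.lift p.2) :=
    (K.contDiff_lift.comp contDiff_fst).sub (K.contDiff_lift.comp contDiff_snd)
  exact contDiff_const.mul (h.norm_sq ℝ)

lemma dS_energy (c : Torus L) : dS K.energy c = -inner ℝ (K.chord c) (K.tan c.1) := by
  obtain ⟨⟨a, b⟩, rfl⟩ := tc_surjective c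
  unfold dS
  change cderiv _ (a : AddCircle L) = - inner ℝ _ (K.tan (a : AddCircle L))
  rw [cderiv_coe, K.tan_coe]
  have h : HasDerivAt (fun x => K.lift x - K.lift b) (deriv K.lift a) a :=
    (K.hasDerivAt_lift a).sub_const _
  have h2 := (h.norm_sq).const_mul (1 / 2 : ℝ)
  change deriv (fun x => (1 / 2 : ℝ) * ‖K.lift x - K.lift b‖ ^ 2) a = _
  rw [h2.deriv, chord_tc, ← inner_neg_left]
  simp

lemma dT_energy (c : Torus L) : dT K.energy c = inner ℝ (K.chord c) (K.tan c.2) := by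
  obtain ⟨⟨a, b⟩, rfl⟩ := tc_surjective c
  unfold dT
  change cderiv _ (b : AddCircle L) = inner ℝ _ (K.tan (b : AddCircle L))
  rw [cderiv_coe, K.tan_coe]
  have h : HasDerivAt (fun x => K.lift a - K.lift x) (-deriv K.lift b) b :=
    (K.hasDerivAt_lift b).const_sub _
  have h2 := (h.norm_sq).const_mul (1 / 2 : ℝ)
  change deriv (fun x => (1 / 2 : ℝ) * ‖K.lift a - K.lift x‖ ^ 2) b = _
  rw [h2.deriv, chord_tc, inner_neg_right, ← inner_neg_left]
  simp

end Knot

namespace CordData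

variable {L : ℝ} {K : Knot L} (X : CordData K)

lemma tsmooth_h : TSmooth X.h := X.h_smooth

lemma tsmooth_E : TSmooth X.E := ContDiff.add K.tsmooth_energy X.tsmooth_h

lemma dS_E (c : Torus L) : dS X.E c = dS K.energy c + dS X.h c := by
  obtain ⟨p, rfl⟩ := tc_surjective c
  have h1 := K.tsmooth_energy.differentiableAt p
  have h2 := X.tsmooth_h.differentiableAt p
  rw [dS_tc h1, dS_tc h2, dS_tc (X.tsmooth_E.differentiableAt p)]
  have : (fun x => X.E (tc L x)) = (fun x => K.energy (tc L x)) + fun x => X.h (tc L x) := rfl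
  rw [this, fderiv_add h1 h2]; rfl

lemma continuous_E : Continuous X.E := X.tsmooth_E.continuous

lemma continuous_vel : Continuous X.vel :=
  (X.tsmooth_E.dS.continuous.neg).prodMk (X.tsmooth_E.dT.continuous.neg)

/-- The negative gradient, lifted to the plane. -/
noncomputable def lvel (p : ℝ × ℝ) : ℝ × ℝ := X.vel (tc L p)

lemma contDiff_lvel : ContDiff ℝ ∞ X.lvel :=
  (ContDiff.neg X.tsmooth_E.dS).prodMk (ContDiff.neg X.tsmooth_E.dT)

lemma vel_eq_zero_iff (c : Torus L) : X.vel c = 0 ↔ IsCrit X.E c := by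
  simp [vel, IsCrit, Prod.ext_iff]

end CordData
/-! ### Global flows of bounded Lipschitz vector fields -/

section ODE

variable {E : Type*} [NormedAddCommGroup E] [NormedSpace ℝ E]

/-- A bounded Lipschitz vector field has global integral curves. They are glued from solutions on growing
intervals, which the Picard–Lindelöf theorem provides because of the bound. -/
lemma exists_global_solution [CompleteSpace E] {v : E → E} {M K : NNReal} (hb : ∀ x, ‖v x‖ ≤ M)
    (hl : LipschitzWith K v) (p : E) :
    ∃ x : ℝ → E, x 0 = p ∧ ∀ τ, HasDerivAt x (v (x τ)) τ := by
  have hex : ∀ n : ℕ, ∃ α : ℝ → E, α 0 = p ∧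
      ∀ t ∈ Icc (-(n + 1 : ℝ)) (n + 1), HasDerivWithinAt α (v (α t)) (Icc (-(n + 1 : ℝ)) (n + 1)) t := by
    intro n
    have hpos : (0 : ℝ) ≤ n + 1 := by positivity
    have h0 : (0 : ℝ) ∈ Icc (-(n + 1 : ℝ)) (n + 1) := ⟨by linarith, hpos⟩
    have hpl : IsPicardLindelof (fun _ => v) (tmin := -(n + 1 : ℝ)) (tmax := n + 1) ⟨0, h0⟩ p
        (M * (n + 1)) 0 M K := by
      refine IsPicardLindelof.of_time_independent (fun x _ => hb x) hl.lipschitzOnWith ?_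
      simp
    exact hpl.exists_eq_forall_mem_Icc_hasDerivWithinAt₀
  choose α h0 hα using hex
  have hd : ∀ n : ℕ, ∀ t ∈ Ioo (-(n + 1 : ℝ)) (n + 1), HasDerivAt (α n) (v (α n t)) t :=
    fun n t ht => (hα n t (Ioo_subset_Icc_self ht)).hasDerivAt (Icc_mem_nhds ht.1 ht.2)
  have heq : ∀ m n : ℕ, m ≤ n → EqOn (α m) (α n) (Ioo (-(m + 1 : ℝ)) (m + 1)) := by
    intro m n hmn
    have hmn' : (m : ℝ) ≤ n := by exact_mod_cast hmn
    have hm0 : (0 : ℝ) ≤ m := by positivity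
    refine ODE_solution_unique_of_mem_Ioo (v := fun _ => v) (s := fun _ => univ) (K := K)
      (t₀ := 0) (fun t _ => hl.lipschitzOnWith) ⟨by linarith, by linarith⟩
      (fun t ht => ⟨hd m t ht, trivial⟩) (fun t ht => ⟨hd n t ?_, trivial⟩) ?_
    · exact ⟨by linarith [ht.1], by linarith [ht.2]⟩
    · rw [h0, h0]
  have hmem : ∀ σ : ℝ, σ ∈ Ioo (-((⌈|σ|⌉₊ : ℝ) + 1)) ((⌈|σ|⌉₊ : ℝ) + 1) := by
    intro σ
    have := Nat.le_ceil |σ|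
    have h1 := abs_le.1 this
    exact ⟨by linarith [h1.1], by linarith [h1.2]⟩
  refine ⟨fun τ => α ⌈|τ|⌉₊ τ, ?_, ?_⟩
  · simp [h0]
  · intro τ
    set N := ⌈|τ|⌉₊ + 1 with hN
    have hNτ : τ ∈ Ioo (-((N : ℝ) + 1)) (N + 1) := by
      have := hmem τ
      rw [hN]; push_cast
      exact ⟨by linarith [this.1], by linarith [this.2]⟩
    have e1 : α ⌈|τ|⌉₊ τ = α N τ := heq _ _ (by omega) (hmem τ)
    have e2 : (fun σ : ℝ => α ⌈|σ|⌉₊ σ) =ᶠ[𝓝 τ] α N := by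
      have : ∀ᶠ σ : ℝ in 𝓝 τ, |σ| < N := by
        refine (continuous_abs.tendsto τ).eventually_lt_const ?_
        have := Nat.le_ceil |τ|
        rw [hN]; push_cast; linarith
      filter_upwards [this] with σ hσ
      exact heq _ _ (Nat.ceil_le.2 hσ.le) (hmem σ)
    have e3 := (hd N τ hNτ).congr_of_eventuallyEq e2
    rw [← e1] at e3
    exact e3

/-- Grönwall's estimate in both directions of time; the past is reduced to the future by time reversal. -/
lemma dist_solutions_le {v : E → E} {K : NNReal} (hl : LipschitzWith K v) {x y : ℝ → E}
    (hx : ∀ τ, HasDerivAt x (v (x τ)) τ) (hy : ∀ τ, HasDerivAt y (v (y τ)) τ) (τ : ℝ) :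
    dist (x τ) (y τ) ≤ dist (x 0) (y 0) * Real.exp (K * |τ|) := by
  have key : ∀ (w : E → E) (_ : LipschitzWith K w) (f g : ℝ → E)
      (_ : ∀ τ, HasDerivAt f (w (f τ)) τ) (_ : ∀ τ, HasDerivAt g (w (g τ)) τ) (t : ℝ), 0 ≤ t →
      dist (f t) (g t) ≤ dist (f 0) (g 0) * Real.exp (K * t) := by
    intro w hw f g hf hg t ht
    have := dist_le_of_trajectories_ODE (v := fun _ => w) (K := K) (a := 0) (b := t)
      (fun _ => hw) (fun s _ => (hf s).continuousAt.continuousWithinAt)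
      (fun s _ => (hf s).hasDerivWithinAt) (fun s _ => (hg s).continuousAt.continuousWithinAt)
      (fun s _ => (hg s).hasDerivWithinAt) le_rfl t ⟨ht, le_rfl⟩
    simpa using this
  rcases le_total 0 τ with h | h
  · rw [abs_of_nonneg h]; exact key v hl x y hx hy τ h
  · have hneg : ∀ z : ℝ → E, (∀ τ, HasDerivAt z (v (z τ)) τ) →
        ∀ τ, HasDerivAt (fun s => z (-s)) ((fun e => -v e) (z (-τ))) τ := by
      intro z hz τ
      have := (hz (-τ)).scomp τ (hasDerivAt_neg τ)
      rw [neg_one_smul] at this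
      exact this
    have := key (fun e => -v e) hl.neg (fun s => x (-s)) (fun s => y (-s)) (hneg x hx) (hneg y hy)
      (-τ) (by linarith)
    rw [abs_of_nonpos h]
    simpa using this

end ODE

/-! ### The negative gradient flow -/

namespace CordData

variable {L : ℝ} {K : Knot L} (X : CordData K)

lemma bounded_of_periodic {Y : Type*} [NormedAddCommGroup Y] (hL : 0 < L) {F : ℝ × ℝ → Y}
    (hF : Continuous F) (hper : ∀ p q, tc L p = tc L q → F p = F q) :
    ∃ M : NNReal, ∀ p, ‖F p‖ ≤ M := by
  obtain ⟨M, hM⟩ := (isCompact_Icc (a := ((0 : ℝ), (0 : ℝ))) (b := (L, L))).exists_bound_of_continuousOn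
    hF.continuousOn
  refine ⟨M.toNNReal, fun p => ?_⟩
  have : Fact (0 < L) := ⟨hL⟩
  have hco : ∀ a : ℝ, ∃ b ∈ Icc 0 L, (b : AddCircle L) = a := by
    intro a
    have := AddCircle.coe_image_Icc_eq L 0
    rw [zero_add] at this
    have h2 : (a : AddCircle L) ∈ ((↑) : ℝ → AddCircle L) '' Icc 0 L := by rw [this]; trivial
    obtain ⟨b, hb, hb'⟩ := h2
    exact ⟨b, hb, hb'⟩
  obtain ⟨a, ha, ha'⟩ := hco p.1
  obtain ⟨b, hb, hb'⟩ := hco p.2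
  rw [hper p (a, b) (Prod.ext ha'.symm hb'.symm)]
  exact (hM (a, b) ⟨⟨ha.1, hb.1⟩, ⟨ha.2, hb.2⟩⟩).trans (Real.le_coe_toNNReal M)

lemma lvel_congr {p q : ℝ × ℝ} (h : tc L p = tc L q) : X.lvel p = X.lvel q := by
  unfold lvel; rw [h]

lemma exists_bound_lvel : ∃ M : NNReal, ∀ p, ‖X.lvel p‖ ≤ M :=
  bounded_of_periodic K.length_pos X.contDiff_lvel.continuous fun _ _ => X.lvel_congr

lemma exists_lipschitz_lvel : ∃ M : NNReal, LipschitzWith M X.lvel := by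
  have hd : Differentiable ℝ X.lvel := X.contDiff_lvel.differentiable (by simp)
  obtain ⟨M, hM⟩ := bounded_of_periodic K.length_pos (F := fderiv ℝ X.lvel)
    (X.contDiff_lvel.continuous_fderiv (by simp)) (by
      intro p q h
      obtain ⟨m, n, rfl⟩ := exists_period_of_tc_eq h
      have : X.lvel = fun x => X.lvel (x + (m * L, n * L)) := by
        ext1 x; exact X.lvel_congr (tc_add_period x m n).symm
      conv_lhs => rw [this]
      exact fderiv_comp_add_right _)
  exact ⟨M, lipschitzWith_of_nnnorm_fderiv_le hd fun x => by exact_mod_cast hM x⟩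

/-- The displacement along the trajectory of `c`. -/
noncomputable def traj (c : Torus L) : ℝ → ℝ × ℝ :=
  Classical.epsilon (fun x : ℝ → ℝ × ℝ => X.IsTrajectory c x)

lemma isTrajectory_tc_iff (p : ℝ × ℝ) (x : ℝ → ℝ × ℝ) :
    X.IsTrajectory (tc L p) x ↔ x 0 = 0 ∧ ∀ τ, HasDerivAt (fun τ => p + x τ) (X.lvel (p + x τ)) τ := by
  unfold IsTrajectory
  refine and_congr_right fun _ => forall_congr' fun τ => ?_
  rw [hasDerivAt_const_add_iff, shift_tc]; rfl

lemma isTrajectory_traj (c : Torus L) : X.IsTrajectory c (X.traj c) := by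
  refine Classical.epsilon_spec (p := fun x : ℝ → ℝ × ℝ => X.IsTrajectory c x) ?_
  obtain ⟨p, rfl⟩ := tc_surjective c
  obtain ⟨M, hM⟩ := X.exists_bound_lvel
  obtain ⟨K', hK⟩ := X.exists_lipschitz_lvel
  obtain ⟨x, hx0, hx⟩ := exists_global_solution hM hK p
  refine ⟨fun τ => x τ - p, (X.isTrajectory_tc_iff _ _).2 ⟨by simp [hx0], fun τ => ?_⟩⟩
  simpa using hx τ

/-- The flow of `-∇E`, lifted to the plane. -/
noncomputable def lflow (τ : ℝ) (p : ℝ × ℝ) : ℝ × ℝ := p + X.traj (tc L p) τ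

lemma flow_tc (τ : ℝ) (p : ℝ × ℝ) : X.flow τ (tc L p) = tc L (X.lflow τ p) := rfl

lemma lflow_zero (p : ℝ × ℝ) : X.lflow 0 p = p := by
  simp [lflow, (X.isTrajectory_traj (tc L p)).1]

lemma flow_zero (c : Torus L) : X.flow 0 c = c := by
  obtain ⟨p, rfl⟩ := tc_surjective c
  rw [flow_tc, lflow_zero]

lemma hasDerivAt_lflow (p : ℝ × ℝ) (τ : ℝ) :
    HasDerivAt (fun τ => X.lflow τ p) (X.lvel (X.lflow τ p)) τ :=
  ((X.isTrajectory_tc_iff p _).1 (X.isTrajectory_traj (tc L p))).2 τ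

lemma eq_lflow {x : ℝ → ℝ × ℝ} (hx : ∀ τ, HasDerivAt x (X.lvel (x τ)) τ) (τ : ℝ) :
    x τ = X.lflow τ (x 0) := by
  obtain ⟨K', hK⟩ := X.exists_lipschitz_lvel
  have := dist_solutions_le hK hx (X.hasDerivAt_lflow (x 0)) τ
  rw [lflow_zero, dist_self, zero_mul] at this
  exact dist_le_zero.1 this

lemma lflow_add (σ τ : ℝ) (p : ℝ × ℝ) : X.lflow (τ + σ) p = X.lflow τ (X.lflow σ p) := by
  have h : ∀ t, HasDerivAt (fun t => X.lflow (t + σ) p) (X.lvel (X.lflow (t + σ) p)) t := by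
    intro t
    exact (X.hasDerivAt_lflow p (t + σ)).comp_add_const t σ
  have := X.eq_lflow h τ
  simpa using this

lemma flow_add (σ τ : ℝ) (c : Torus L) : X.flow (τ + σ) c = X.flow τ (X.flow σ c) := by
  obtain ⟨p, rfl⟩ := tc_surjective c
  rw [flow_tc, flow_tc, flow_tc, lflow_add]

lemma continuous_lflow : Continuous (fun x : ℝ × (ℝ × ℝ) => X.lflow x.1 x.2) := by
  obtain ⟨K', hK⟩ := X.exists_lipschitz_lvel
  refine continuous_iff_continuousAt.2 fun ⟨τ, p⟩ => ?_
  have h1 : Tendsto (fun x : ℝ × (ℝ × ℝ) => X.lflow x.1 p) (𝓝 (τ, p)) (𝓝 (X.lflow τ p)) :=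
    ((X.hasDerivAt_lflow p τ).continuousAt.tendsto).comp continuousAt_fst
  refine tendsto_iff_dist_tendsto_zero.2 ?_
  have h2 : Tendsto (fun x : ℝ × (ℝ × ℝ) => dist x.2 p * Real.exp (K' * |x.1|)
      + dist (X.lflow x.1 p) (X.lflow τ p)) (𝓝 (τ, p)) (𝓝 0) := by
    have h3 : Tendsto (fun x : ℝ × (ℝ × ℝ) => dist x.2 p * Real.exp (K' * |x.1|)) (𝓝 (τ, p))
        (𝓝 (dist p p * Real.exp (K' * |τ|))) := by
      have : Continuous (fun x : ℝ × (ℝ × ℝ) => dist x.2 p * Real.exp (K' * |x.1|)) := by fun_prop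
      exact this.tendsto (τ, p)
    have := h3.add (tendsto_iff_dist_tendsto_zero.1 h1)
    simpa using this
  refine squeeze_zero (fun _ => dist_nonneg) (fun x => ?_) h2
  refine (dist_triangle _ (X.lflow x.1 p) _).trans (add_le_add ?_ le_rfl)
  have := dist_solutions_le hK (X.hasDerivAt_lflow x.2) (X.hasDerivAt_lflow p) x.1
  simpa [lflow_zero] using this

lemma continuous_flow : Continuous (fun x : ℝ × Torus L => X.flow x.1 x.2) := by
  refine continuous_iff_continuousAt.2 fun ⟨τ, c⟩ => ?_
  obtain ⟨p, rfl⟩ := tc_surjective c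
  unfold ContinuousAt
  rw [nhds_prod_eq, ← map_tc_nhds, ← Filter.map_id (f := 𝓝 τ), prod_map_map_eq', tendsto_map'_iff,
    ← nhds_prod_eq]
  exact (continuous_tc.comp X.continuous_lflow).continuousAt

lemma continuous_flow_left (c : Torus L) : Continuous (fun τ => X.flow τ c) :=
  Continuous.comp (g := fun x : ℝ × Torus L => X.flow x.1 x.2) (f := fun τ => (τ, c))
    X.continuous_flow (continuous_id.prodMk continuous_const)

lemma continuous_flow_right (τ : ℝ) : Continuous (X.flow τ) :=
  Continuous.comp (g := fun x : ℝ × Torus L => X.flow x.1 x.2) (f := fun c => (τ, c))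
    X.continuous_flow (continuous_const.prodMk continuous_id)

/-- The squared length of the gradient. -/
noncomputable def gradSq (c : Torus L) : ℝ := (X.vel c).1 ^ 2 + (X.vel c).2 ^ 2

lemma gradSq_nonneg (c : Torus L) : 0 ≤ X.gradSq c := by unfold gradSq; positivity

lemma gradSq_eq_zero_iff (c : Torus L) : X.gradSq c = 0 ↔ IsCrit X.E c := by
  rw [← vel_eq_zero_iff, gradSq, Prod.ext_iff]
  constructor
  · intro h
    constructor <;> simp <;> nlinarith [sq_nonneg (X.vel c).1, sq_nonneg (X.vel c).2]
  · rintro ⟨h1, h2⟩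
    rw [h1, h2]; simp

lemma sq_norm_vel_le (c : Torus L) : ‖X.vel c‖ ^ 2 ≤ X.gradSq c := by
  unfold gradSq
  rw [Prod.norm_def]
  rcases max_choice ‖(X.vel c).1‖ ‖(X.vel c).2‖ with h | h <;> rw [h, Real.norm_eq_abs, sq_abs]
  · nlinarith [sq_nonneg (X.vel c).2]
  · nlinarith [sq_nonneg (X.vel c).1]

lemma hasDerivAt_comp_lflow {f : Torus L → ℝ} (hf : TSmooth f) (p : ℝ × ℝ) (τ : ℝ) :
    HasDerivAt (fun τ => f (X.flow τ (tc L p))) (X.along f (X.flow τ (tc L p))) τ := by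
  have h := (hf.differentiableAt (X.lflow τ p)).hasFDerivAt.comp_hasDerivAt τ (X.hasDerivAt_lflow p τ)
  rw [fderiv_tc_apply (hf.differentiableAt _)] at h
  exact h

lemma hasDerivAt_E_flow (c : Torus L) (τ : ℝ) :
    HasDerivAt (fun τ => X.E (X.flow τ c)) (-X.gradSq (X.flow τ c)) τ := by
  obtain ⟨p, rfl⟩ := tc_surjective c
  convert X.hasDerivAt_comp_lflow X.tsmooth_E p τ using 1
  simp only [gradSq, along, vel]; ring

lemma antitone_E_flow (c : Torus L) : Antitone (fun τ => X.E (X.flow τ c)) :=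
  antitone_of_deriv_nonpos (fun τ => (X.hasDerivAt_E_flow c τ).differentiableAt) fun τ => by
    rw [(X.hasDerivAt_E_flow c τ).deriv]; linarith [X.gradSq_nonneg (X.flow τ c)]

lemma E_flow_le {c : Torus L} {τ : ℝ} (h : 0 ≤ τ) : X.E (X.flow τ c) ≤ X.E c := by
  have := X.antitone_E_flow c h
  simpa [flow_zero] using this

lemma flow_of_isCrit {c : Torus L} (h : IsCrit X.E c) (τ : ℝ) : X.flow τ c = c := by
  obtain ⟨p, rfl⟩ := tc_surjective c
  have hv : X.lvel p = 0 := (X.vel_eq_zero_iff _).2 h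
  have := X.eq_lflow (x := fun _ => p) (fun τ => by simpa [hv] using hasDerivAt_const τ p) τ
  rw [flow_tc, ← this]

lemma isCrit_of_isCrit_flow {c : Torus L} {τ : ℝ} (h : IsCrit X.E (X.flow τ c)) : X.flow τ c = c := by
  have := X.flow_of_isCrit h (-τ)
  rw [← flow_add, neg_add_cancel, flow_zero] at this
  exact this.symm

/-! ### The symmetry that reverses cords -/

/-- The framed knot with the perturbation composed with the reversal of cords. -/
def swap : CordData K where
  ν := X.ν
  ν_smooth := X.ν_smooth
  ν_unit := X.ν_unit
  ν_normal := X.ν_normal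
  h c := X.h c.swap
  h_smooth := X.h_smooth.comp (contDiff_snd.prodMk contDiff_fst)

lemma swap_E : X.swap.E = fun c => X.E c.swap := by
  ext c; simp only [E, swap]; rw [K.energy_swap]

lemma swap_vel (c : Torus L) : X.swap.vel c.swap = (X.vel c).swap := by
  unfold vel; rw [swap_E]; rfl

lemma swap_flow (τ : ℝ) (c : Torus L) : X.swap.flow τ c.swap = (X.flow τ c).swap := by
  obtain ⟨p, rfl⟩ := tc_surjective c
  have h : ∀ t, HasDerivAt (fun t => (X.lflow t p).swap) (X.swap.lvel (X.lflow t p).swap) t := by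
    intro t
    have h1 : X.swap.lvel (X.lflow t p).swap = (X.lvel (X.lflow t p)).swap := by
      unfold lvel; exact X.swap_vel (tc L (X.lflow t p))
    rw [h1]
    have := X.hasDerivAt_lflow p t
    exact this.snd.prodMk this.fst
  have := X.swap.eq_lflow h τ
  simp only [lflow_zero] at this
  change tc L (X.swap.lflow τ p.swap) = tc L (X.lflow τ p).swap
  rw [← this]

lemma swap_perturbationLT {ε : ℝ} (h : X.PerturbationLT ε) : X.swap.PerturbationLT ε := by
  intro c
  have := h c.swap
  exact ⟨this.1, this.2.2, this.2.1⟩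

end CordData
/-! ### Nondegenerate critical points -/

section Hessian

variable {L : ℝ}

lemma hasFDerivAt_tc {f : Torus L → ℝ} (hf : TSmooth f) (p : ℝ × ℝ) :
    HasFDerivAt (fun x => f (tc L x)) (dS f (tc L p) • ContinuousLinearMap.fst ℝ ℝ ℝ +
      dT f (tc L p) • ContinuousLinearMap.snd ℝ ℝ ℝ) p := by
  convert (hf.differentiableAt p).hasFDerivAt using 1
  ext <;> simp [dS_tc (hf.differentiableAt p), dT_tc (hf.differentiableAt p)]

lemma det_hessian (f : Torus L → ℝ) (c : Torus L) :
    (hessian f c).det = dS (dS f) c * dT (dT f) c - dS (dT f) c * dT (dS f) c := by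
  rw [hessian, Matrix.det_fin_two_of]

lemma hessian_neg (f : Torus L → ℝ) (c : Torus L) :
    hessian (fun x => -f x) c = -hessian f c := by
  have h1 : dS (fun x => -f x) = fun x => -dS f x := by
    ext x; unfold dS cderiv; exact deriv.fun_neg
  have h2 : dT (fun x => -f x) = fun x => -dT f x := by
    ext x; unfold dT cderiv; exact deriv.fun_neg
  have h3 : ∀ g : Torus L → ℝ, dS (fun x => -g x) c = -dS g c := by
    intro g; unfold dS cderiv; exact deriv.fun_neg
  have h4 : ∀ g : Torus L → ℝ, dT (fun x => -g x) c = -dT g c := by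
    intro g; unfold dT cderiv; exact deriv.fun_neg
  rw [hessian, hessian, h1, h2, h3, h3, h4, h4]
  ext i j; fin_cases i <;> fin_cases j <;> rfl

lemma posDef_hessian {f : Torus L → ℝ} (hf : TSmooth f) {c : Torus L} (h0 : 0 < dS (dS f) c)
    (hdet : 0 < (hessian f c).det) : (hessian f c).PosDef := by
  rw [det_hessian, hf.dS_dT_comm] at hdet
  refine Matrix.PosDef.of_dotProduct_mulVec_pos ?_ ?_
  · ext i j
    fin_cases i <;> fin_cases j <;> simp [hessian, hf.dS_dT_comm]
  · intro x hx
    have hx' : x 0 ≠ 0 ∨ x 1 ≠ 0 := by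
      by_contra h
      push Not at h
      apply hx
      ext i; fin_cases i
      · exact h.1
      · exact h.2
    simp only [hessian, dotProduct, Matrix.mulVec, Fin.sum_univ_two, hf.dS_dT_comm]
    simp only [Matrix.of_apply, Matrix.cons_val', Matrix.cons_val_zero, Matrix.cons_val_one,
      Pi.star_apply, star_trivial, Matrix.cons_val_fin_one]
    set a := dS (dS f) c
    set b := dT (dS f) c
    set d := dT (dT f) c
    have key : a * (x 0 * (a * x 0 + b * x 1) + x 1 * (b * x 0 + d * x 1))
        = (a * x 0 + b * x 1) ^ 2 + (a * d - b * b) * x 1 ^ 2 := by ring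
    refine (mul_pos_iff_of_pos_left h0).1 ?_
    rw [key]
    by_cases h1 : x 1 = 0
    · have h2 : x 0 ≠ 0 := by simpa [h1] using hx'
      rw [h1]
      have : 0 < (a * x 0) ^ 2 := by positivity
      simpa using this
    · have : 0 < (a * d - b * b) * x 1 ^ 2 := by positivity
      positivity

/-- Near a critical point with positive definite Hessian the gradient points outwards. -/
lemma gradient_outward {f : Torus L → ℝ} (hf : TSmooth f) {p₀ : ℝ × ℝ}
    (hc : IsCrit f (tc L p₀)) (hpos : (hessian f (tc L p₀)).PosDef) :
    ∀ᶠ x in 𝓝 p₀, x ≠ p₀ →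
      0 < (x.1 - p₀.1) * dS f (tc L x) + (x.2 - p₀.2) * dT f (tc L x) := by
  have ha : 0 < dS (dS f) (tc L p₀) := by simpa [hessian] using hpos.diag_pos (i := 0)
  have hd : 0 < dT (dT f) (tc L p₀) := by simpa [hessian] using hpos.diag_pos (i := 1)
  have hdet := hpos.det_pos
  rw [det_hessian, hf.dS_dT_comm] at hdet
  have hS := (hasFDerivAt_tc hf.dS p₀).isLittleO
  have hT := (hasFDerivAt_tc hf.dT p₀).isLittleO
  rw [hf.dS_dT_comm] at hT
  set a := dS (dS f) (tc L p₀)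
  set b := dT (dS f) (tc L p₀)
  set d := dT (dT f) (tc L p₀)
  set l := (a * d - b * b) / (a + d) with hl
  have hl0 : 0 < l := by positivity
  have hl' : l * (a + d) = a * d - b * b := by rw [hl]; field_simp
  filter_upwards [hS.def (c := l / 4) (by positivity), hT.def (c := l / 4) (by positivity)]
    with x h1 h2 hx
  rw [hc.1] at h1
  rw [hc.2] at h2
  set u := x.1 - p₀.1 with hu
  set v := x.2 - p₀.2 with hv
  have hn : ‖x - p₀‖ = max |u| |v| := rfl
  have h1' : |dS f (tc L x) - (a * u + b * v)| ≤ l / 4 * max |u| |v| := by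
    rw [← hn]; simpa using h1
  have h2' : |dT f (tc L x) - (b * u + d * v)| ≤ l / 4 * max |u| |v| := by
    rw [← hn]; simpa using h2
  set m := max |u| |v| with hm
  have hum : |u| ≤ m := le_max_left _ _
  have hvm : |v| ≤ m := le_max_right _ _
  have hm0 : 0 < m := by
    rw [← hn]; exact norm_pos_iff.2 (sub_ne_zero.2 hx)
  have hm2 : m ^ 2 ≤ u ^ 2 + v ^ 2 := by
    rcases max_choice |u| |v| with h | h <;> rw [hm, h, sq_abs]
    · nlinarith [sq_nonneg v]
    · nlinarith [sq_nonneg u]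
  have e1 : |u * (dS f (tc L x) - (a * u + b * v))| ≤ m * (l / 4 * m) := by
    rw [abs_mul]; gcongr
  have e2 : |v * (dT f (tc L x) - (b * u + d * v))| ≤ m * (l / 4 * m) := by
    rw [abs_mul]; gcongr
  -- the quadratic form of the Hessian is at least `l * |x - p₀| ^ 2`
  have hq : l * (u ^ 2 + v ^ 2) ≤ u * (a * u + b * v) + v * (b * u + d * v) := by
    have hA : 0 < a - l := by
      have : (a - l) * (a + d) = a * a + b * b := by nlinarith
      refine pos_of_mul_pos_left (b := a + d) ?_ (by positivity)
      rw [this]; nlinarith [mul_pos ha ha, mul_self_nonneg b]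
    have hD : (a - l) * (d - l) - b * b = l ^ 2 := by nlinarith
    have key : (a - l) * (u * (a * u + b * v) + v * (b * u + d * v) - l * (u ^ 2 + v ^ 2))
        = ((a - l) * u + b * v) ^ 2 + ((a - l) * (d - l) - b * b) * v ^ 2 := by ring
    have : 0 ≤ (a - l) * (u * (a * u + b * v) + v * (b * u + d * v) - l * (u ^ 2 + v ^ 2)) := by
      rw [key, hD]; positivity
    have := nonneg_of_mul_nonneg_right this hA
    linarith
  have e1' := (abs_le.1 e1).1
  have e2' := (abs_le.1 e2).1
  nlinarith [mul_pos hl0 (pow_pos hm0 2)]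

/-- A critical point with positive definite Hessian is a strict local minimum. -/
lemma strict_local_min {f : Torus L → ℝ} (hf : TSmooth f) {c : Torus L}
    (hc : IsCrit f c) (hpos : (hessian f c).PosDef) :
    ∀ᶠ x in 𝓝 c, x ≠ c → f c < f x := by
  obtain ⟨p₀, rfl⟩ := tc_surjective c
  rw [eventually_nhds_tc]
  obtain ⟨r, hr, hball⟩ := Metric.eventually_nhds_iff_ball.1 (gradient_outward hf hc hpos)
  filter_upwards [Metric.ball_mem_nhds p₀ hr] with x hx hne
  have hne' : x ≠ p₀ := fun h => hne (by rw [h])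
  set g : ℝ → ℝ := fun t => f (tc L (p₀ + t • (x - p₀))) with hg
  have hder : ∀ t, HasDerivAt g ((x.1 - p₀.1) * dS f (tc L (p₀ + t • (x - p₀)))
      + (x.2 - p₀.2) * dT f (tc L (p₀ + t • (x - p₀)))) t := by
    intro t
    have h1 : HasDerivAt (fun t : ℝ => p₀ + t • (x - p₀)) (x - p₀) t := by
      simpa using ((hasDerivAt_id t).smul_const (x - p₀)).const_add p₀
    have := (hf.differentiableAt (p₀ + t • (x - p₀))).hasFDerivAt.comp_hasDerivAt t h1
    rw [fderiv_tc_apply (hf.differentiableAt _)] at this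
    exact this
  have hmono : StrictMonoOn g (Icc 0 1) := by
    refine strictMonoOn_of_deriv_pos (convex_Icc 0 1)
      (fun t _ => (hder t).continuousAt.continuousWithinAt) fun t ht => ?_
    rw [interior_Icc] at ht
    rw [(hder t).deriv]
    have hmem : p₀ + t • (x - p₀) ∈ Metric.ball p₀ r := by
      rw [Metric.mem_ball, dist_eq_norm, add_sub_cancel_left, norm_smul, Real.norm_eq_abs,
        abs_of_pos ht.1]
      rw [Metric.mem_ball, dist_eq_norm] at hx
      nlinarith [ht.2, norm_nonneg (x - p₀), ht.1]
    have hne2 : p₀ + t • (x - p₀) ≠ p₀ := by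
      intro h
      have := add_eq_left.1 h
      rcases smul_eq_zero.1 this with h | h
      · exact ht.1.ne' h
      · exact hne' (sub_eq_zero.1 h)
    have := hball _ hmem hne2
    have e1 : (p₀ + t • (x - p₀)).1 - p₀.1 = t * (x.1 - p₀.1) := by simp
    have e2 : (p₀ + t • (x - p₀)).2 - p₀.2 = t * (x.2 - p₀.2) := by simp
    rw [e1, e2, mul_assoc, mul_assoc, ← mul_add] at this
    exact pos_of_mul_pos_right this ht.1.le
  have := hmono (left_mem_Icc.2 zero_le_one) (right_mem_Icc.2 zero_le_one) one_pos
  simpa [hg] using this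

end Hessian

/-! ### Convergence of trajectories -/

namespace CordData

variable {L : ℝ} {K : Knot L} (X : CordData K)

lemma compactSpace_torus (K : Knot L) : CompactSpace (Torus L) := by
  have : Fact (0 < L) := ⟨K.length_pos⟩
  infer_instance

lemma tendsto_E_flow (q : Torus L) : ∃ e, Tendsto (fun τ => X.E (X.flow τ q)) atTop (𝓝 e) := by
  have := compactSpace_torus K
  have hbdd : BddBelow (range (fun τ => X.E (X.flow τ q))) :=
    (isCompact_range X.continuous_E).bddBelow.mono (range_subset_iff.2 fun τ => mem_range_self _)
  exact ⟨_, tendsto_atTop_ciInf (X.antitone_E_flow q) hbdd⟩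

/-- At a cluster point `y` of a trajectory the energy does not change along the flow up to time 1, because the
energy converges along the trajectory. Hence the gradient vanishes. -/
lemma isCrit_of_mapClusterPt {q y : Torus L}
    (h : MapClusterPt y atTop (fun τ => X.flow τ q)) : IsCrit X.E y := by
  obtain ⟨e, he⟩ := X.tendsto_E_flow q
  set g : Torus L → ℝ := fun c => X.E (X.flow 1 c) - X.E c with hg
  have hgc : Continuous g := (X.continuous_E.comp (X.continuous_flow_right 1)).sub X.continuous_E
  have h1 : Tendsto (fun τ => g (X.flow τ q)) atTop (𝓝 0) := by
    have h2 : Tendsto (fun τ => X.E (X.flow (1 + τ) q)) atTop (𝓝 e) :=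
      he.comp (tendsto_atTop_add_const_left _ _ tendsto_id)
    have := h2.sub he
    simpa [hg, flow_add] using this
  have h2 : MapClusterPt (g y) atTop (fun τ => g (X.flow τ q)) := h.continuousAt_comp hgc.continuousAt
  have h3 : g y = 0 := by
    have := ClusterPt.mono h2 h1
    exact eq_of_nhds_neBot this
  have hconst : ∀ s ∈ Icc (0 : ℝ) 1, X.E (X.flow s y) = X.E y := by
    intro s hs
    have a1 := X.antitone_E_flow y hs.1
    have a2 := X.antitone_E_flow y hs.2
    simp only [flow_zero] at a1 a2
    have : X.E (X.flow 1 y) = X.E y := sub_eq_zero.1 h3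
    linarith
  have hd := X.hasDerivAt_E_flow y (1 / 2)
  have hev : (fun s => X.E (X.flow s y)) =ᶠ[𝓝 (1 / 2)] fun _ => X.E y := by
    filter_upwards [Icc_mem_nhds (a := (0 : ℝ)) (b := 1) (by norm_num) (by norm_num)] with s hs
    exact hconst s hs
  have h5 := hd.unique ((hasDerivAt_const (1 / 2 : ℝ) (X.E y)).congr_of_eventuallyEq hev)
  have h6 : IsCrit X.E (X.flow (1 / 2) y) := (X.gradSq_eq_zero_iff _).1 (by linarith)
  rwa [X.isCrit_of_isCrit_flow h6] at h6

/-- A nondegenerate critical point is isolated: the derivative of the gradient is injective there. -/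
lemma isolated_crit {y : Torus L} (hy : IsCrit X.E y) (hdet : (hessian X.E y).det ≠ 0) :
    ∀ᶠ x in 𝓝 y, IsCrit X.E x → x = y := by
  obtain ⟨p₀, rfl⟩ := tc_surjective y
  rw [eventually_nhds_tc]
  set A : ℝ × ℝ →L[ℝ] ℝ := dS (dS X.E) (tc L p₀) • ContinuousLinearMap.fst ℝ ℝ ℝ +
      dT (dS X.E) (tc L p₀) • ContinuousLinearMap.snd ℝ ℝ ℝ with hA
  set B : ℝ × ℝ →L[ℝ] ℝ := dS (dT X.E) (tc L p₀) • ContinuousLinearMap.fst ℝ ℝ ℝ +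
      dT (dT X.E) (tc L p₀) • ContinuousLinearMap.snd ℝ ℝ ℝ with hB
  have hder : HasFDerivAt (fun x => (dS X.E (tc L x), dT X.E (tc L x))) (A.prod B) p₀ :=
    (hasFDerivAt_tc X.tsmooth_E.dS p₀).prodMk (hasFDerivAt_tc X.tsmooth_E.dT p₀)
  have hinj : Function.Injective (A.prod B : ℝ × ℝ →ₗ[ℝ] ℝ × ℝ) := by
    rw [← LinearMap.ker_eq_bot, LinearMap.ker_eq_bot']
    rintro ⟨u, v⟩ h
    rw [det_hessian] at hdet
    have h1 : dS (dS X.E) (tc L p₀) * u + dT (dS X.E) (tc L p₀) * v = 0 := by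
      simpa [hA] using congrArg Prod.fst h
    have h2 : dS (dT X.E) (tc L p₀) * u + dT (dT X.E) (tc L p₀) * v = 0 := by
      simpa [hB] using congrArg Prod.snd h
    have hu : (dS (dS X.E) (tc L p₀) * dT (dT X.E) (tc L p₀)
        - dS (dT X.E) (tc L p₀) * dT (dS X.E) (tc L p₀)) * u = 0 := by
      linear_combination dT (dT X.E) (tc L p₀) * h1 - dT (dS X.E) (tc L p₀) * h2
    have hv : (dS (dS X.E) (tc L p₀) * dT (dT X.E) (tc L p₀)
        - dS (dT X.E) (tc L p₀) * dT (dS X.E) (tc L p₀)) * v = 0 := by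
      linear_combination dS (dS X.E) (tc L p₀) * h2 - dS (dT X.E) (tc L p₀) * h1
    rw [(mul_eq_zero.1 hu).resolve_left hdet, (mul_eq_zero.1 hv).resolve_left hdet]
    rfl
  obtain ⟨C, -, hC⟩ := LinearMap.exists_antilipschitzWith _ (LinearMap.ker_eq_bot.2 hinj)
  have := hder.eventually_ne (c := 0) ⟨C, hC⟩
  rw [eventually_nhdsWithin_iff] at this
  filter_upwards [this] with x hx hcrit
  by_contra hne
  exact hx (fun h => hne (by rw [h])) (Prod.ext hcrit.1 hcrit.2)

/-- A nondegenerate critical point that is a cluster point of a trajectory is its limit: otherwise the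
trajectory would have a further cluster point on every small sphere around it. -/
lemma mem_stable_of_mapClusterPt {q y : Torus L} (hdet : (hessian X.E y).det ≠ 0)
    (h : MapClusterPt y atTop (fun τ => X.flow τ q)) : q ∈ X.stable y := by
  have := compactSpace_torus K
  have hy := X.isCrit_of_mapClusterPt h
  obtain ⟨r, hr, hiso⟩ := Metric.eventually_nhds_iff_ball.1 (X.isolated_crit hy hdet)
  refine Metric.tendsto_nhds.2 fun ε hε => ?_
  by_contra hcon
  rw [not_eventually] at hcon
  set ρ := min ε (r / 2) with hρ
  have hρ0 : 0 < ρ := by positivity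
  have hfreq1 : ∃ᶠ τ in atTop, dist (X.flow τ q) y < ρ :=
    h.frequently (Metric.ball_mem_nhds y hρ0)
  have hcont : Continuous (fun τ => dist (X.flow τ q) y) :=
    (X.continuous_flow_left q).dist continuous_const
  have hfreq : ∃ᶠ τ in atTop, X.flow τ q ∈ Metric.sphere y ρ := by
    rw [frequently_atTop]
    intro T
    obtain ⟨τ₁, h1, h1'⟩ := frequently_atTop.1 hfreq1 T
    obtain ⟨τ₂, h2, h2'⟩ := frequently_atTop.1 hcon τ₁
    have hsub := intermediate_value_Icc h2 (f := fun τ => dist (X.flow τ q) y) hcont.continuousOn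
    have : ρ ∈ Icc (dist (X.flow τ₁ q) y) (dist (X.flow τ₂ q) y) :=
      ⟨h1'.le, (min_le_left _ _).trans (not_lt.1 h2')⟩
    obtain ⟨τ, hτ, hτ'⟩ := hsub this
    exact ⟨τ, h1.trans hτ.1, hτ'⟩
  obtain ⟨z, hz, hz'⟩ := (isCompact_sphere y ρ).exists_mapClusterPt_of_frequently hfreq
  have hzc := X.isCrit_of_mapClusterPt hz'
  have hzy : dist z y = ρ := hz
  have := hiso z (by rw [Metric.mem_ball, hzy]; exact lt_of_le_of_lt (min_le_right _ _) (by linarith)) hzc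
  rw [this, dist_self] at hzy
  exact hρ0.ne hzy

variable {X}

/-- A trajectory outside the stable manifolds of the saddles tends to a critical point of index 0: it cannot
tend to a local maximum unless it is constant. -/
lemma Generic.tendsto_crit0 (hX : X.Generic) {q : Torus L} (h2 : q ∉ X.Crit2)
    (h1 : ∀ k ∈ X.Crit1, q ∉ X.stable k) : ∃ d ∈ X.Crit0, q ∈ X.stable d := by
  have := compactSpace_torus K
  obtain ⟨y, hy⟩ := exists_clusterPt_of_compactSpace (map (fun τ => X.flow τ q) atTop)
  have hcrit := X.isCrit_of_mapClusterPt hy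
  have hst := X.mem_stable_of_mapClusterPt (hX.morse y hcrit) hy
  rcases (hX.morse y hcrit).lt_or_gt with hneg | hpos
  · exact absurd hst (h1 y ⟨hcrit, hneg⟩)
  · have hne : dS (dS X.E) y ≠ 0 := by
      intro h0
      rw [det_hessian, h0, X.tsmooth_E.dS_dT_comm] at hpos
      nlinarith [sq_nonneg (dT (dS X.E) y)]
    rcases hne.lt_or_gt with h | h
    -- index 2: the energy decreases to its value at `y`, which is a strict local maximum
    · exfalso
      have hsm : TSmooth (fun c => -X.E c) := ContDiff.neg X.tsmooth_E
      have e1 : dS (fun c => -X.E c) = fun c => -dS X.E c := by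
        ext x; unfold dS cderiv; exact deriv.fun_neg
      have e2 : dT (fun c => -X.E c) = fun c => -dT X.E c := by
        ext x; unfold dT cderiv; exact deriv.fun_neg
      have hc' : IsCrit (fun c => -X.E c) y := by
        unfold IsCrit; rw [e1, e2]; simp [hcrit.1, hcrit.2]
      have hpd : (hessian (fun c => -X.E c) y).PosDef := by
        refine posDef_hessian hsm ?_ ?_
        · rw [e1]
          have : dS (fun c => -dS X.E c) y = -dS (dS X.E) y := by
            unfold dS cderiv; exact deriv.fun_neg
          rw [this]; linarith
        · rw [hessian_neg, Matrix.det_neg]; simpa using hpos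
      have hmax := strict_local_min hsm hc' hpd
      obtain ⟨τ, hτ⟩ := (hst.eventually hmax).exists
      have hle : X.E y ≤ X.E (X.flow τ q) := by
        have ht : Tendsto (fun τ => X.E (X.flow τ q)) atTop (𝓝 (X.E y)) :=
          (X.continuous_E.tendsto y).comp hst
        exact (X.antitone_E_flow q).le_of_tendsto ht τ
      have heq : X.flow τ q = y := by
        by_contra hne
        have := hτ hne
        linarith
      have hqy : X.flow τ q = q := X.isCrit_of_isCrit_flow (by rw [heq]; exact hcrit)
      rw [hessian_neg] at hpd
      exact h2 (by rw [← hqy, heq]; exact ⟨hcrit, hpd⟩)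
    · exact ⟨y, ⟨hcrit, posDef_hessian X.tsmooth_E h hpos⟩, hst⟩

variable (X)

/-- A critical point of index 0 attracts a neighbourhood, and the trajectories that start there stay close to
it: the Euclidean distance from it, in a lift, decreases along the flow. -/
lemma attracts_nhds {d : Torus L} (hd : d ∈ X.Crit0) {W : Set (Torus L)} (hW : W ∈ 𝓝 d) :
    ∃ N ∈ 𝓝 d, ∀ x ∈ N, x ∈ X.stable d ∧ ∀ τ, 0 ≤ τ → X.flow τ x ∈ W := by
  have := compactSpace_torus K
  obtain ⟨p₀, rfl⟩ := tc_surjective d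
  have hW' : ∀ᶠ x in 𝓝 p₀, tc L x ∈ W := eventually_nhds_tc.1 hW
  obtain ⟨r, hr, hball⟩ := Metric.eventually_nhds_iff_ball.1
    (hW'.and (gradient_outward X.tsmooth_E hd.1 hd.2))
  set n : ℝ × ℝ → ℝ := fun x => (x.1 - p₀.1) ^ 2 + (x.2 - p₀.2) ^ 2 with hn
  have hnc : Continuous n := by fun_prop
  have hnball : ∀ x, n x < r ^ 2 → x ∈ Metric.ball p₀ r := by
    intro x hx
    rw [Metric.mem_ball, Prod.dist_eq, Real.dist_eq, Real.dist_eq]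
    have h1 : (x.1 - p₀.1) ^ 2 < r ^ 2 := by
      simp only [hn] at hx; nlinarith [sq_nonneg (x.2 - p₀.2)]
    have h2 : (x.2 - p₀.2) ^ 2 < r ^ 2 := by
      simp only [hn] at hx; nlinarith [sq_nonneg (x.1 - p₀.1)]
    exact max_lt (abs_lt_of_sq_lt_sq h1 hr.le) (abs_lt_of_sq_lt_sq h2 hr.le)
  refine ⟨tc L '' {x | n x < r ^ 2}, ?_, ?_⟩
  · rw [← map_tc_nhds]
    refine image_mem_map ((hnc.tendsto p₀).eventually_lt_const ?_)
    simp only [hn]; simpa using pow_pos hr 2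
  · rintro _ ⟨p, hp, rfl⟩
    have hp' : n p < r ^ 2 := hp
    have hn0 : 0 ≤ n p := by simp only [hn]; positivity
    set ρ := (n p + r ^ 2) / 2 with hρ
    have hr2 : 0 < r ^ 2 := by positivity
    have hinv : ∀ τ, 0 ≤ τ → n (X.lflow τ p) ≤ ρ := by
      intro τ hτ
      have hder : ∀ t, HasDerivAt (fun t => n (X.lflow t p))
          (-2 * (((X.lflow t p).1 - p₀.1) * dS X.E (tc L (X.lflow t p))
            + ((X.lflow t p).2 - p₀.2) * dT X.E (tc L (X.lflow t p)))) t := by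
        intro t
        have h1 := X.hasDerivAt_lflow p t
        have h3 : HasDerivAt (fun t => (X.lflow t p).1) (X.lvel (X.lflow t p)).1 t :=
          (ContinuousLinearMap.fst ℝ ℝ ℝ).hasFDerivAt.comp_hasDerivAt t h1
        have h4 : HasDerivAt (fun t => (X.lflow t p).2) (X.lvel (X.lflow t p)).2 t :=
          (ContinuousLinearMap.snd ℝ ℝ ℝ).hasFDerivAt.comp_hasDerivAt t h1
        have h2 := ((h3.sub_const p₀.1).pow 2).add ((h4.sub_const p₀.2).pow 2)
        refine h2.congr_deriv ?_
        simp only [lvel, vel]; push_cast; ring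
      refine image_le_of_deriv_right_lt_deriv_boundary (f := fun t => n (X.lflow t p))
        (B := fun _ => ρ) (B' := fun _ => 0) (a := 0) (b := τ)
        (fun t _ => (hder t).continuousAt.continuousWithinAt)
        (fun t _ => (hder t).hasDerivWithinAt) ?_ (fun t => hasDerivAt_const _ _) ?_ ⟨hτ, le_rfl⟩
      · simp only [lflow_zero]; linarith
      · intro t _ ht
        have hlt : n (X.lflow t p) < r ^ 2 := by rw [ht]; linarith
        have hne : X.lflow t p ≠ p₀ := by
          intro h
          rw [h] at ht
          simp only [hn, sub_self] at ht
          norm_num at ht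
          linarith
        have := (hball _ (hnball _ hlt)).2 hne
        linarith
    have hlt : ∀ τ, 0 ≤ τ → n (X.lflow τ p) < r ^ 2 := fun τ hτ => (hinv τ hτ).trans_lt (by linarith)
    refine ⟨?_, fun τ hτ => (hball _ (hnball _ (hlt τ hτ))).1⟩
    have hKc : IsCompact {x : ℝ × ℝ | n x ≤ ρ} := by
      refine Metric.isCompact_of_isClosed_isBounded (isClosed_le hnc continuous_const) ?_
      exact Metric.isBounded_ball.subset fun x hx => hnball x (lt_of_le_of_lt hx (by linarith))
    have hcl : IsClosed (tc L '' {x : ℝ × ℝ | n x ≤ ρ}) := (hKc.image continuous_tc).isClosed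
    refine le_nhds_of_unique_clusterPt (X := Torus L) fun y hy => ?_
    have hyc := X.isCrit_of_mapClusterPt hy
    have hymem : y ∈ tc L '' {x : ℝ × ℝ | n x ≤ ρ} := by
      refine hcl.mem_of_mapClusterPt hy ?_
      filter_upwards [eventually_ge_atTop 0] with τ hτ
      exact ⟨_, hinv τ hτ, rfl⟩
    obtain ⟨z, hz, rfl⟩ := hymem
    by_contra hne
    have hz' : n z ≤ ρ := hz
    have := (hball z (hnball z (lt_of_le_of_lt hz' (by linarith)))).2 (fun h => hne (by rw [h]))
    rw [hyc.1, hyc.2] at this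
    simp at this

/-- After some time, all trajectories that start near a given point of the stable manifold of a critical
point `d` of index 0 are in a given neighbourhood of `d`. -/
lemma eventually_flow_mem {d q : Torus L} (hd : d ∈ X.Crit0) (hq : q ∈ X.stable d)
    {W : Set (Torus L)} (hW : W ∈ 𝓝 d) :
    ∃ T, 0 ≤ T ∧ ∀ᶠ x in 𝓝 q, ∀ τ, T ≤ τ → X.flow τ x ∈ W := by
  obtain ⟨N, hN, hNW⟩ := X.attracts_nhds hd hW
  obtain ⟨T, hT, hT0⟩ := ((hq.eventually (eventually_mem_nhds_iff.2 hN)).and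
    (eventually_ge_atTop (0 : ℝ))).exists
  refine ⟨T, hT0, ?_⟩
  filter_upwards [(X.continuous_flow_right T).tendsto q hT] with x hx τ hτ
  have := (hNW _ hx).2 (τ - T) (by linarith)
  rwa [← flow_add, sub_add_cancel] at this

lemma stable_mem_nhds {d q : Torus L} (hd : d ∈ X.Crit0) (hq : q ∈ X.stable d) :
    ∀ᶠ x in 𝓝 q, x ∈ X.stable d := by
  obtain ⟨N, hN, hNW⟩ := X.attracts_nhds hd univ_mem
  obtain ⟨T, hT⟩ := (hq.eventually (eventually_mem_nhds_iff.2 hN)).exists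
  filter_upwards [(X.continuous_flow_right T).tendsto q hT] with x hx
  have h1 : Tendsto (fun τ => X.flow τ (X.flow T x)) atTop (𝓝 d) := (hNW _ hx).1
  have h2 := h1.comp (tendsto_atTop_add_const_right atTop (-T) tendsto_id)
  refine h2.congr fun τ => ?_
  simp [← flow_add]

end CordData
/-! ### Cross products -/

section Cross

lemma inner_eq_sum (v w : E3) : inner ℝ v w = v 0 * w 0 + v 1 * w 1 + v 2 * w 2 := by
  simp only [PiLp.inner_apply, Fin.sum_univ_three, RCLike.inner_apply, conj_trivial]
  ring

lemma cross_zero (v w : E3) : cross v w 0 = v 1 * w 2 - v 2 * w 1 := by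
  simp [cross, crossProduct]
lemma cross_one (v w : E3) : cross v w 1 = v 2 * w 0 - v 0 * w 2 := by
  simp [cross, crossProduct]
lemma cross_two (v w : E3) : cross v w 2 = v 0 * w 1 - v 1 * w 0 := by
  simp [cross, crossProduct]

lemma inner_cross_self_left (v w : E3) : inner ℝ v (cross v w) = 0 := by
  rw [inner_eq_sum, cross_zero, cross_one, cross_two]; ring
lemma inner_cross_self_right (v w : E3) : inner ℝ w (cross v w) = 0 := by
  rw [inner_eq_sum, cross_zero, cross_one, cross_two]; ring

lemma cross_smul_right (a : ℝ) (v w : E3) : cross v (a • w) = a • cross v w := by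
  simp [cross]

lemma continuous_cross : Continuous (fun x : E3 × E3 => cross x.1 x.2) := by
  have h : ∀ i : Fin 3, Continuous (fun x : E3 × E3 => cross x.1 x.2 i) := by
    intro i
    fin_cases i
    · simp only [Fin.zero_eta, cross_zero]; fun_prop
    · simp only [Fin.mk_one, cross_one]; fun_prop
    · simp only [Fin.reduceFinMk, cross_two]; fun_prop
  exact (PiLp.continuous_toLp 2 _).comp (continuous_pi h)

lemma contDiff_cross {n : WithTop ℕ∞} {E : Type*} [NormedAddCommGroup E] [NormedSpace ℝ E] {f g : E → E3}
    (hf : ContDiff ℝ n f) (hg : ContDiff ℝ n g) : ContDiff ℝ n (fun x => cross (f x) (g x)) := by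
  rw [contDiff_euclidean] at hf hg ⊢
  intro i
  fin_cases i
  · simp only [Fin.zero_eta, cross_zero]
    exact ((hf 1).mul (hg 2)).sub ((hf 2).mul (hg 1))
  · simp only [Fin.mk_one, cross_one]
    exact ((hf 2).mul (hg 0)).sub ((hf 0).mul (hg 2))
  · simp only [Fin.reduceFinMk, cross_two]
    exact ((hf 0).mul (hg 1)).sub ((hf 1).mul (hg 0))

/-- The expansion of a vector in the basis `a`, `b`, `a × b`, multiplied by the Gram determinant. -/
lemma cross_frame (a b v : E3) :
    (inner ℝ (cross a b) (cross a b)) • v =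
      (inner ℝ v a * inner ℝ b b - inner ℝ v b * inner ℝ a b) • a +
      (inner ℝ v b * inner ℝ a a - inner ℝ v a * inner ℝ a b) • b +
      (inner ℝ v (cross a b)) • cross a b := by
  ext i
  simp only [PiLp.add_apply, PiLp.smul_apply, smul_eq_mul, inner_eq_sum]
  fin_cases i <;> simp only [Fin.zero_eta, Fin.mk_one, Fin.reduceFinMk, cross_zero, cross_one, cross_two] <;> ring

lemma inner_cross_cross_self (a b : E3) : inner ℝ (cross a b) (cross a b) =
    inner ℝ a a * inner ℝ b b - inner ℝ a b ^ 2 := by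
  simp only [inner_eq_sum, cross_zero, cross_one, cross_two]; ring

lemma eq_of_orthonormal_frame {a b v : E3} (ha : inner ℝ a a = 1) (hb : inner ℝ b b = 1)
    (hab : inner ℝ a b = 0) :
    v = (inner ℝ v a : ℝ) • a + (inner ℝ v b : ℝ) • b + (inner ℝ v (cross a b) : ℝ) • cross a b := by
  have h := cross_frame a b v
  rw [inner_cross_cross_self, ha, hb, hab] at h
  simpa using h

end Cross

/-! ### Divided differences -/

section Parametric

/-- An integral over `[0, 1]` is continuously differentiable in a parameter if the integrand is. -/
lemma contDiff_one_integral {E : Type*} [NormedAddCommGroup E] [NormedSpace ℝ E]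
    [CompleteSpace E] {F : (ℝ × ℝ) × ℝ → E} (hF : ContDiff ℝ 1 F) :
    ContDiff ℝ 1 (fun p : ℝ × ℝ => ∫ θ in (0 : ℝ)..1, F (p, θ)) := by
  set F' : ℝ × ℝ → ℝ → (ℝ × ℝ →L[ℝ] E) := fun p θ =>
    (fderiv ℝ F (p, θ)).comp (ContinuousLinearMap.inl ℝ (ℝ × ℝ) ℝ) with hF'
  have hF'c : Continuous (fun x : (ℝ × ℝ) × ℝ => F' x.1 x.2) := by
    have := hF.continuous_fderiv one_ne_zero
    exact this.clm_comp continuous_const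
  have hder : ∀ p : ℝ × ℝ, HasFDerivAt (fun p : ℝ × ℝ => ∫ θ in (0 : ℝ)..1, F (p, θ))
      (∫ θ in (0 : ℝ)..1, F' p θ) p := by
    intro p
    obtain ⟨C, hC⟩ := ((isCompact_closedBall p 1).prod (isCompact_Icc (a := (0 : ℝ)) (b := 1))
      ).exists_bound_of_continuousOn hF'c.continuousOn
    refine intervalIntegral.hasFDerivAt_integral_of_dominated_of_fderiv_le
      (F := fun p θ => F (p, θ)) (F' := F') (bound := fun _ => C)
      (Metric.closedBall_mem_nhds p one_pos) ?_ ?_ ?_ ?_ ?_ ?_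
    · refine Eventually.of_forall fun x => ?_
      exact (hF.continuous.comp (Continuous.prodMk_right x)).aestronglyMeasurable
    · exact (hF.continuous.comp (Continuous.prodMk_right p)).intervalIntegrable _ _
    · exact (hF'c.comp (Continuous.prodMk_right p)).aestronglyMeasurable
    · refine Eventually.of_forall fun θ hθ x hx => ?_
      rw [uIoc_of_le zero_le_one] at hθ
      exact hC (x, θ) ⟨hx, Ioc_subset_Icc_self hθ⟩
    · exact intervalIntegrable_const
    · refine Eventually.of_forall fun θ _ x _ => ?_
      have h1 : HasFDerivAt F (fderiv ℝ F (x, θ)) (x, θ) :=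
        ((hF.differentiable one_ne_zero).differentiableAt).hasFDerivAt
      exact h1.comp x (hasFDerivAt_prodMk_left x θ)
  refine contDiff_one_iff_fderiv.2 ⟨fun p => (hder p).differentiableAt, ?_⟩
  have : (fderiv ℝ fun p : ℝ × ℝ => ∫ θ in (0 : ℝ)..1, F (p, θ)) = fun p => ∫ θ in (0 : ℝ)..1, F' p θ := by
    ext1 p; exact (hder p).fderiv
  rw [this]
  exact intervalIntegral.continuous_parametric_intervalIntegral_of_continuous' hF'c 0 1

end Parametric

namespace Knot

variable {L : ℝ} (K : Knot L)

/-- The divided difference `(γ b - γ a) / (b - a)`, extended to the diagonal. -/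
noncomputable def dd (p : ℝ × ℝ) : E3 :=
  ∫ θ in (0 : ℝ)..1, deriv K.lift (p.1 + θ * (p.2 - p.1))

/-- The second order remainder `(γ b - γ a - (b - a) γ' a) / (b - a) ^ 2`, extended to the diagonal. -/
noncomputable def rr (p : ℝ × ℝ) : E3 :=
  ∫ θ in (0 : ℝ)..1, (1 - θ) • deriv (deriv K.lift) (p.1 + θ * (p.2 - p.1))

lemma contDiff_segment :
    ContDiff ℝ 1 (fun x : (ℝ × ℝ) × ℝ => x.1.1 + x.2 * (x.1.2 - x.1.1)) := by fun_prop

lemma continuous_segment (a b : ℝ) : Continuous (fun θ : ℝ => a + θ * (b - a)) := by fun_prop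

lemma contDiff_dd : ContDiff ℝ 1 K.dd := by
  refine contDiff_one_integral (F := fun x => deriv K.lift (x.1.1 + x.2 * (x.1.2 - x.1.1))) ?_
  exact (K.contDiff_deriv_lift.of_le (by simp)).comp contDiff_segment

lemma contDiff_rr : ContDiff ℝ 1 K.rr := by
  refine contDiff_one_integral
    (F := fun x => (1 - x.2) • deriv (deriv K.lift) (x.1.1 + x.2 * (x.1.2 - x.1.1))) ?_
  exact ContDiff.smul (contDiff_const.sub contDiff_snd)
    ((K.contDiff_deriv2_lift.of_le (by simp)).comp contDiff_segment)

lemma smul_dd (a b : ℝ) : (b - a) • K.dd (a, b) = K.lift b - K.lift a := by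
  have h : ∀ θ ∈ uIcc (0 : ℝ) 1, HasDerivAt (fun θ => K.lift (a + θ * (b - a)))
      ((b - a) • deriv K.lift (a + θ * (b - a))) θ := by
    intro θ _
    have h1 : HasDerivAt (fun θ : ℝ => a + θ * (b - a)) (b - a) θ := by
      simpa using ((hasDerivAt_id θ).mul_const (b - a)).const_add a
    exact (K.hasDerivAt_lift _).scomp θ h1
  have hc : Continuous (fun θ : ℝ => (b - a) • deriv K.lift (a + θ * (b - a))) :=
    continuous_const.fun_smul (K.contDiff_deriv_lift.continuous.comp (continuous_segment a b))
  have := intervalIntegral.integral_eq_sub_of_hasDerivAt h (hc.intervalIntegrable _ _)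
  rw [intervalIntegral.integral_smul] at this
  rw [dd, this]
  simp

lemma smul_rr (a b : ℝ) :
    ((b - a) ^ 2) • K.rr (a, b) = K.lift b - K.lift a - (b - a) • deriv K.lift a := by
  have h : ∀ θ ∈ uIcc (0 : ℝ) 1, HasDerivAt (fun θ => ((1 - θ) * (b - a)) • deriv K.lift (a + θ * (b - a))
        + K.lift (a + θ * (b - a)))
      ((b - a) ^ 2 • ((1 - θ) • deriv (deriv K.lift) (a + θ * (b - a)))) θ := by
    intro θ _
    have h1 : HasDerivAt (fun θ : ℝ => a + θ * (b - a)) (b - a) θ := by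
      simpa using ((hasDerivAt_id θ).mul_const (b - a)).const_add a
    have h2 := (K.hasDerivAt_lift _).scomp θ h1
    have h3 := (K.hasDerivAt_deriv_lift _).scomp θ h1
    have h4 : HasDerivAt (fun θ : ℝ => (1 - θ) * (b - a)) (-(b - a)) θ := by
      simpa using ((hasDerivAt_id θ).const_sub 1).mul_const (b - a)
    refine ((h4.smul h3).add h2).congr_deriv ?_
    simp only [Function.comp_apply, smul_smul]
    module
  have hc : Continuous (fun θ : ℝ => (b - a) ^ 2 • ((1 - θ) • deriv (deriv K.lift) (a + θ * (b - a)))) :=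
    continuous_const.fun_smul ((continuous_const.sub continuous_id).fun_smul
      (K.contDiff_deriv2_lift.continuous.comp (continuous_segment a b)))
  have := intervalIntegral.integral_eq_sub_of_hasDerivAt h (hc.intervalIntegrable _ _)
  rw [intervalIntegral.integral_smul] at this
  rw [rr, this]
  simp only [sub_self, zero_mul, zero_smul, one_mul, sub_zero, add_zero, zero_add, add_sub_cancel]
  abel

lemma dd_self (a : ℝ) : K.dd (a, a) = deriv K.lift a := by
  simp [dd]

lemma rr_self (a : ℝ) : K.rr (a, a) = (1 / 2 : ℝ) • deriv (deriv K.lift) a := by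
  simp only [rr, sub_self, mul_zero, add_zero]
  rw [intervalIntegral.integral_smul_const]
  congr 1
  rw [intervalIntegral.integral_sub (by simp) (by simp)]
  simp
  norm_num

lemma dd_symm (a b : ℝ) : K.dd (a, b) = K.dd (b, a) := by
  by_cases h : a = b
  · rw [h]
  · have h1 := K.smul_dd a b
    have h2 := K.smul_dd b a
    have h3 : (b - a) • K.dd (a, b) = (b - a) • K.dd (b, a) := by
      rw [h1, ← neg_sub a b, neg_smul, h2]; abel
    exact smul_right_injective E3 (sub_ne_zero.2 (Ne.symm h)) h3

/-- The derivative of the divided difference on the diagonal is determined by the symmetry of the divided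
difference and by its restriction to the diagonal, which is `γ'`. -/
lemma hasStrictFDerivAt_dd (a : ℝ) : HasStrictFDerivAt K.dd
    ((ContinuousLinearMap.fst ℝ ℝ ℝ + ContinuousLinearMap.snd ℝ ℝ ℝ).smulRight
      ((1 / 2 : ℝ) • deriv (deriv K.lift) a)) (a, a) := by
  have hs := (K.contDiff_dd.contDiffAt (x := (a, a))).hasStrictFDerivAt one_ne_zero
  have hd := hs.hasFDerivAt
  set A := fderiv ℝ K.dd (a, a)
  have h11 : A (1, 1) = deriv (deriv K.lift) a := by
    have h1 : HasDerivAt (fun x : ℝ => (x, x)) ((1 : ℝ), (1 : ℝ)) a :=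
      (hasDerivAt_id a).prodMk (hasDerivAt_id a)
    have h2 := HasFDerivAt.comp_hasDerivAt (f := fun x : ℝ => (x, x)) a hd h1
    have h3 : (K.dd ∘ fun x : ℝ => (x, x)) = deriv K.lift := by
      ext1 x; exact K.dd_self x
    rw [h3] at h2
    exact h2.unique (K.hasDerivAt_deriv_lift a)
  have h10 : A (1, 0) = A (0, 1) := by
    have h1 : HasDerivAt (fun x : ℝ => (x, a)) ((1 : ℝ), (0 : ℝ)) a :=
      (hasDerivAt_id a).prodMk (hasDerivAt_const a a)
    have h1' : HasDerivAt (fun x : ℝ => (a, x)) ((0 : ℝ), (1 : ℝ)) a :=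
      (hasDerivAt_const a a).prodMk (hasDerivAt_id a)
    have h2 := HasFDerivAt.comp_hasDerivAt (f := fun x : ℝ => (x, a)) a hd h1
    have h2' := HasFDerivAt.comp_hasDerivAt (f := fun x : ℝ => (a, x)) a hd h1'
    have h3 : (K.dd ∘ fun x : ℝ => (x, a)) = (K.dd ∘ fun x : ℝ => (a, x)) := by
      ext1 x; exact K.dd_symm x a
    rw [h3] at h2
    exact h2.unique h2'
  have hsum : A (1, 0) + A (0, 1) = deriv (deriv K.lift) a := by
    rw [← map_add, ← h11]; simp
  have h01 : A (0, 1) = (1 / 2 : ℝ) • deriv (deriv K.lift) a := by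
    rw [h10] at hsum; rw [← hsum]; module
  refine hs.congr_fderiv ?_
  ext1
  · ext1; simp [A, h10, h01]
  · ext1; simp [A, h01]

lemma eq_of_coe_eq_of_abs_lt {a b : ℝ} (h : |b - a| < L) (he : (a : AddCircle L) = b) : a = b := by
  obtain ⟨n, rfl⟩ := exists_period_of_coe_eq he
  have hL : 0 < L := (abs_nonneg _).trans_lt h
  rw [add_sub_cancel_left, abs_mul, abs_of_pos hL] at h
  have h1 : |(n : ℝ)| < 1 := by
    by_contra hcon
    push Not at hcon
    nlinarith
  have : n = 0 := by
    have : |n| < 1 := by exact_mod_cast h1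
    exact Int.abs_lt_one_iff.1 this
  simp [this]

lemma dd_ne_zero {a b : ℝ} (h : |b - a| < L) : K.dd (a, b) ≠ 0 := by
  intro h0
  by_cases hab : a = b
  · subst hab
    rw [dd_self] at h0
    have := K.norm_deriv_lift a
    rw [h0, norm_zero] at this
    exact zero_ne_one this
  · have h1 := K.smul_dd a b
    rw [h0, smul_zero] at h1
    exact hab (eq_of_coe_eq_of_abs_lt h (K.injective (sub_eq_zero.1 h1.symm).symm))

/-- The length of a chord is bounded below by a multiple of the distance of its ends along the knot. The
constant is the minimum of the length of the divided difference over a compact set that contains lifts of all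
pairs of points. -/
lemma exists_bilipschitz : ∃ κ : ℝ, 0 < κ ∧ ∀ s u : AddCircle L, κ * ‖u - s‖ ≤ ‖K.γ u - K.γ s‖ := by
  have hL := K.length_pos
  have : Fact (0 < L) := ⟨hL⟩
  set Z : Set (ℝ × ℝ) := {p | p.1 ∈ Icc 0 L ∧ |p.2 - p.1| ≤ L / 2} with hZ
  have hZc : IsCompact Z := by
    have hcl : IsClosed Z := by
      refine IsClosed.and (isClosed_Icc.preimage continuous_fst) (isClosed_le (by fun_prop) continuous_const)
    refine (isCompact_Icc (a := ((0 : ℝ), -(L / 2))) (b := (L, L + L / 2))).of_isClosed_subset hcl ?_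
    rintro ⟨a, b⟩ ⟨h1, h2⟩
    have := abs_le.1 h2
    exact ⟨⟨h1.1, by simp at *; linarith⟩, ⟨h1.2, by simp at *; linarith⟩⟩
  have hZne : Z.Nonempty := ⟨(0, 0), ⟨le_rfl, hL.le⟩, by simp; linarith⟩
  obtain ⟨p, hp, hmin⟩ := hZc.exists_isMinOn hZne K.contDiff_dd.continuous.norm.continuousOn
  refine ⟨‖K.dd p‖, norm_pos_iff.2 (K.dd_ne_zero (a := p.1) (b := p.2) ?_), fun s u => ?_⟩
  · have := hp.2; linarith
  · have h2 : s ∈ ((↑) : ℝ → AddCircle L) '' Icc 0 L := by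
      have := AddCircle.coe_image_Icc_eq L 0
      rw [zero_add] at this
      rw [this]; trivial
    obtain ⟨a, ha, rfl⟩ := h2
    obtain ⟨b, rfl, hb, hb'⟩ := exists_lift_near hL a u
    have h3 := hmin (show (a, b) ∈ Z from ⟨ha, hb'⟩)
    change _ ≤ ‖K.lift b - K.lift a‖
    rw [← K.smul_dd a b, norm_smul, Real.norm_eq_abs, ← hb, mul_comm]
    exact mul_le_mul_of_nonneg_left h3 (abs_nonneg _)

/-! ### The normal component of a cord -/

/-- A vector that has the same normal component at `γ a` as the scaled cord from `γ a` to `γ b`, and is a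
continuously differentiable function of `a` and `b` with `|b - a| < L`. -/
noncomputable def nvec (p : ℝ × ℝ) : E3 := (‖K.dd p‖ ^ 2)⁻¹ • K.rr p

lemma contDiffAt_nvec {p : ℝ × ℝ} (h : |p.2 - p.1| < L) : ContDiffAt ℝ 1 K.nvec p := by
  refine ContDiffAt.smul (ContDiffAt.inv ((K.contDiff_dd.norm_sq ℝ).contDiffAt) ?_)
    K.contDiff_rr.contDiffAt
  exact pow_ne_zero 2 (norm_ne_zero_iff.2 (K.dd_ne_zero h))

lemma scaledChord_tc {p : ℝ × ℝ} (h : |p.2 - p.1| < L) :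
    ∃ k : ℝ, K.scaledChord (tc L p) = k • deriv K.lift p.1 + K.nvec p := by
  obtain ⟨a, b⟩ := p
  by_cases hab : a = b
  · subst hab
    refine ⟨0, ?_⟩
    have : (tc L (a, a)).1 = (tc L (a, a)).2 := rfl
    rw [scaledChord, if_pos this, nvec, dd_self, rr_self, K.norm_deriv_lift]
    simp [tc, K.acc_coe]
  · have hne : (tc L (a, b)).1 ≠ (tc L (a, b)).2 := fun he => hab (eq_of_coe_eq_of_abs_lt h he)
    have hba : b - a ≠ 0 := sub_ne_zero.2 (Ne.symm hab)
    rw [scaledChord, if_neg hne, chord_tc, nvec]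
    have hn : ‖K.lift b - K.lift a‖ ^ 2 = (b - a) ^ 2 * ‖K.dd (a, b)‖ ^ 2 := by
      rw [← K.smul_dd a b, norm_smul, mul_pow, Real.norm_eq_abs, sq_abs]
    have h2 : K.lift b - K.lift a = (b - a) • deriv K.lift a + (b - a) ^ 2 • K.rr (a, b) := by
      rw [K.smul_rr]; abel
    change ∃ k : ℝ, (‖K.lift b - K.lift a‖ ^ 2)⁻¹ • (K.lift b - K.lift a) = _
    rw [hn]
    refine ⟨((b - a) ^ 2 * ‖K.dd (a, b)‖ ^ 2)⁻¹ * (b - a), ?_⟩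
    rw [h2, smul_add, smul_smul, smul_smul]
    congr 2
    field_simp

/-- The normal component of the scaled cord at its startpoint. -/
noncomputable def normalChord (c : Torus L) : E3 := K.normalProj c.1 (K.scaledChord c)

lemma normalChord_tc {p : ℝ × ℝ} (h : |p.2 - p.1| < L) :
    K.normalChord (tc L p) = K.nvec p - (inner ℝ (K.nvec p) (deriv K.lift p.1) : ℝ) • deriv K.lift p.1 := by
  obtain ⟨k, hk⟩ := K.scaledChord_tc h
  have ht : K.tan (tc L p).1 = deriv K.lift p.1 := K.tan_coe p.1
  rw [normalChord, normalProj, hk, ht, inner_add_left, real_inner_smul_left,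
    real_inner_self_eq_norm_sq, K.norm_deriv_lift]
  module

lemma exists_lift_abs_lt (hL : 0 < L) (c : Torus L) : ∃ p, tc L p = c ∧ |p.2 - p.1| < L := by
  obtain ⟨⟨a, b⟩, rfl⟩ := tc_surjective c
  obtain ⟨b', h1, -, h2⟩ := exists_lift_near hL a (b : AddCircle L)
  exact ⟨(a, b'), by simp [tc, h1], by simp only; linarith⟩

lemma eventually_abs_lt {p : ℝ × ℝ} (h : |p.2 - p.1| < L) : ∀ᶠ x : ℝ × ℝ in 𝓝 p, |x.2 - x.1| < L :=
  (show Continuous fun x : ℝ × ℝ => |x.2 - x.1| by fun_prop).tendsto p |>.eventually_lt_const h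

lemma continuous_normalChord : Continuous K.normalChord := by
  refine continuous_iff_continuousAt.2 fun c => ?_
  obtain ⟨p, rfl, hp⟩ := exists_lift_abs_lt K.length_pos c
  unfold ContinuousAt
  rw [← map_tc_nhds, tendsto_map'_iff]
  change ContinuousAt (fun x => K.normalChord (tc L x)) p
  have h1 : ContinuousAt (fun x : ℝ × ℝ => K.nvec x - (inner ℝ (K.nvec x) (deriv K.lift x.1) : ℝ) • deriv K.lift x.1) p := by
    have hn := (K.contDiffAt_nvec hp).continuousAt
    have ht : ContinuousAt (fun x : ℝ × ℝ => deriv K.lift x.1) p :=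
      (K.contDiff_deriv_lift.continuous.comp continuous_fst).continuousAt
    exact hn.fun_sub ((ContinuousAt.inner (𝕜 := ℝ) hn ht).fun_smul ht)
  refine h1.congr ?_
  filter_upwards [eventually_abs_lt hp] with x hx
  exact (K.normalChord_tc hx).symm

/-- The cords that are tangent to the knot at their startpoint. -/
def tangentStart : Set (Torus L) := {c | c.1 ≠ c.2 ∧ ∃ a : ℝ, K.chord c = a • K.tan c.1}

lemma inner_normalChord_tan (c : Torus L) : inner ℝ (K.normalChord c) (K.tan c.1) = 0 := by
  rw [normalChord, normalProj, inner_sub_left, real_inner_smul_left, K.inner_tan_self]; ring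

lemma chord_eq_of_ne {c : Torus L} (h : c.1 ≠ c.2) : ∃ k : ℝ, K.chord c =
    ‖K.chord c‖ ^ 2 • K.normalChord c + k • K.tan c.1 := by
  have h0 : ‖K.chord c‖ ^ 2 ≠ 0 := pow_ne_zero 2 (norm_ne_zero_iff.2 (K.chord_ne_zero h))
  refine ⟨inner ℝ (K.chord c) (K.tan c.1), ?_⟩
  rw [normalChord, normalProj, scaledChord, if_neg h, real_inner_smul_left, smul_sub, smul_smul,
    smul_smul, ← mul_assoc, mul_inv_cancel₀ h0]
  module

variable {K}

/-- The normal component of the scaled cord vanishes exactly at the cords tangent at their startpoint. On the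
diagonal it does not vanish because the curvature does not. -/
lemma Generic.mem_tangentStart_iff (hK : K.Generic) (c : Torus L) :
    c ∈ K.tangentStart ↔ K.normalChord c = 0 := by
  by_cases h : c.1 = c.2
  · refine ⟨fun hc => absurd h hc.1, fun hc => ?_⟩
    rw [normalChord, normalProj, scaledChord, if_pos h, real_inner_smul_left, K.inner_acc_tan] at hc
    simp at hc
    exact absurd hc (hK.curvature _)
  · have h0 : ‖K.chord c‖ ^ 2 ≠ 0 := pow_ne_zero 2 (norm_ne_zero_iff.2 (K.chord_ne_zero h))
    obtain ⟨k, hk⟩ := K.chord_eq_of_ne h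
    constructor
    · rintro ⟨-, a, ha⟩
      have h1 : ‖K.chord c‖ ^ 2 • K.normalChord c = (a - k) • K.tan c.1 := by
        rw [sub_smul, ← ha]; exact eq_sub_of_add_eq hk.symm
      have h2 := K.inner_normalChord_tan c
      have h3 : (a - k) * 1 = 0 := by
        rw [← K.inner_tan_self c.1, ← real_inner_smul_left, ← h1, real_inner_smul_left, h2, mul_zero]
      rw [show a - k = 0 by linarith, zero_smul] at h1
      exact (smul_eq_zero.1 h1).resolve_left h0
    · intro hc
      rw [hc, smul_zero, zero_add] at hk
      exact ⟨h, k, hk⟩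

lemma Generic.isClosed_tangentStart (hK : K.Generic) : IsClosed K.tangentStart := by
  have : K.tangentStart = K.normalChord ⁻¹' {0} := by
    ext c; exact hK.mem_tangentStart_iff c
  rw [this]
  exact isClosed_singleton.preimage K.continuous_normalChord

variable (K)

lemma bdryS_eq : K.bdryS = K.tangentStart ∪ Prod.swap ⁻¹' K.tangentStart := by
  ext c
  constructor
  · rintro ⟨h, ⟨a, ha⟩ | ⟨a, ha⟩⟩
    · exact Or.inl ⟨h, a, ha⟩
    · refine Or.inr ⟨Ne.symm h, -a, ?_⟩
      rw [chord_swap, ha, neg_smul]; rfl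
  · rintro (⟨h, a, ha⟩ | ⟨h, a, ha⟩)
    · exact ⟨h, Or.inl ⟨a, ha⟩⟩
    · refine ⟨Ne.symm h, Or.inr ⟨-a, ?_⟩⟩
      rw [chord_swap] at ha
      rw [neg_smul, ← neg_eq_iff_eq_neg, ha]; rfl

variable {K}

lemma Generic.isClosed_bdryS (hK : K.Generic) : IsClosed K.bdryS := by
  rw [bdryS_eq]
  exact hK.isClosed_tangentStart.union (hK.isClosed_tangentStart.preimage continuous_swap)

end Knot
/-! ### Walls and the framing -/

section Wall

variable {L : ℝ}

/-- Near the point `c` the set `M` is the zero set of a function whose derivative at `c` in the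
direction of `v` does not vanish. The function lives on the covering plane. -/
def LocalWall (M : Set (Torus L)) (c : Torus L) (v : ℝ × ℝ) : Prop :=
  ∃ p₀, tc L p₀ = c ∧ ∃ (g : ℝ × ℝ → ℝ) (g' : ℝ × ℝ →L[ℝ] ℝ), HasStrictFDerivAt g g' p₀ ∧ g' v ≠ 0 ∧
    ∀ᶠ p in 𝓝 p₀, tc L p ∈ M ↔ g p = 0

lemma LocalWall.swap {M : Set (Torus L)} {c : Torus L} {v : ℝ × ℝ} (h : LocalWall M c v) :
    LocalWall (Prod.swap ⁻¹' M) c.swap v.swap := by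
  obtain ⟨p₀, rfl, g, g', hg, hv, hM⟩ := h
  have hsw : HasStrictFDerivAt (Prod.swap : ℝ × ℝ → ℝ × ℝ)
      ((ContinuousLinearMap.snd ℝ ℝ ℝ).prod (ContinuousLinearMap.fst ℝ ℝ ℝ)) p₀.swap :=
    ((ContinuousLinearMap.snd ℝ ℝ ℝ).prod (ContinuousLinearMap.fst ℝ ℝ ℝ)).hasStrictFDerivAt
  refine ⟨p₀.swap, rfl, g ∘ Prod.swap, _,
    HasStrictFDerivAt.comp (g := g) (g' := g') (f := Prod.swap) p₀.swap (by simpa using hg) hsw, ?_, ?_⟩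
  · simpa using hv
  · have : Tendsto (Prod.swap : ℝ × ℝ → ℝ × ℝ) (𝓝 p₀.swap) (𝓝 p₀) :=
      continuous_swap.tendsto' _ _ (by simp)
    exact this.eventually hM

/-- A wall can be described near any lift of the given point. -/
lemma LocalWall.at_lift {M : Set (Torus L)} {p : ℝ × ℝ} {v : ℝ × ℝ} (h : LocalWall M (tc L p) v) :
    ∃ (g : ℝ × ℝ → ℝ) (g' : ℝ × ℝ →L[ℝ] ℝ), HasStrictFDerivAt g g' p ∧ g' v ≠ 0 ∧
    ∀ᶠ x in 𝓝 p, tc L x ∈ M ↔ g x = 0 := by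
  obtain ⟨p₀, h0, g, g', hg, hv, hM⟩ := h
  obtain ⟨m, n, rfl⟩ := exists_period_of_tc_eq h0.symm
  refine ⟨fun x => g (x + (m * L, n * L)), g', ?_, hv, ?_⟩
  · have h1 : HasStrictFDerivAt (fun x : ℝ × ℝ => x + (m * L, n * L)) (ContinuousLinearMap.id ℝ (ℝ × ℝ)) p :=
      (hasStrictFDerivAt_id p).add_const _
    exact HasStrictFDerivAt.comp (g := g) (f := fun x : ℝ × ℝ => x + (m * L, n * L)) p hg h1
  · have : Tendsto (fun x : ℝ × ℝ => x + (m * L, n * L)) (𝓝 p) (𝓝 (p + (m * L, n * L))) :=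
      (continuous_id.add continuous_const).tendsto p
    filter_upwards [this.eventually hM] with x hx
    rwa [tc_add_period] at hx

lemma localWall_of_contDiffAt {M : Set (Torus L)} {f : Torus L → ℝ} {p₀ v : ℝ × ℝ}
    (hf : ContDiffAt ℝ 1 (fun p => f (tc L p)) p₀)
    (hv : v.1 * dS f (tc L p₀) + v.2 * dT f (tc L p₀) ≠ 0)
    (hM : ∀ᶠ p in 𝓝 p₀, tc L p ∈ M ↔ f (tc L p) = 0) : LocalWall M (tc L p₀) v := by
  refine ⟨p₀, rfl, _, _, hf.hasStrictFDerivAt one_ne_zero, ?_, hM⟩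
  rwa [fderiv_tc_apply (hf.differentiableAt one_ne_zero)]

lemma localWall_base {c : Torus L} {v : ℝ × ℝ} (hL : 0 < L) (hc : c.1 = 0) (hv : v.1 ≠ 0) :
    LocalWall {x : Torus L | x.1 = 0} c v := by
  obtain ⟨p, rfl⟩ := tc_surjective c
  refine ⟨p, rfl, fun x => x.1 - p.1, ContinuousLinearMap.fst ℝ ℝ ℝ,
    (ContinuousLinearMap.fst ℝ ℝ ℝ).hasStrictFDerivAt.sub_const _, hv, ?_⟩
  have hcont : Continuous fun x : ℝ × ℝ => |x.1 - p.1| := by fun_prop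
  have : ∀ᶠ x : ℝ × ℝ in 𝓝 p, |x.1 - p.1| < L :=
    (hcont.tendsto p).eventually_lt_const (by simpa using hL)
  filter_upwards [this] with x hx
  have hc' : (p.1 : AddCircle L) = 0 := hc
  change (x.1 : AddCircle L) = 0 ↔ _
  constructor
  · intro h
    have := Knot.eq_of_coe_eq_of_abs_lt (L := L) hx (hc'.trans h.symm)
    linarith
  · intro h
    have : x.1 = p.1 := by linarith
    rw [this, hc']

end Wall

namespace CordData

variable {L : ℝ} {K : Knot L} (X : CordData K)

/-- The framing vector turned by a right angle in the normal plane. -/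
noncomputable def coframe (a : ℝ) : E3 := cross (deriv K.lift a) (X.ν (a : AddCircle L))

lemma contDiff_coframe : ContDiff ℝ 1 X.coframe :=
  contDiff_cross (K.contDiff_deriv_lift.of_le (by simp)) (X.ν_smooth.of_le (by simp))

lemma continuous_ν : Continuous X.ν := continuous_of_comp_coe X.ν_smooth.continuous

lemma inner_ν_self (s : AddCircle L) : inner ℝ (X.ν s) (X.ν s) = 1 := by
  rw [real_inner_self_eq_norm_sq, X.ν_unit]; norm_num

lemma inner_tan_ν (s : AddCircle L) : inner ℝ (K.tan s) (X.ν s) = 0 := by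
  rw [real_inner_comm]; exact X.ν_normal s

lemma offS_tc {p : ℝ × ℝ} (h : |p.2 - p.1| < L) :
    X.offS (tc L p) = inner ℝ (K.nvec p) (X.coframe p.1) := by
  obtain ⟨k, hk⟩ := K.scaledChord_tc h
  have ht : K.tan (tc L p).1 = deriv K.lift p.1 := K.tan_coe p.1
  rw [offS, hk, ht, inner_add_left, real_inner_smul_left]
  rw [inner_cross_self_left, mul_zero, zero_add]
  rfl

lemma contDiffAt_offS {p : ℝ × ℝ} (h : |p.2 - p.1| < L) :
    ContDiffAt ℝ 1 (fun x => X.offS (tc L x)) p := by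
  have h1 : ContDiffAt ℝ 1 (fun x : ℝ × ℝ => inner ℝ (K.nvec x) (X.coframe x.1)) p :=
    (K.contDiffAt_nvec h).inner ℝ (X.contDiff_coframe.contDiffAt.comp p contDiffAt_fst)
  refine h1.congr_of_eventuallyEq ?_
  filter_upwards [Knot.eventually_abs_lt h] with x hx
  exact X.offS_tc hx

lemma continuous_dS_offS : Continuous (dS X.offS) ∧ Continuous (dT X.offS) := by
  rw [continuous_iff_continuousAt, continuous_iff_continuousAt, ← forall_and]
  intro c
  obtain ⟨p, rfl, hp⟩ := Knot.exists_lift_abs_lt K.length_pos c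
  have hc : ContinuousAt (fderiv ℝ (fun x => X.offS (tc L x))) p :=
    ((X.contDiffAt_offS hp).fderiv_right (m := 0) (by simp)).continuousAt
  unfold ContinuousAt
  rw [← map_tc_nhds, tendsto_map'_iff, tendsto_map'_iff]
  constructor
  · refine ContinuousAt.congr (f := fun x => fderiv ℝ (fun x => X.offS (tc L x)) x (1, 0))
      (hc.clm_apply continuousAt_const) ?_
    filter_upwards [Knot.eventually_abs_lt hp] with x hx
    exact (dS_tc ((X.contDiffAt_offS hx).differentiableAt one_ne_zero)).symm
  · refine ContinuousAt.congr (f := fun x => fderiv ℝ (fun x => X.offS (tc L x)) x (0, 1))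
      (hc.clm_apply continuousAt_const) ?_
    filter_upwards [Knot.eventually_abs_lt hp] with x hx
    exact (dT_tc ((X.contDiffAt_offS hx).differentiableAt one_ne_zero)).symm

lemma continuous_along_offS : Continuous (X.along X.offS) :=
  ((continuous_fst.comp X.continuous_vel).mul X.continuous_dS_offS.1).add
    ((continuous_snd.comp X.continuous_vel).mul X.continuous_dS_offS.2)

lemma dS_offE (c : Torus L) : dS X.offE c = dT X.offS c.swap := rfl
lemma dT_offE (c : Torus L) : dT X.offE c = dS X.offS c.swap := rfl

lemma continuous_along_offE : Continuous (X.along X.offE) := by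
  have h : X.along X.offE =
      fun c => (X.vel c).1 * dT X.offS c.swap + (X.vel c).2 * dS X.offS c.swap := by
    ext c; rw [along, dS_offE, dT_offE]
  rw [h]
  have h1 : Continuous fun c : Torus L => dT X.offS c.swap := X.continuous_dS_offS.2.comp continuous_swap
  have h2 : Continuous fun c : Torus L => dS X.offS c.swap := X.continuous_dS_offS.1.comp continuous_swap
  have h3 := X.continuous_vel
  exact (h3.fst.mul h1).add (h3.snd.mul h2)

lemma mem_Fs_iff_normalChord (c : Torus L) :
    c ∈ X.Fs ↔ ∃ α : ℝ, 0 < α ∧ K.normalChord c = α • X.ν c.1 := Iff.rfl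

lemma normalChord_eq (c : Torus L) :
    K.normalChord c = (inner ℝ (K.normalChord c) (X.ν c.1) : ℝ) • X.ν c.1 +
      X.offS c • cross (K.tan c.1) (X.ν c.1) := by
  have h := eq_of_orthonormal_frame (v := K.normalChord c) (K.inner_tan_self c.1) (X.inner_ν_self c.1)
    (X.inner_tan_ν c.1)
  rw [K.inner_normalChord_tan, zero_smul, zero_add] at h
  have h2 : inner ℝ (K.normalChord c) (cross (K.tan c.1) (X.ν c.1)) = X.offS c := by
    rw [Knot.normalChord, Knot.normalProj, inner_sub_left, real_inner_smul_left, inner_cross_self_left, mul_zero,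
      sub_zero, offS]
  rw [h2] at h
  exact h

lemma mem_Fs_iff (c : Torus L) :
    c ∈ X.Fs ↔ 0 < inner ℝ (K.normalChord c) (X.ν c.1) ∧ X.offS c = 0 := by
  rw [mem_Fs_iff_normalChord]
  constructor
  · rintro ⟨α, hα, h⟩
    constructor
    · rw [h, real_inner_smul_left, X.inner_ν_self]; simpa using hα
    · have h2 : inner ℝ (K.normalChord c) (cross (K.tan c.1) (X.ν c.1)) = X.offS c := by
        rw [Knot.normalChord, Knot.normalProj, inner_sub_left, real_inner_smul_left, inner_cross_self_left,
          mul_zero, sub_zero, offS]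
      rw [← h2, h, real_inner_smul_left, inner_cross_self_right, mul_zero]
  · rintro ⟨h1, h2⟩
    refine ⟨_, h1, ?_⟩
    have := X.normalChord_eq c
    rwa [h2, zero_smul, add_zero] at this

lemma continuous_inner_normalChord :
    Continuous (fun c : Torus L => (inner ℝ (K.normalChord c) (X.ν c.1) : ℝ)) :=
  K.continuous_normalChord.inner (X.continuous_ν.comp continuous_fst)

variable {X}

/-- A limit of cords in `F^s` has a nonnegative multiple of the framing vector as its normal component; if the
multiple is zero, it is tangent to the knot. -/
lemma closure_Fs_subset (hK : K.Generic) : closure X.Fs ⊆ X.Fs ∪ K.tangentStart := by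
  have hcl : IsClosed {c : Torus L | K.normalChord c = ‖K.normalChord c‖ • X.ν c.1} :=
    isClosed_eq K.continuous_normalChord
      (K.continuous_normalChord.norm.smul (X.continuous_ν.comp continuous_fst))
  have hsub : X.Fs ⊆ {c : Torus L | K.normalChord c = ‖K.normalChord c‖ • X.ν c.1} := by
    rintro c ⟨α, hα, h⟩
    have h : K.normalChord c = α • X.ν c.1 := h
    change K.normalChord c = ‖K.normalChord c‖ • X.ν c.1
    rw [h, norm_smul, X.ν_unit, Real.norm_eq_abs, abs_of_pos hα, mul_one]
  intro c hc
  have h : K.normalChord c = ‖K.normalChord c‖ • X.ν c.1 := closure_minimal hsub hcl hc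
  by_cases h0 : K.normalChord c = 0
  · exact Or.inr ((hK.mem_tangentStart_iff c).2 h0)
  · exact Or.inl ⟨_, norm_pos_iff.2 h0, h⟩

lemma closure_Fe_subset (hK : K.Generic) : closure X.Fe ⊆ X.Fe ∪ Prod.swap ⁻¹' K.tangentStart := by
  have h1 : closure X.Fe ⊆ Prod.swap ⁻¹' closure X.Fs :=
    closure_minimal (fun c hc => subset_closure (show c.swap ∈ X.Fs from hc))
      (isClosed_closure.preimage continuous_swap)
  intro c hc
  rcases closure_Fs_subset hK (h1 hc) with h | h
  · exact Or.inl h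
  · exact Or.inr h

/-- The cords in `∂F` are tangent to the knot. -/
lemma bdryF_subset (hK : K.Generic) : X.bdryF ⊆ K.bdryS := by
  rw [Knot.bdryS_eq]
  rintro c (⟨h1, h2⟩ | ⟨h1, h2⟩)
  · exact Or.inl ((closure_Fs_subset hK h1).resolve_left h2)
  · exact Or.inr ((closure_Fe_subset hK h1).resolve_left h2)

lemma localWall_Fs {c : Torus L} {v : ℝ × ℝ} (hc : c ∈ X.Fs)
    (hv : v.1 * dS X.offS c + v.2 * dT X.offS c ≠ 0) : LocalWall X.Fs c v := by
  obtain ⟨p, rfl, hp⟩ := Knot.exists_lift_abs_lt K.length_pos c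
  refine localWall_of_contDiffAt (X.contDiffAt_offS hp) hv ?_
  have hpos := ((X.mem_Fs_iff _).1 hc).1
  have : ∀ᶠ x in 𝓝 (tc L p), 0 < inner ℝ (K.normalChord x) (X.ν x.1) :=
    (X.continuous_inner_normalChord.tendsto _).eventually_const_lt hpos
  filter_upwards [eventually_nhds_tc.1 this] with x hx
  rw [X.mem_Fs_iff]
  exact and_iff_right hx

lemma localWall_Fe {c : Torus L} {v : ℝ × ℝ} (hc : c ∈ X.Fe)
    (hv : v.1 * dS X.offE c + v.2 * dT X.offE c ≠ 0) : LocalWall X.Fe c v := by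
  have := (localWall_Fs (X := X) (c := c.swap) (v := v.swap) hc
    (by rw [dS_offE, dT_offE] at hv; simp only [Prod.fst_swap, Prod.snd_swap]; rwa [add_comm])).swap
  rw [Prod.swap_swap, Prod.swap_swap] at this
  exact this

/-- A critical point of the perturbed energy is not tangent to the knot. -/
lemma Generic.notMem_bdryS (hX : X.Generic) {d : Torus L} (hd : IsCrit X.E d) : d ∉ K.bdryS := by
  rintro ⟨hne, h⟩
  have hc := hX.crit_offDiag d hne hd
  have h1 : inner ℝ (K.chord d) (K.tan d.1) = 0 := by
    have := hc.1; rw [K.dS_energy] at this; linarith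
  have h2 : inner ℝ (K.chord d) (K.tan d.2) = 0 := by
    have := hc.2; rwa [K.dT_energy] at this
  apply K.chord_ne_zero hne
  rcases h with ⟨a, ha⟩ | ⟨a, ha⟩
  · rw [ha, real_inner_smul_left, K.inner_tan_self, mul_one] at h1
    rw [ha, h1, zero_smul]
  · rw [ha, real_inner_smul_left, K.inner_tan_self, mul_one] at h2
    rw [ha, h2, zero_smul]

end CordData
/-! ### Cords that meet the knot in their interior -/

section

variable {L : ℝ}

lemma eventually_nhds_tc_coe {P : Torus L × AddCircle L → Prop} {p : ℝ × ℝ} {x : ℝ} :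
    (∀ᶠ z in 𝓝 (tc L p, (x : AddCircle L)), P z) ↔
      ∀ᶠ y in 𝓝 (p, x), P (tc L y.1, (y.2 : AddCircle L)) := by
  rw [nhds_prod_eq, ← map_tc_nhds, ← map_coe_nhds, prod_map_map_eq', eventually_map, ← nhds_prod_eq]
  rfl

end

namespace Knot

variable {L : ℝ} {K : Knot L}

lemma Hit.swap {c : Torus L} {u : AddCircle L} {r : ℝ} (h : K.Hit c u r) : K.Hit c.swap u (1 - r) := by
  obtain ⟨h1, h2, h3, h4⟩ := h
  refine ⟨Ne.symm h1, by linarith, by linarith, ?_⟩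
  rw [h4, Prod.fst_swap, Prod.snd_swap]; module

lemma Hit.sub_start {c : Torus L} {u : AddCircle L} {r : ℝ} (h : K.Hit c u r) :
    K.γ u - K.γ c.1 = r • K.chord c := by
  rw [h.2.2.2, chord]; module

lemma Hit.end_sub {c : Torus L} {u : AddCircle L} {r : ℝ} (h : K.Hit c u r) :
    K.γ c.2 - K.γ u = (1 - r) • K.chord c := by
  rw [h.2.2.2, chord]; module

lemma Hit.ne_start {c : Torus L} {u : AddCircle L} {r : ℝ} (h : K.Hit c u r) : u ≠ c.1 := by
  rintro rfl
  have := h.sub_start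
  rw [sub_self] at this
  rcases smul_eq_zero.1 this.symm with h0 | h0
  · exact h.2.1.ne' h0
  · exact K.chord_ne_zero h.1 h0

lemma Hit.ne_end {c : Torus L} {u : AddCircle L} {r : ℝ} (h : K.Hit c u r) : u ≠ c.2 :=
  h.swap.ne_start

lemma Hit.ratio_unique {c : Torus L} {u : AddCircle L} {r r' : ℝ} (h : K.Hit c u r) (h' : K.Hit c u r') :
    r = r' :=
  smul_left_injective ℝ (K.chord_ne_zero h.1) (h.sub_start.symm.trans h'.sub_start)

/-- Divided differences at the startpoint of a cord that meets the knot in its interior are parallel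
to the cord. -/
lemma Hit.exists_smul_dd {a b x : ℝ} {r : ℝ} (h : K.Hit (tc L (a, b)) (x : AddCircle L) r) :
    ∃ k : ℝ, K.chord (tc L (a, b)) = k • K.dd (a, x) := by
  have h1 := h.sub_start
  change K.lift x - K.lift a = _ at h1
  rw [← K.smul_dd] at h1
  refine ⟨r⁻¹ * (x - a), ?_⟩
  rw [mul_smul, h1, smul_smul, inv_mul_cancel₀ h.2.1.ne', one_smul]

/-- The strict derivative at `a = b` of a component of `(γ b - γ a) / (b - a)`, as a function of `a`, `b`
and a further variable. -/
lemma hasStrictFDerivAt_inner_dd_fst (V : E3) (a x : ℝ) :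
    HasStrictFDerivAt (fun y : (ℝ × ℝ) × ℝ => (inner ℝ V (K.dd y.1) : ℝ))
      ((inner ℝ V (deriv (deriv K.lift) a) / 2 : ℝ) • ((ContinuousLinearMap.fst ℝ ℝ ℝ
        + ContinuousLinearMap.snd ℝ ℝ ℝ).comp (ContinuousLinearMap.fst ℝ (ℝ × ℝ) ℝ))) ((a, a), x) := by
  have h1 : HasStrictFDerivAt (fun y : (ℝ × ℝ) × ℝ => K.dd y.1) _ ((a, a), x) :=
    (K.hasStrictFDerivAt_dd a).comp ((a, a), x) hasStrictFDerivAt_fst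
  refine ((innerSL ℝ V).hasStrictFDerivAt.comp ((a, a), x) h1).congr_fderiv ?_
  ext <;> simp <;> ring

lemma hasStrictFDerivAt_inner_dd_snd (V : E3) (a b : ℝ) :
    HasStrictFDerivAt (fun y : (ℝ × ℝ) × ℝ => (inner ℝ V (K.dd (y.1.1, y.2)) : ℝ))
      ((inner ℝ V (deriv (deriv K.lift) a) / 2 : ℝ) • ((ContinuousLinearMap.fst ℝ ℝ ℝ).comp
        (ContinuousLinearMap.fst ℝ (ℝ × ℝ) ℝ) + ContinuousLinearMap.snd ℝ (ℝ × ℝ) ℝ)) ((a, b), a) := by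
  have h1 : HasStrictFDerivAt (fun y : (ℝ × ℝ) × ℝ => K.dd (y.1.1, y.2)) _ ((a, b), a) :=
    HasStrictFDerivAt.comp (g := K.dd) (f := fun y : (ℝ × ℝ) × ℝ => (y.1.1, y.2)) ((a, b), a)
      (K.hasStrictFDerivAt_dd a)
      ((hasStrictFDerivAt_fst.comp ((a, b), a) hasStrictFDerivAt_fst).prodMk hasStrictFDerivAt_snd)
  refine ((innerSL ℝ V).hasStrictFDerivAt.comp ((a, b), a) h1).congr_fderiv ?_
  ext <;> simp <;> ring

/-- Short cords do not meet the knot in their interior: by the curvature, a third point of the knot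
near the cord cannot be collinear with its ends. -/
lemma Generic.no_hit_near_diag (hK : K.Generic) (a₀ : ℝ) :
    ∀ᶠ z in 𝓝 (tc L (a₀, a₀), (a₀ : AddCircle L)), ∀ r, ¬ K.Hit z.1 z.2 r := by
  rw [eventually_nhds_tc_coe]
  set T := deriv K.lift a₀ with hT
  set N := deriv (deriv K.lift) a₀ with hN
  have hTT : inner ℝ T T = 1 := by rw [real_inner_self_eq_norm_sq, K.norm_deriv_lift]; norm_num
  have hNT : inner ℝ N T = 0 := by
    have := K.inner_acc_tan (a₀ : AddCircle L)
    rwa [K.acc_coe, K.tan_coe] at this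
  have hTN : inner ℝ T N = 0 := by rw [real_inner_comm]; exact hNT
  have hNN : 0 < inner ℝ N N := by
    rw [real_inner_self_pos]
    have := hK.curvature (a₀ : AddCircle L)
    rwa [K.acc_coe] at this
  -- the minor of the two divided differences with respect to the normal and the tangent
  set W : (ℝ × ℝ) × ℝ → ℝ := fun y =>
    inner ℝ N (K.dd (y.1.1, y.2)) * inner ℝ T (K.dd y.1)
      - inner ℝ T (K.dd (y.1.1, y.2)) * inner ℝ N (K.dd y.1) with hW
  have hWd : HasStrictFDerivAt W ((inner ℝ N N / 2 : ℝ) • (ContinuousLinearMap.snd ℝ (ℝ × ℝ) ℝ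
      - (ContinuousLinearMap.snd ℝ ℝ ℝ).comp (ContinuousLinearMap.fst ℝ (ℝ × ℝ) ℝ)))
      ((a₀, a₀), a₀) := by
    refine HasStrictFDerivAt.congr_fderiv (((K.hasStrictFDerivAt_inner_dd_snd N a₀ a₀).mul
      (K.hasStrictFDerivAt_inner_dd_fst T a₀ a₀)).sub ((K.hasStrictFDerivAt_inner_dd_snd T a₀ a₀).mul
      (K.hasStrictFDerivAt_inner_dd_fst N a₀ a₀))) ?_
    simp only [K.dd_self, ← hT, ← hN, hTT, hTN, hNT]
    ext <;> simp
  have hlo := hWd.isLittleO.def (c := inner ℝ N N / 4) (by positivity)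
  have htend : Tendsto (fun y : (ℝ × ℝ) × ℝ => (y, (y.1, y.1.2))) (𝓝 ((a₀, a₀), a₀))
      (𝓝 (((a₀, a₀), a₀), ((a₀, a₀), a₀))) :=
    (show Continuous (fun y : (ℝ × ℝ) × ℝ => (y, (y.1, y.1.2))) by fun_prop).tendsto' _ _ rfl
  filter_upwards [htend.eventually hlo] with y hy r hit
  obtain ⟨⟨a, b⟩, x⟩ := y
  have hW0 : inner ℝ N (K.dd (a, x)) * inner ℝ T (K.dd (a, b))
      - inner ℝ T (K.dd (a, x)) * inner ℝ N (K.dd (a, b)) = 0 := by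
    obtain ⟨k, hk⟩ := hit.exists_smul_dd
    rw [chord_tc, ← K.smul_dd] at hk
    have hba : b - a ≠ 0 := by
      intro h
      exact hit.1 (by simp [tc, show b = a by linarith])
    have hk' : K.dd (a, b) = ((b - a)⁻¹ * k) • K.dd (a, x) := by
      rw [mul_smul, ← hk, smul_smul, inv_mul_cancel₀ hba, one_smul]
    rw [hk', real_inner_smul_right, real_inner_smul_right]; ring
  have hval : (((a, b), x) : (ℝ × ℝ) × ℝ) - ((a, b), b) = ((0, 0), x - b) := by
    ext <;> simp
  rw [hval] at hy
  have hnorm : ‖(((0, 0), x - b) : (ℝ × ℝ) × ℝ)‖ = |x - b| := by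
    simp [Prod.norm_def]
  rw [hnorm] at hy
  have hlhs : |(x - b) * (inner ℝ N N / 2)| ≤ inner ℝ N N / 4 * |x - b| := by
    refine le_trans (le_of_eq ?_) hy
    simp only [hW, hW0]
    rw [Real.norm_eq_abs, ← abs_neg]
    congr 1
    simp
    ring
  have hxb : x - b = 0 := by
    rw [abs_mul, abs_of_pos (by positivity : 0 < inner ℝ N N / 2)] at hlhs
    have : |x - b| * (inner ℝ N N / 4) ≤ 0 := by nlinarith
    have h3 : |x - b| ≤ 0 := by
      by_contra hcon
      push Not at hcon
      nlinarith [mul_pos hcon hNN]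
    exact abs_nonpos_iff.1 h3
  exact hit.ne_end (by simp [tc, show x = b by linarith])

/-- Cords near a cord that is not tangent to the knot at its startpoint do not meet the knot in
their interior near the startpoint. -/
lemma Generic.no_hit_near_start (hK : K.Generic) {c₀ : Torus L} (hc : c₀ ∉ K.tangentStart) :
    ∀ᶠ z in 𝓝 (c₀, c₀.1), ∀ r, ¬ K.Hit z.1 z.2 r := by
  obtain ⟨⟨a₀, b₀⟩, rfl⟩ := tc_surjective c₀
  by_cases hd : (a₀ : AddCircle L) = b₀
  · have : tc L (a₀, b₀) = tc L (a₀, a₀) := by simp [tc, hd]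
    rw [this]
    exact hK.no_hit_near_diag a₀
  · change ∀ᶠ z in 𝓝 (tc L (a₀, b₀), (a₀ : AddCircle L)), _
    rw [eventually_nhds_tc_coe]
    have hne : (tc L (a₀, b₀)).1 ≠ (tc L (a₀, b₀)).2 := hd
    rw [hK.mem_tangentStart_iff] at hc
    set T := deriv K.lift a₀ with hT
    set w := K.normalChord (tc L (a₀, b₀)) with hw
    have hTT : inner ℝ T T = 1 := by rw [real_inner_self_eq_norm_sq, K.norm_deriv_lift]; norm_num
    have hwT : inner ℝ w T = 0 := by
      have := K.inner_normalChord_tan (tc L (a₀, b₀))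
      rwa [show K.tan (tc L (a₀, b₀)).1 = T from K.tan_coe a₀] at this
    set W : (ℝ × ℝ) × ℝ → ℝ := fun y =>
      inner ℝ (K.chord (tc L y.1)) w * inner ℝ (K.dd (y.1.1, y.2)) T
        - inner ℝ (K.chord (tc L y.1)) T * inner ℝ (K.dd (y.1.1, y.2)) w with hW
    have hWc : Continuous W := by
      have h1 : Continuous (fun y : (ℝ × ℝ) × ℝ => K.chord (tc L y.1)) :=
        K.continuous_chord.comp (continuous_tc.comp continuous_fst)
      have h2 : Continuous (fun y : (ℝ × ℝ) × ℝ => K.dd (y.1.1, y.2)) :=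
        K.contDiff_dd.continuous.comp (by fun_prop)
      exact ((h1.inner continuous_const).mul (h2.inner continuous_const)).sub
        ((h1.inner continuous_const).mul (h2.inner continuous_const))
    have hW0 : W ((a₀, b₀), a₀) ≠ 0 := by
      obtain ⟨k, hk⟩ := K.chord_eq_of_ne hne
      have hk' : inner ℝ (K.chord (tc L (a₀, b₀))) w = ‖K.chord (tc L (a₀, b₀))‖ ^ 2 * ‖w‖ ^ 2 := by
        conv_lhs => rw [hk]
        rw [inner_add_left, real_inner_smul_left, real_inner_smul_left, ← hw, real_inner_self_eq_norm_sq,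
          show K.tan (tc L (a₀, b₀)).1 = T from K.tan_coe a₀, real_inner_comm, hwT]
        ring
      simp only [hW, K.dd_self, ← hT, hTT, hk']
      rw [real_inner_comm w T, hwT]
      have h1 := norm_ne_zero_iff.2 (K.chord_ne_zero hne)
      have h2 := norm_ne_zero_iff.2 hc
      simp only [mul_one, mul_zero, sub_zero]
      positivity
    filter_upwards [hWc.continuousAt.eventually_ne hW0] with y hy r hit
    obtain ⟨⟨a, b⟩, x⟩ := y
    obtain ⟨k, hk⟩ := hit.exists_smul_dd
    apply hy
    simp only [hW]
    rw [hk, real_inner_smul_left, real_inner_smul_left]; ring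

lemma Generic.no_hit_near_end (hK : K.Generic) {c₀ : Torus L} (hc : c₀.swap ∉ K.tangentStart) :
    ∀ᶠ z in 𝓝 (c₀, c₀.2), ∀ r, ¬ K.Hit z.1 z.2 r := by
  have h := hK.no_hit_near_start hc
  have ht : Tendsto (fun z : Torus L × AddCircle L => (z.1.swap, z.2)) (𝓝 (c₀, c₀.2))
      (𝓝 (c₀.swap, c₀.swap.1)) :=
    ((continuous_swap.comp continuous_fst).prodMk continuous_snd).tendsto' _ _ rfl
  filter_upwards [ht.eventually h] with z hz r hit
  exact hz _ hit.swap

/-- If a cord that is not tangent to the knot does not meet it at `γ u`, neither do the nearby cords near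
`γ u`. -/
lemma Generic.eventually_not_hit (hK : K.Generic) {c₀ : Torus L} (hc : c₀ ∉ K.bdryS)
    {u₀ : AddCircle L} {r₀ : ℝ} (hn : ¬ K.Hit c₀ u₀ r₀) :
    ∀ᶠ z : Torus L × (AddCircle L × ℝ) in 𝓝 (c₀, (u₀, r₀)), ¬ K.Hit z.1 z.2.1 z.2.2 := by
  rw [bdryS_eq, mem_union, not_or] at hc
  have hstart : u₀ = c₀.1 → ∀ᶠ z : Torus L × (AddCircle L × ℝ) in 𝓝 (c₀, (u₀, r₀)),
      ¬ K.Hit z.1 z.2.1 z.2.2 := by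
    rintro rfl
    have ht : Tendsto (fun z : Torus L × (AddCircle L × ℝ) => (z.1, z.2.1)) (𝓝 (c₀, (c₀.1, r₀)))
        (𝓝 (c₀, c₀.1)) :=
      (continuous_fst.prodMk (continuous_fst.comp continuous_snd)).tendsto' _ _ rfl
    filter_upwards [ht.eventually (hK.no_hit_near_start hc.1)] with z hz
    exact hz _
  have hend : u₀ = c₀.2 → ∀ᶠ z : Torus L × (AddCircle L × ℝ) in 𝓝 (c₀, (u₀, r₀)),
      ¬ K.Hit z.1 z.2.1 z.2.2 := by
    rintro rfl
    have ht : Tendsto (fun z : Torus L × (AddCircle L × ℝ) => (z.1, z.2.1)) (𝓝 (c₀, (c₀.2, r₀)))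
        (𝓝 (c₀, c₀.2)) :=
      (continuous_fst.prodMk (continuous_fst.comp continuous_snd)).tendsto' _ _ rfl
    filter_upwards [ht.eventually (hK.no_hit_near_end hc.2)] with z hz
    exact hz _
  have hr : Tendsto (fun z : Torus L × (AddCircle L × ℝ) => z.2.2) (𝓝 (c₀, (u₀, r₀))) (𝓝 r₀) :=
    (continuous_snd.comp continuous_snd).tendsto' _ _ rfl
  rcases lt_trichotomy r₀ 0 with h0 | h0 | h0
  · filter_upwards [hr.eventually_lt_const h0] with z hz hit
    exact absurd hit.2.1 (not_lt.2 hz.le)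
  · by_cases hu : u₀ = c₀.1
    · exact hstart hu
    · have hcont : Continuous (fun z : Torus L × (AddCircle L × ℝ) => K.γ z.2.1 -
          ((1 - z.2.2) • K.γ z.1.1 + z.2.2 • K.γ z.1.2)) := by
        have := K.continuous_γ; fun_prop
      have hne : (fun z : Torus L × (AddCircle L × ℝ) => K.γ z.2.1 -
          ((1 - z.2.2) • K.γ z.1.1 + z.2.2 • K.γ z.1.2)) (c₀, (u₀, r₀)) ≠ 0 := by
        simp only [h0, sub_zero, one_smul, zero_smul, add_zero]
        exact fun h => hu (K.injective (sub_eq_zero.1 h))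
      filter_upwards [hcont.continuousAt.eventually_ne hne] with z hz hit
      exact hz (sub_eq_zero.2 hit.2.2.2)
  · rcases lt_trichotomy r₀ 1 with h1 | h1 | h1
    · by_cases heq : K.γ u₀ = (1 - r₀) • K.γ c₀.1 + r₀ • K.γ c₀.2
      · have hcc : c₀.1 = c₀.2 := by
          by_contra hne
          exact hn ⟨hne, h0, h1, heq⟩
        refine hstart (K.injective ?_)
        rw [heq, ← hcc]; module
      · have hcont : Continuous (fun z : Torus L × (AddCircle L × ℝ) => K.γ z.2.1 -
            ((1 - z.2.2) • K.γ z.1.1 + z.2.2 • K.γ z.1.2)) := by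
          have := K.continuous_γ; fun_prop
        filter_upwards [hcont.continuousAt.eventually_ne (sub_ne_zero.2 heq)] with z hz hit
        exact hz (sub_eq_zero.2 hit.2.2.2)
    · by_cases hu : u₀ = c₀.2
      · exact hend hu
      · have hcont : Continuous (fun z : Torus L × (AddCircle L × ℝ) => K.γ z.2.1 -
            ((1 - z.2.2) • K.γ z.1.1 + z.2.2 • K.γ z.1.2)) := by
          have := K.continuous_γ; fun_prop
        have hne : (fun z : Torus L × (AddCircle L × ℝ) => K.γ z.2.1 -
            ((1 - z.2.2) • K.γ z.1.1 + z.2.2 • K.γ z.1.2)) (c₀, (u₀, r₀)) ≠ 0 := by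
          simp only [h1, sub_self, one_smul, zero_smul, zero_add]
          exact fun h => hu (K.injective (sub_eq_zero.1 h))
        filter_upwards [hcont.continuousAt.eventually_ne hne] with z hz hit
        exact hz (sub_eq_zero.2 hit.2.2.2)
    · filter_upwards [hr.eventually_const_lt h1] with z hz hit
      exact absurd hit.2.2.1 (not_lt.2 hz.le)

/-- If all hits of `c₀` are in the open set `U`, the same is true for the hits of the cords near `c₀`. -/
lemma Generic.eventually_hit_mem (hK : K.Generic) {c₀ : Torus L} (hc : c₀ ∉ K.bdryS)
    {U : Set (AddCircle L × ℝ)} (hU : IsOpen U) (h : ∀ u r, K.Hit c₀ u r → (u, r) ∈ U) :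
    ∀ᶠ c in 𝓝 c₀, ∀ u r, K.Hit c u r → (u, r) ∈ U := by
  have : Fact (0 < L) := ⟨K.length_pos⟩
  have hcomp : IsCompact ((univ : Set (AddCircle L)) ×ˢ Icc (0 : ℝ) 1) := isCompact_univ.prod isCompact_Icc
  have := hcomp.eventually_forall_of_forall_eventually (x₀ := c₀)
    (P := fun c y => K.Hit c y.1 y.2 → y ∈ U) (by
      rintro ⟨u, r⟩ -
      by_cases hit : K.Hit c₀ u r
      · have ht : Tendsto (fun z : Torus L × (AddCircle L × ℝ) => z.2) (𝓝 (c₀, (u, r))) (𝓝 (u, r)) :=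
          continuous_snd.tendsto' _ _ rfl
        filter_upwards [ht.eventually (hU.mem_nhds (h u r hit))] with z hz _
        exact hz
      · filter_upwards [hK.eventually_not_hit hc hit] with z hz hz'
        exact absurd hz' hz)
  filter_upwards [this] with c hc u r hit
  exact hc (u, r) ⟨trivial, hit.2.1.le, hit.2.2.1.le⟩ hit

lemma Generic.eventually_notMem_S (hK : K.Generic) {c₀ : Torus L} (hc : c₀ ∉ K.bdryS) (hS : c₀ ∉ K.S) :
    ∀ᶠ c in 𝓝 c₀, c ∉ K.S := by
  filter_upwards [hK.eventually_hit_mem hc isOpen_empty fun u r h => hS ⟨u, r, h⟩] with c h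
  rintro ⟨u, r, hit⟩
  exact h u r hit

/-- A limit of cords that meet the knot in their interior does so too or is tangent to the knot. -/
lemma Generic.isClosed_S_union (hK : K.Generic) : IsClosed (K.S ∪ K.bdryS) := by
  rw [← isOpen_compl_iff, isOpen_iff_mem_nhds]
  intro c hc
  rw [mem_compl_iff, mem_union, not_or] at hc
  filter_upwards [hK.eventually_notMem_S hc.2 hc.1,
    hK.isClosed_bdryS.isOpen_compl.mem_nhds hc.2] with x h1 h2
  exact fun h => h.elim h1 h2

/-- The lengths of the cords in `S` are bounded below, since the short cords are not in `S`. -/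
lemma Generic.exists_length_lower_bound (hK : K.Generic) :
    ∃ ℓ : ℝ, 0 < ℓ ∧ ∀ c ∈ K.S ∪ K.bdryS, ℓ ≤ ‖K.chord c‖ := by
  have : Fact (0 < L) := ⟨K.length_pos⟩
  by_cases hne : (K.S ∪ K.bdryS).Nonempty
  · obtain ⟨c, hc, hmin⟩ := hK.isClosed_S_union.isCompact.exists_isMinOn hne
      K.continuous_chord.norm.continuousOn
    refine ⟨‖K.chord c‖, norm_pos_iff.2 (K.chord_ne_zero ?_), fun x hx => hmin hx⟩
    rcases hc with ⟨u, r, h⟩ | h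
    · exact h.1
    · exact h.1
  · exact ⟨1, one_pos, fun c hc => absurd ⟨c, hc⟩ hne⟩

end Knot
namespace Knot

variable {L : ℝ} {K : Knot L}

/-- The equation of a hit, with a further unknown that moves the cord in the direction of a vector `n`:
the left hand side is `(1 - r) γ a + r γ b + y n - γ x`. -/
noncomputable def hitFun (K : Knot L) (n : E3) (z : (ℝ × ℝ) × (ℝ × ℝ × ℝ)) : E3 :=
  ((1 - z.2.2.1) • K.lift z.1.1 + z.2.2.1 • K.lift z.1.2 + z.2.2.2 • n) - K.lift z.2.1

lemma hasStrictDerivAt_lift (K : Knot L) (a : ℝ) : HasStrictDerivAt K.lift (deriv K.lift a) a :=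
  ((K.contDiff_lift.contDiffAt).hasStrictDerivAt (by simp))

/-- Suppose that the vector `n = γ' u × (γ t - γ s)` of a hit does not vanish. Then the equation `hitFun = 0` can
be solved for the point `x` of the knot, the position `r` on the cord and the displacement `y` in the direction
of `n`, by the implicit function theorem. The cord itself meets the knot when the displacement `g` is zero, and
the values `uf` and `rf` give the intersection. -/
lemma exists_local_hit {p₀ : ℝ × ℝ} {x₀ r₀ : ℝ} (hit : K.Hit (tc L p₀) (x₀ : AddCircle L) r₀)
    (hn : K.conormal (tc L p₀) (x₀ : AddCircle L) ≠ 0) :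
    ∃ (g uf rf : ℝ × ℝ → ℝ) (g' : ℝ × ℝ →L[ℝ] ℝ), HasStrictFDerivAt g g' p₀ ∧
      (∀ v : ℝ × ℝ, ‖K.conormal (tc L p₀) (x₀ : AddCircle L)‖ ^ 2 * g' v =
        -inner ℝ (((1 - r₀) * v.1) • K.tan (p₀.1 : AddCircle L) + (r₀ * v.2) • K.tan (p₀.2 : AddCircle L))
          (K.conormal (tc L p₀) (x₀ : AddCircle L))) ∧
      ContinuousAt uf p₀ ∧ uf p₀ = x₀ ∧ ContinuousAt rf p₀ ∧ rf p₀ = r₀ ∧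
      ∀ᶠ y : (ℝ × ℝ) × (ℝ × ℝ) in 𝓝 (p₀, (x₀, r₀)), K.Hit (tc L y.1) (y.2.1 : AddCircle L) y.2.2 ↔
        g y.1 = 0 ∧ uf y.1 = y.2.1 ∧ rf y.1 = y.2.2 := by
  set n := K.conormal (tc L p₀) (x₀ : AddCircle L) with hndef
  set C := K.lift p₀.2 - K.lift p₀.1 with hC
  set T := deriv K.lift x₀ with hT
  have hnTC : n = cross T C := by
    rw [hndef, conormal, K.tan_coe, chord_tc]
  have hnT : inner ℝ n T = 0 := by rw [hnTC, real_inner_comm, inner_cross_self_left]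
  have hnC : inner ℝ n C = 0 := by rw [hnTC, real_inner_comm, inner_cross_self_right]
  have hnn : inner ℝ n n ≠ 0 := inner_self_ne_zero.2 hn
  set u : (ℝ × ℝ) × (ℝ × ℝ × ℝ) := (p₀, (x₀, r₀, 0)) with hu
  -- the coordinate projections
  set A : (ℝ × ℝ) × (ℝ × ℝ × ℝ) →L[ℝ] ℝ := (ContinuousLinearMap.fst ℝ ℝ ℝ).comp (ContinuousLinearMap.fst ℝ _ _)
  set B : (ℝ × ℝ) × (ℝ × ℝ × ℝ) →L[ℝ] ℝ := (ContinuousLinearMap.snd ℝ ℝ ℝ).comp (ContinuousLinearMap.fst ℝ _ _)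
  set X : (ℝ × ℝ) × (ℝ × ℝ × ℝ) →L[ℝ] ℝ := (ContinuousLinearMap.fst ℝ ℝ (ℝ × ℝ)).comp (ContinuousLinearMap.snd ℝ _ _)
  set R : (ℝ × ℝ) × (ℝ × ℝ × ℝ) →L[ℝ] ℝ := ((ContinuousLinearMap.fst ℝ ℝ ℝ).comp
    (ContinuousLinearMap.snd ℝ ℝ (ℝ × ℝ))).comp (ContinuousLinearMap.snd ℝ _ _)
  set Y : (ℝ × ℝ) × (ℝ × ℝ × ℝ) →L[ℝ] ℝ := ((ContinuousLinearMap.snd ℝ ℝ ℝ).comp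
    (ContinuousLinearMap.snd ℝ ℝ (ℝ × ℝ))).comp (ContinuousLinearMap.snd ℝ _ _)
  set f' : (ℝ × ℝ) × (ℝ × ℝ × ℝ) →L[ℝ] E3 :=
    A.smulRight ((1 - r₀) • deriv K.lift p₀.1) + B.smulRight (r₀ • deriv K.lift p₀.2)
      + R.smulRight C + Y.smulRight n - X.smulRight T with hf'
  have hA : HasStrictFDerivAt (fun z : (ℝ × ℝ) × (ℝ × ℝ × ℝ) => z.1.1) A u := A.hasStrictFDerivAt
  have hB : HasStrictFDerivAt (fun z : (ℝ × ℝ) × (ℝ × ℝ × ℝ) => z.1.2) B u := B.hasStrictFDerivAt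
  have hX : HasStrictFDerivAt (fun z : (ℝ × ℝ) × (ℝ × ℝ × ℝ) => z.2.1) X u := X.hasStrictFDerivAt
  have hR : HasStrictFDerivAt (fun z : (ℝ × ℝ) × (ℝ × ℝ × ℝ) => z.2.2.1) R u := R.hasStrictFDerivAt
  have hY : HasStrictFDerivAt (fun z : (ℝ × ℝ) × (ℝ × ℝ × ℝ) => z.2.2.2) Y u := Y.hasStrictFDerivAt
  have hlift : ∀ {φ : (ℝ × ℝ) × (ℝ × ℝ × ℝ) → ℝ}
      {φ' : (ℝ × ℝ) × (ℝ × ℝ × ℝ) →L[ℝ] ℝ}, HasStrictFDerivAt φ φ' u →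
      HasStrictFDerivAt (fun z => K.lift (φ z)) (φ'.smulRight (deriv K.lift (φ u))) u := by
    intro φ φ' hφ
    have := (K.hasStrictDerivAt_lift (φ u)).hasStrictFDerivAt.comp u hφ
    refine this.congr_fderiv ?_
    ext v <;> simp
  have hder : HasStrictFDerivAt (K.hitFun n) f' u := by
    have h1 := ((((hR.const_sub 1).smul (hlift hA)).add (hR.smul (hlift hB))).add
      (hY.smul_const n)).sub (hlift hX)
    refine HasStrictFDerivAt.congr_fderiv h1 ?_
    refine ContinuousLinearMap.ext fun v => ?_
    simp only [hf', hu, hC, hT, add_apply, sub_apply,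
      smul_apply, neg_apply,
      ContinuousLinearMap.smulRight_apply]
    module
  have hf0 : K.hitFun n u = 0 := by
    have := hit.2.2.2
    change K.lift x₀ = (1 - r₀) • K.lift p₀.1 + r₀ • K.lift p₀.2 at this
    simp only [hitFun, hu, zero_smul, add_zero, this, sub_self]
  have hinr : ∀ w : ℝ × ℝ × ℝ, f' (0, w) = w.2.1 • C + w.2.2 • n - w.1 • T := by
    intro w
    simp [hf', A, B, X, R, Y]
  have hinl : ∀ v : ℝ × ℝ, f' (v, 0) = ((1 - r₀) * v.1) • deriv K.lift p₀.1 + (r₀ * v.2) • deriv K.lift p₀.2 := by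
    intro v
    simp [hf', A, B, X, R, Y, smul_smul, mul_comm]
  have hinv : (f' ∘L ContinuousLinearMap.inr ℝ (ℝ × ℝ) (ℝ × ℝ × ℝ)).IsInvertible := by
    set M := f' ∘L ContinuousLinearMap.inr ℝ (ℝ × ℝ) (ℝ × ℝ × ℝ) with hM
    have hMw : ∀ w, M w = w.2.1 • C + w.2.2 • n - w.1 • T := hinr
    have hinj : Function.Injective (M : ℝ × ℝ × ℝ →ₗ[ℝ] E3) := by
      rw [← LinearMap.ker_eq_bot, LinearMap.ker_eq_bot']
      rintro ⟨x, r, y⟩ h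
      have h : r • C + y • n - x • T = 0 := (hMw _).symm.trans h
      have hy : y = 0 := by
        have := congrArg (fun V => (inner ℝ n V : ℝ)) h
        simp only [inner_sub_right, inner_add_right, real_inner_smul_right, hnT, hnC, inner_zero_right,
          mul_zero, zero_add, sub_zero] at this
        exact (mul_eq_zero.1 this).resolve_right hnn
      have h2 : r • C = x • T := by
        rw [hy, zero_smul, add_zero] at h; exact sub_eq_zero.1 h
      have hr : r = 0 := by
        have h3 : r • n = 0 := by
          rw [hnTC, ← cross_smul_right, h2]
          ext i
          fin_cases i <;> simp [cross_zero, cross_one, cross_two] <;> ring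
        exact (smul_eq_zero.1 h3).resolve_right hn
      have hx : x = 0 := by
        rw [hr, zero_smul] at h2
        refine (smul_eq_zero.1 h2.symm).resolve_right fun h0 => ?_
        have := K.norm_deriv_lift x₀
        rw [← hT, h0, norm_zero] at this
        exact zero_ne_one this
      rw [hx, hr, hy]; rfl
    have hdim : Module.finrank ℝ (ℝ × ℝ × ℝ) = Module.finrank ℝ E3 := by simp
    refine ⟨(LinearMap.linearEquivOfInjective (M : ℝ × ℝ × ℝ →ₗ[ℝ] E3) hinj hdim).toContinuousLinearEquiv, ?_⟩
    exact ContinuousLinearMap.ext fun w => rfl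
  set ψ := hder.implicitFunctionOfProdDomain hinv with hψ
  have hψd := hder.hasStrictFDerivAt_implicitFunctionOfProdDomain hinv
  have hψt : Tendsto ψ (𝓝 p₀) (𝓝 (x₀, r₀, 0)) := hder.tendsto_implicitFunctionOfProdDomain hinv
  have hψ0 : ψ p₀ = (x₀, r₀, 0) :=
    (hder.eventually_apply_eq_iff_implicitFunctionOfProdDomain hinv).self_of_nhds.1 rfl
  set ψ' := -(f' ∘L ContinuousLinearMap.inr ℝ (ℝ × ℝ) (ℝ × ℝ × ℝ)).inverse ∘L
    (f' ∘L ContinuousLinearMap.inl ℝ (ℝ × ℝ) (ℝ × ℝ × ℝ)) with hψ'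
  have hψ'eq : ∀ v, f' (0, ψ' v) = -f' (v, 0) := by
    intro v
    have h1 : (f' ∘L ContinuousLinearMap.inr ℝ (ℝ × ℝ) (ℝ × ℝ × ℝ)) (ψ' v) = - f' (v, 0) := by
      have : ψ' v = -((f' ∘L ContinuousLinearMap.inr ℝ (ℝ × ℝ) (ℝ × ℝ × ℝ)).inverse (f' (v, 0))) := rfl
      rw [this, map_neg, hinv.self_apply_inverse]
    exact h1
  refine ⟨fun p => (ψ p).2.2, fun p => (ψ p).1, fun p => (ψ p).2.1,
    ((ContinuousLinearMap.snd ℝ ℝ ℝ).comp (ContinuousLinearMap.snd ℝ ℝ (ℝ × ℝ))).comp ψ', ?_, ?_, ?_, ?_, ?_, ?_, ?_⟩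
  · exact ((ContinuousLinearMap.snd ℝ ℝ ℝ).comp (ContinuousLinearMap.snd ℝ ℝ (ℝ × ℝ))).hasStrictFDerivAt.comp p₀ hψd
  · intro v
    have h1 := hψ'eq v
    rw [hinr, hinl] at h1
    have h2 := congrArg (fun V => (inner ℝ n V : ℝ)) h1
    simp only [inner_sub_right, inner_add_right, real_inner_smul_right, hnT, hnC, inner_neg_right,
      mul_zero, zero_add, sub_zero] at h2
    rw [K.tan_coe, K.tan_coe, inner_add_left, real_inner_smul_left, real_inner_smul_left,
      real_inner_comm n (deriv K.lift p₀.1), real_inner_comm n (deriv K.lift p₀.2), ← h2,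
      ← real_inner_self_eq_norm_sq]
    simp only [ContinuousLinearMap.comp_apply, ContinuousLinearMap.coe_snd']
    ring
  · exact hψd.continuousAt.fst
  · simp only [hψ0]
  · exact hψd.continuousAt.snd.fst
  · simp only [hψ0]
  · have ht : Tendsto (fun y : (ℝ × ℝ) × (ℝ × ℝ) => ((y.1, (y.2.1, y.2.2, (0 : ℝ))) : (ℝ × ℝ) × (ℝ × ℝ × ℝ)))
        (𝓝 (p₀, (x₀, r₀))) (𝓝 u) :=
      (show Continuous (fun y : (ℝ × ℝ) × (ℝ × ℝ) => ((y.1, (y.2.1, y.2.2, (0 : ℝ))) :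
        (ℝ × ℝ) × (ℝ × ℝ × ℝ))) by fun_prop).tendsto' _ _ rfl
    have hr : Tendsto (fun y : (ℝ × ℝ) × (ℝ × ℝ) => y.2.2) (𝓝 (p₀, (x₀, r₀))) (𝓝 r₀) :=
      (continuous_snd.comp continuous_snd).tendsto' _ _ rfl
    have hch : Continuous (fun y : (ℝ × ℝ) × (ℝ × ℝ) => K.chord (tc L y.1)) :=
      K.continuous_chord.comp (continuous_tc.comp continuous_fst)
    filter_upwards [ht.eventually (hder.eventually_apply_eq_iff_implicitFunctionOfProdDomain hinv),
      hr.eventually_const_lt hit.2.1, hr.eventually_lt_const hit.2.2.1,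
      hch.continuousAt.eventually_ne (K.chord_ne_zero hit.1)] with y hy h0 h1 hne
    rw [hf0] at hy
    have hgoal : (K.hitFun n (y.1, (y.2.1, y.2.2, 0)) = 0) ↔ K.Hit (tc L y.1) (y.2.1 : AddCircle L) y.2.2 := by
      have hoff : (tc L y.1).1 ≠ (tc L y.1).2 := fun h => hne (by rw [chord, h, sub_self])
      simp only [hitFun, zero_smul, add_zero, sub_eq_zero]
      constructor
      · intro h; exact ⟨hoff, h0, h1, h.symm⟩
      · intro h; exact h.2.2.2.symm
    rw [← hgoal, hy]
    change ψ y.1 = _ ↔ _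
    rw [Prod.ext_iff, Prod.ext_iff]
    tauto

/-- Near a cord that meets the knot in its interior at one point only, transversally to `v`, the set `S` is
a wall and disjoint from `S₂`. -/
lemma Generic.localWall_S (hK : K.Generic) {c₀ : Torus L} {u₀ : AddCircle L} {r₀ : ℝ}
    (hit : K.Hit c₀ u₀ r₀) (h2 : c₀ ∉ K.S₂) (hb : c₀ ∉ K.bdryS) {v : ℝ × ℝ}
    (hv : inner ℝ (((1 - r₀) * v.1) • K.tan c₀.1 + (r₀ * v.2) • K.tan c₀.2) (K.conormal c₀ u₀) ≠ 0) :
    LocalWall K.S c₀ v ∧ ∀ᶠ c in 𝓝 c₀, c ∉ K.S₂ := by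
  have : Fact (0 < L) := ⟨K.length_pos⟩
  have hn : K.conormal c₀ u₀ ≠ 0 := by
    intro h; rw [h, inner_zero_right] at hv; exact hv rfl
  obtain ⟨p₀, rfl⟩ := tc_surjective c₀
  obtain ⟨x₀, rfl⟩ := QuotientAddGroup.mk_surjective u₀
  obtain ⟨g, uf, rf, g', hg, hg', huc, hu0, hrc, hr0, hloc⟩ := exists_local_hit hit hn
  have hcomp : IsCompact ((univ : Set (AddCircle L)) ×ˢ Icc (0 : ℝ) 1) := isCompact_univ.prod isCompact_Icc
  have hall := hcomp.eventually_forall_of_forall_eventually (x₀ := p₀)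
    (P := fun p y => K.Hit (tc L p) y.1 y.2 → g p = 0 ∧ y.1 = (uf p : AddCircle L)) (by
      rintro ⟨u, r⟩ -
      by_cases hur : u = x₀ ∧ r = r₀
      · obtain ⟨rfl, rfl⟩ := hur
        have : map (fun y : (ℝ × ℝ) × (ℝ × ℝ) => (y.1, ((y.2.1 : AddCircle L), y.2.2))) (𝓝 (p₀, (x₀, r)))
            = 𝓝 (p₀, ((x₀ : AddCircle L), r)) := by
          simp only [nhds_prod_eq]
          rw [← map_coe_nhds]
          have e1 := prod_map_map_eq' (fun x : ℝ => (x : AddCircle L)) (id : ℝ → ℝ) (𝓝 x₀) (𝓝 r)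
          rw [Filter.map_id] at e1
          rw [e1]
          have e2 := prod_map_map_eq' (id : ℝ × ℝ → ℝ × ℝ) (Prod.map (fun x : ℝ => (x : AddCircle L)) (id : ℝ → ℝ))
            (𝓝 p₀) (𝓝 x₀ ×ˢ 𝓝 r)
          rw [Filter.map_id] at e2
          rw [← nhds_prod_eq] at e2 ⊢
          rw [nhds_prod_eq] at e2
          rw [nhds_prod_eq, e2]
          rfl
        change ∀ᶠ z in 𝓝 (p₀, ((x₀ : AddCircle L), r)), _
        rw [← this, eventually_map]
        filter_upwards [hloc] with y hy hit'
        exact ⟨(hy.1 hit').1, by rw [(hy.1 hit').2.1]⟩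
      · have hno : ¬ K.Hit (tc L p₀) u r := by
          intro hit'
          apply hur
          have huu : u = x₀ := by
            by_contra hne
            exact h2 ⟨u, r, _, _, hit', hit, hne⟩
          subst huu
          exact ⟨rfl, hit'.ratio_unique hit⟩
        have ht : Tendsto (fun z : (ℝ × ℝ) × (AddCircle L × ℝ) => (tc L z.1, z.2)) (𝓝 (p₀, (u, r)))
            (𝓝 (tc L p₀, (u, r))) :=
          ((continuous_tc.comp continuous_fst).prodMk continuous_snd).tendsto' _ _ rfl
        filter_upwards [ht.eventually (hK.eventually_not_hit hb hno)] with z hz hz'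
        exact absurd hz' hz)
  refine ⟨⟨p₀, rfl, g, g', hg, ?_, ?_⟩, ?_⟩
  · intro h0
    have := hg' v
    rw [h0, mul_zero] at this
    exact hv (neg_eq_zero.1 this.symm)
  · have ht : Tendsto (fun p => (p, (uf p, rf p))) (𝓝 p₀) (𝓝 (p₀, (x₀, r₀))) := by
      have h1 := huc.tendsto
      have h2 := hrc.tendsto
      rw [hu0] at h1
      rw [hr0] at h2
      exact tendsto_id.prodMk_nhds (h1.prodMk_nhds h2)
    filter_upwards [ht.eventually hloc, hall] with p hp hp'
    constructor
    · rintro ⟨u, r, h⟩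
      exact (hp' (u, r) ⟨trivial, h.2.1.le, h.2.2.1.le⟩ h).1
    · intro h
      exact ⟨_, _, hp.2 ⟨h, rfl, rfl⟩⟩
  · rw [eventually_nhds_tc]
    filter_upwards [hall] with p hp
    rintro ⟨u, r, u', r', h, h', hne⟩
    have h1 := (hp (u, r) ⟨trivial, h.2.1.le, h.2.2.1.le⟩ h).2
    have h2 := (hp (u', r') ⟨trivial, h'.2.1.le, h'.2.2.1.le⟩ h').2
    exact hne (h1.trans h2.symm)

end Knot
/-! ### Crossings of walls by the flow -/

/-- A parametrized version of the one-variable implicit function theorem, without differentiability in the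
parameter: if `k (y, τ)` grows in `τ` at a rate close to one, it has a unique zero, which depends continuously
on `y`. -/
lemma exists_zero_curve {Y : Type*} [TopologicalSpace Y] {k : Y → ℝ → ℝ} {y₀ : Y} {τ₀ : ℝ}
    (h0 : k y₀ τ₀ = 0) (hc : ∀ᶠ τ in 𝓝 τ₀, ContinuousAt (fun y => k y τ) y₀)
    (hs : ∀ᶠ w : Y × (ℝ × ℝ) in 𝓝 (y₀, (τ₀, τ₀)),
      |k w.1 w.2.1 - k w.1 w.2.2 - (w.2.1 - w.2.2)| ≤ 1 / 2 * |w.2.1 - w.2.2|) :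
    ∃ θ : Y → ℝ, Tendsto θ (𝓝 y₀) (𝓝 τ₀) ∧ ∀ᶠ z : Y × ℝ in 𝓝 (y₀, τ₀), k z.1 z.2 = 0 ↔ z.2 = θ z.1 := by
  classical
  rw [nhds_prod_eq, nhds_prod_eq] at hs
  obtain ⟨U, hU, W, hW, hUW⟩ := eventually_prod_iff.1 hs
  obtain ⟨a, ha, b, hb, hab⟩ := eventually_prod_iff.1 hW
  obtain ⟨δ, hδ, hball⟩ := Metric.nhds_basis_closedBall.eventually_iff.1 ((ha.and hb).and hc)
  have hmem : ∀ {τ}, |τ - τ₀| ≤ δ ↔ τ ∈ Metric.closedBall τ₀ δ := by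
    intro τ; rw [Metric.mem_closedBall, Real.dist_eq]
  have key : ∀ {y}, U y → ∀ {τ τ'}, |τ - τ₀| ≤ δ → |τ' - τ₀| ≤ δ →
      |k y τ - k y τ' - (τ - τ')| ≤ 1 / 2 * |τ - τ'| := fun hy τ τ' h h' =>
    hUW hy (y := (τ, τ')) (hab (hball (hmem.1 h)).1.1 (hball (hmem.1 h')).1.2)
  have huniq : ∀ {y}, U y → ∀ {τ τ'}, |τ - τ₀| ≤ δ → |τ' - τ₀| ≤ δ → k y τ = 0 → k y τ' = 0 → τ = τ' := by
    intro y hy τ τ' h h' e e'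
    have := key hy h h'
    rw [e, e', sub_zero, zero_sub, abs_neg] at this
    exact sub_eq_zero.1 (abs_eq_zero.1 (by linarith [abs_nonneg (τ - τ')]))
  have hex : ∀ η, 0 < η → η ≤ δ → ∀ᶠ y in 𝓝 y₀, ∃ τ, |τ - τ₀| ≤ η ∧ k y τ = 0 := by
    intro η hη hηδ
    have h0U : U y₀ := hU.self_of_nhds
    have hself : |τ₀ - τ₀| ≤ δ := by simpa using hδ.le
    have hp : |τ₀ + η - τ₀| ≤ δ := by rw [add_sub_cancel_left, abs_of_pos hη]; exact hηδ
    have hm : |τ₀ - η - τ₀| ≤ δ := by rw [sub_sub_cancel_left, abs_neg, abs_of_pos hη]; exact hηδ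
    have h1 := key h0U hp hself
    have h2 := key h0U hm hself
    rw [h0, add_sub_cancel_left, abs_of_pos hη, sub_zero] at h1
    rw [h0, sub_sub_cancel_left, abs_neg, abs_of_pos hη, sub_zero] at h2
    have h1' : 0 < k y₀ (τ₀ + η) := by linarith [(abs_le.1 h1).1]
    have h2' : k y₀ (τ₀ - η) < 0 := by linarith [(abs_le.1 h2).2]
    filter_upwards [hU, (hball (hmem.1 hp)).2.tendsto.eventually_const_lt h1',
      (hball (hmem.1 hm)).2.tendsto.eventually_lt_const h2'] with y hy hy1 hy2
    have hcont : ContinuousOn (k y) (Icc (τ₀ - η) (τ₀ + η)) := by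
      have hlip : LipschitzOnWith 2 (k y) (Icc (τ₀ - η) (τ₀ + η)) := by
        refine LipschitzOnWith.of_dist_le_mul fun τ hτ τ' hτ' => ?_
        have h3 := key hy (τ := τ) (τ' := τ') (abs_le.2 ⟨by linarith [hτ.1], by linarith [hτ.2]⟩)
          (abs_le.2 ⟨by linarith [hτ'.1], by linarith [hτ'.2]⟩)
        rw [Real.dist_eq, Real.dist_eq]
        have h4 := abs_add_le (k y τ - k y τ' - (τ - τ')) (τ - τ')
        rw [sub_add_cancel] at h4
        push_cast
        linarith [abs_nonneg (τ - τ')]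
      exact hlip.continuousOn
    obtain ⟨τ, hτ, hk⟩ := intermediate_value_Icc (by linarith) hcont ⟨hy2.le, hy1.le⟩
    exact ⟨τ, abs_le.2 ⟨by linarith [hτ.1], by linarith [hτ.2]⟩, hk⟩
  refine ⟨fun y => if h : ∃ τ, |τ - τ₀| ≤ δ ∧ k y τ = 0 then h.choose else τ₀, ?_, ?_⟩
  · rw [Metric.tendsto_nhds]
    intro η hη
    filter_upwards [hU, hex (min (η / 2) δ) (lt_min (half_pos hη) hδ) (min_le_right _ _)] with y hy hτ
    obtain ⟨τ, hτ, hk⟩ := hτ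
    have h : ∃ τ, |τ - τ₀| ≤ δ ∧ k y τ = 0 := ⟨τ, hτ.trans (min_le_right _ _), hk⟩
    rw [dif_pos h, ← huniq hy (hτ.trans (min_le_right _ _)) h.choose_spec.1 hk h.choose_spec.2, Real.dist_eq]
    linarith [min_le_left (η / 2) δ]
  · rw [nhds_prod_eq]
    refine ((hU.and (hex δ hδ le_rfl)).prod_mk (Metric.closedBall_mem_nhds τ₀ hδ)).mono ?_
    rintro ⟨y, τ⟩ ⟨⟨hy, h⟩, hτ⟩
    replace hτ : |τ - τ₀| ≤ δ := hmem.2 hτ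
    simp only [dif_pos h]
    constructor
    · intro hk
      exact huniq hy hτ h.choose_spec.1 hk h.choose_spec.2
    · intro hk
      rw [hk]; exact h.choose_spec.2

lemma eventually_sign_eq {Y : Type*} {l : Filter Y} {f : Y → ℝ} {a : ℝ} (h : Tendsto f l (𝓝 a)) (ha : a ≠ 0) :
    ∀ᶠ y in l, SignType.sign (f y) = SignType.sign a := by
  rcases ha.lt_or_gt with ha | ha
  · filter_upwards [h.eventually_lt_const ha] with y hy
    rw [sign_neg hy, sign_neg ha]
  · filter_upwards [h.eventually_const_lt ha] with y hy
    rw [sign_pos hy, sign_pos ha]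

lemma eventually_injOn_of_tendsto {Y : Type*} {l : Filter Y} {P : Finset ℝ} {θ : ℝ → Y → ℝ}
    (hθ : ∀ p ∈ P, Tendsto (θ p) l (𝓝 p)) : ∀ᶠ y in l, InjOn (fun p => θ p y) (P : Set ℝ) := by
  have h : ∀ᶠ y in l, ∀ p ∈ P, ∀ p' ∈ P, p ≠ p' → θ p y ≠ θ p' y := by
    rw [Filter.eventually_all_finset]
    intro p hp
    rw [Filter.eventually_all_finset]
    intro p' hp'
    by_cases h : p = p'
    · exact Eventually.of_forall fun y hy => absurd h hy
    · exact (((hθ p hp).sub (hθ p' hp')).eventually_ne (sub_ne_zero.2 h)).mono fun y hy _ => sub_ne_zero.1 hy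
  filter_upwards [h] with y hy p hp p' hp' he
  by_contra hne
  exact hy p hp p' hp' hne he

/-- A section of the covering of the torus that is continuous at a given point. -/
lemma exists_section {L : ℝ} (hL : 0 < L) (p : ℝ × ℝ) :
    ∃ σ : Torus L → ℝ × ℝ, (∀ c, tc L (σ c) = c) ∧ Tendsto σ (𝓝 (tc L p)) (𝓝 p) := by
  have h : ∀ a : ℝ, ∃ σ : AddCircle L → ℝ, (∀ u, (σ u : AddCircle L) = u) ∧
      Tendsto σ (𝓝 (a : AddCircle L)) (𝓝 a) := by
    intro a
    choose σ hσ hn _ using exists_lift_near hL a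
    refine ⟨σ, hσ, ?_⟩
    rw [tendsto_iff_dist_tendsto_zero]
    simp only [Real.dist_eq, hn]
    exact (continuous_norm.comp (continuous_id.sub continuous_const)).tendsto' _ _ (by simp)
  obtain ⟨σ₁, h₁, t₁⟩ := h p.1
  obtain ⟨σ₂, h₂, t₂⟩ := h p.2
  exact ⟨fun c => (σ₁ c.1, σ₂ c.2), fun c => Prod.ext (h₁ _) (h₂ _),
    (t₁.comp (continuous_fst.tendsto _)).prodMk_nhds (t₂.comp (continuous_snd.tendsto _))⟩

namespace CordData
variable {L : ℝ} {K : Knot L} (X : CordData K)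

lemma lflow_increment (p : ℝ × ℝ) (τ₀ : ℝ) {η : ℝ} (hη : 0 < η) :
    ∀ᶠ w : (ℝ × ℝ) × (ℝ × ℝ) in 𝓝 (p, (τ₀, τ₀)),
      ‖X.lflow w.2.1 w.1 - X.lflow w.2.2 w.1 - (w.2.1 - w.2.2) • X.lvel (X.lflow τ₀ p)‖
        ≤ η * |w.2.1 - w.2.2| := by
  have hc : Continuous fun z : (ℝ × ℝ) × ℝ => X.lvel (X.lflow z.2 z.1) :=
    X.contDiff_lvel.continuous.comp (X.continuous_lflow.comp (continuous_snd.prodMk continuous_fst))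
  have h := Metric.tendsto_nhds.1 (hc.tendsto (p, τ₀)) η hη
  rw [nhds_prod_eq] at h
  obtain ⟨U, hU, W, hW, hUW⟩ := eventually_prod_iff.1 h
  obtain ⟨δ, hδ, hball⟩ := Metric.eventually_nhds_iff_ball.1 hW
  have hB : ∀ᶠ τ in 𝓝 τ₀, τ ∈ Metric.ball τ₀ δ := Metric.ball_mem_nhds τ₀ hδ
  rw [nhds_prod_eq, nhds_prod_eq (x := τ₀)]
  refine (hU.prod_mk (hB.prod_mk hB)).mono ?_
  rintro ⟨x, τ, τ'⟩ ⟨hx, hτ, hτ'⟩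
  have hmv := (convex_ball τ₀ δ).norm_image_sub_le_of_norm_hasDerivWithin_le
    (f := fun σ => X.lflow σ x - σ • X.lvel (X.lflow τ₀ p))
    (f' := fun σ => X.lvel (X.lflow σ x) - X.lvel (X.lflow τ₀ p)) (C := η)
    (fun σ _ => by
      have h1 := (X.hasDerivAt_lflow x σ).sub ((hasDerivAt_id σ).smul_const (X.lvel (X.lflow τ₀ p)))
      rw [one_smul] at h1
      exact h1.hasDerivWithinAt)
    (fun σ hσ => by
      have := hUW hx (hball σ hσ)
      rw [dist_eq_norm] at this
      exact this.le) hτ' hτ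
  rw [Real.norm_eq_abs] at hmv
  refine le_trans (le_of_eq ?_) hmv
  congr 1
  simp only [sub_smul]
  abel

lemma continuous_flow_swap : Continuous fun z : Torus L × ℝ => X.flow z.2 z.1 := by
  have h := X.continuous_flow
  generalize X.flow = f at h ⊢
  exact h.comp (continuous_snd.prodMk continuous_fst)

lemma tendsto_flow {Y : Type*} {l : Filter Y} {a : Y → ℝ} {b : Y → Torus L} {τ : ℝ} {c : Torus L}
    (ha : Tendsto a l (𝓝 τ)) (hb : Tendsto b l (𝓝 c)) :
    Tendsto (fun y => X.flow (a y) (b y)) l (𝓝 (X.flow τ c)) := by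
  have h := X.continuous_flow
  generalize X.flow = f at h ⊢
  exact (h.tendsto (τ, c)).comp (ha.prodMk_nhds hb)

/-- Where the flow crosses a wall, the time of crossing depends continuously on the initial point. -/
lemma exists_crossing_time {M : Set (Torus L)} {q : Torus L} {τ₀ : ℝ} (hM : X.flow τ₀ q ∈ M)
    (hw : LocalWall M (X.flow τ₀ q) (X.vel (X.flow τ₀ q))) :
    ∃ θ : Torus L → ℝ, Tendsto θ (𝓝 q) (𝓝 τ₀) ∧
      ∀ᶠ z : Torus L × ℝ in 𝓝 (q, τ₀), X.flow z.2 z.1 ∈ M ↔ z.2 = θ z.1 := by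
  obtain ⟨p, rfl⟩ := tc_surjective q
  rw [flow_tc] at hw hM
  obtain ⟨g, g', hg, hv, hgM⟩ := hw.at_lift
  set P := X.lflow τ₀ p with hP
  set ρ := g' (X.vel (tc L P)) with hρ
  have hgP : g P = 0 := hgM.self_of_nhds.1 hM
  have hcl : Continuous fun z : (ℝ × ℝ) × ℝ => X.lflow z.2 z.1 :=
    X.continuous_lflow.comp (continuous_snd.prodMk continuous_fst)
  have hcont : ∀ᶠ x in 𝓝 P, ContinuousAt g x := by
    obtain ⟨C, s, hs, hlip⟩ := hg.exists_lipschitzOnWith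
    filter_upwards [eventually_mem_nhds_iff.2 hs] with x hx
    exact hlip.continuousOn.continuousAt hx
  obtain ⟨θ, hθ, hθk⟩ := exists_zero_curve (k := fun x τ => ρ⁻¹ * g (X.lflow τ x)) (y₀ := p) (τ₀ := τ₀)
    (by simp [← hP, hgP])
    (by
      have : Tendsto (fun τ => X.lflow τ p) (𝓝 τ₀) (𝓝 P) :=
        (X.continuous_lflow.comp (continuous_id.prodMk continuous_const)).tendsto τ₀
      filter_upwards [this.eventually hcont] with τ hτ
      refine continuousAt_const.mul (ContinuousAt.comp (g := g) hτ ?_)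
      exact (X.continuous_lflow.comp (continuous_const.prodMk continuous_id)).continuousAt)
    (by
      set V := X.lvel P with hV
      have hV' : g' V = ρ := rfl
      have hρ0 : 0 < |ρ| := abs_pos.2 hv
      obtain ⟨η, hη, hη1, hη2⟩ : ∃ η : ℝ, 0 < η ∧ ‖g'‖ * η ≤ |ρ| / 4 ∧ η * (‖V‖ + η) ≤ |ρ| / 4 := by
        have h1 : ∀ᶠ η : ℝ in 𝓝 0, ‖g'‖ * η < |ρ| / 4 :=
          ((continuous_const.mul continuous_id).tendsto' (0 : ℝ) 0 (by simp)).eventually_lt_const (by positivity)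
        have h2 : ∀ᶠ η : ℝ in 𝓝 0, η * (‖V‖ + η) < |ρ| / 4 :=
          ((continuous_id.mul (continuous_const.add continuous_id)).tendsto' (0 : ℝ) 0
            (by simp)).eventually_lt_const (by positivity)
        obtain ⟨η, h, h0⟩ := (((h1.and h2).filter_mono nhdsWithin_le_nhds).and
          (self_mem_nhdsWithin (a := (0:ℝ)) (s := Ioi 0))).exists
        exact ⟨η, h0, h.1.le, h.2.le⟩
      have hg1 := hg.isLittleO.def hη
      have ht : Tendsto (fun w : (ℝ × ℝ) × (ℝ × ℝ) => (X.lflow w.2.1 w.1, X.lflow w.2.2 w.1))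
          (𝓝 (p, (τ₀, τ₀))) (𝓝 (P, P)) :=
        ((hcl.comp (continuous_fst.prodMk (continuous_fst.comp continuous_snd))).prodMk
          (hcl.comp (continuous_fst.prodMk (continuous_snd.comp continuous_snd)))).tendsto _
      filter_upwards [ht.eventually hg1, X.lflow_increment p τ₀ hη] with w hw1 hw2
      obtain ⟨x, τ, τ'⟩ := w
      simp only at hw1 hw2 ⊢
      set a := X.lflow τ x
      set b := X.lflow τ' x
      rw [← hP, ← hV] at hw2
      have hab : ‖a - b‖ ≤ (‖V‖ + η) * |τ - τ'| := by
        have h3 := norm_add_le (a - b - (τ - τ') • V) ((τ - τ') • V)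
        rw [sub_add_cancel, norm_smul, Real.norm_eq_abs] at h3
        linarith
      have h4 : ‖g' (a - b) - (τ - τ') * ρ‖ ≤ ‖g'‖ * (η * |τ - τ'|) := by
        have h5 := g'.le_of_opNorm_le_of_le le_rfl hw2
        rwa [map_sub, map_smul, hV', smul_eq_mul] at h5
      rw [Real.norm_eq_abs] at h4 hw1
      have h6 : |g a - g b - (τ - τ') * ρ| ≤ |ρ| / 2 * |τ - τ'| := by
        have h7 := abs_add_le (g a - g b - g' (a - b)) (g' (a - b) - (τ - τ') * ρ)
        rw [sub_add_sub_cancel] at h7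
        have h8 : η * ‖a - b‖ ≤ |ρ| / 4 * |τ - τ'| := by
          calc η * ‖a - b‖ ≤ η * ((‖V‖ + η) * |τ - τ'|) := by gcongr
            _ = η * (‖V‖ + η) * |τ - τ'| := by ring
            _ ≤ _ := by gcongr
        have h9 : ‖g'‖ * (η * |τ - τ'|) ≤ |ρ| / 4 * |τ - τ'| := by
          rw [← mul_assoc]; gcongr
        linarith
      have h10 : ρ⁻¹ * g a - ρ⁻¹ * g b - (τ - τ') = ρ⁻¹ * (g a - g b - (τ - τ') * ρ) := by
        have : ρ ≠ 0 := hv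
        field_simp
      rw [h10, abs_mul, abs_inv]
      calc |ρ|⁻¹ * |g a - g b - (τ - τ') * ρ| ≤ |ρ|⁻¹ * (|ρ| / 2 * |τ - τ'|) := by gcongr
        _ = 1 / 2 * |τ - τ'| := by field_simp)
  obtain ⟨σ, hσ, hσt⟩ := exists_section K.length_pos p
  refine ⟨fun c => θ (σ c), hθ.comp hσt, ?_⟩
  have ht : Tendsto (fun z : Torus L × ℝ => (σ z.1, z.2)) (𝓝 (tc L p, τ₀)) (𝓝 (p, τ₀)) :=
    (hσt.comp (continuous_fst.tendsto (tc L p, τ₀))).prodMk_nhds (continuous_snd.tendsto (tc L p, τ₀))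
  have ht2 : Tendsto (fun z : Torus L × ℝ => X.lflow z.2 (σ z.1)) (𝓝 (tc L p, τ₀)) (𝓝 P) :=
    (hcl.tendsto (p, τ₀)).comp ht
  filter_upwards [ht.eventually hθk, ht2.eventually hgM] with z h1 h2
  rw [← h1, mul_eq_zero, or_iff_right (inv_ne_zero hv), ← h2, ← flow_tc, hσ]

/-- A trajectory that is transverse to a set `M` meets it at finitely many times, and these times depend
continuously on the initial point. -/
lemma exists_crossing_times {M : Set (Torus L)} {q d : Torus L} (hd : d ∈ X.Crit0) (hq : q ∈ X.stable d)
    (hq0 : q ∉ closure M) (hdM : d ∉ closure M)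
    (hw : ∀ τ, 0 < τ → X.flow τ q ∉ closure M ∨
      (X.flow τ q ∈ M ∧ LocalWall M (X.flow τ q) (X.vel (X.flow τ q)))) :
    ∃ (P : Finset ℝ) (θ : ℝ → Torus L → ℝ), (∀ p, p ∈ P ↔ 0 < p ∧ X.flow p q ∈ M) ∧
      (∀ p ∈ P, Tendsto (θ p) (𝓝 q) (𝓝 p)) ∧
      ∀ᶠ x in 𝓝 q, ∀ τ, 0 ≤ τ → (X.flow τ x ∈ M ↔ ∃ p ∈ P, τ = θ p x) := by
  classical
  have hcf : Continuous fun z : Torus L × ℝ => X.flow z.2 z.1 := X.continuous_flow_swap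
  obtain ⟨T, hT0, hT⟩ := X.eventually_flow_mem hd hq (isClosed_closure.isOpen_compl.mem_nhds hdM)
  have hTM : ∀ᶠ x in 𝓝 q, ∀ τ, T ≤ τ → X.flow τ x ∉ M :=
    hT.mono fun x hx τ hτ h => hx τ hτ (subset_closure h)
  have hloc : ∀ τ, 0 ≤ τ → (X.flow τ q ∉ M → ∀ᶠ z : Torus L × ℝ in 𝓝 (q, τ), X.flow z.2 z.1 ∉ M) ∧
      (X.flow τ q ∈ M → 0 < τ ∧ ∃ θ : Torus L → ℝ, Tendsto θ (𝓝 q) (𝓝 τ) ∧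
        ∀ᶠ z : Torus L × ℝ in 𝓝 (q, τ), X.flow z.2 z.1 ∈ M ↔ z.2 = θ z.1) := by
    intro τ hτ
    have hno : X.flow τ q ∉ closure M → ∀ᶠ z : Torus L × ℝ in 𝓝 (q, τ), X.flow z.2 z.1 ∉ M := by
      intro h
      exact ((hcf.tendsto (q, τ)).eventually (isClosed_closure.isOpen_compl.mem_nhds h)).mono
        fun z hz h => hz (subset_closure h)
    rcases hτ.eq_or_lt with rfl | hτ
    · rw [flow_zero] at hno ⊢
      exact ⟨fun _ => hno hq0, fun h => absurd (subset_closure h) hq0⟩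
    · rcases hw τ hτ with h | h
      · exact ⟨fun _ => hno h, fun h' => absurd (subset_closure h') h⟩
      · exact ⟨fun h' => absurd h.1 h', fun _ => ⟨hτ, X.exists_crossing_time h.1 h.2⟩⟩
  have hfin : ({τ | 0 ≤ τ ∧ X.flow τ q ∈ M} : Set ℝ).Finite := by
    have hsub : ({τ | 0 ≤ τ ∧ X.flow τ q ∈ M} : Set ℝ) ⊆ {τ | 0 ≤ τ ∧ X.flow τ q ∈ M} ∩ Icc 0 T :=
      fun τ hτ => ⟨hτ, hτ.1, not_lt.1 fun h => hTM.self_of_nhds τ h.le hτ.2⟩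
    refine Finite.subset ?_ hsub
    refine isCompact_Icc.induction_on (p := fun s => ({τ | 0 ≤ τ ∧ X.flow τ q ∈ M} ∩ s).Finite) (by simp)
      (fun s t hst ht => ht.subset (inter_subset_inter_right _ hst))
      (fun s t hs ht => by rw [inter_union_distrib_left]; exact hs.union ht) ?_
    intro τ hτ
    have hq' : Tendsto (fun σ : ℝ => (q, σ)) (𝓝 τ) (𝓝 (q, τ)) :=
      (continuous_const.prodMk continuous_id).tendsto τ
    by_cases h : X.flow τ q ∈ M
    · obtain ⟨-, θ, hθ, hz⟩ := (hloc τ hτ.1).2 h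
      refine ⟨_, mem_nhdsWithin_of_mem_nhds (hq'.eventually hz), (finite_singleton (θ q)).subset ?_⟩
      rintro σ ⟨hσ, hσ'⟩
      exact hσ'.1 hσ.2
    · refine ⟨_, mem_nhdsWithin_of_mem_nhds (hq'.eventually ((hloc τ hτ.1).1 h)), ?_⟩
      convert finite_empty using 1
      exact eq_empty_of_forall_notMem fun σ hσ => hσ.2 hσ.1.2
  have hP : ∀ p, p ∈ hfin.toFinset ↔ 0 ≤ p ∧ X.flow p q ∈ M := fun p => hfin.mem_toFinset
  have hch : ∀ p : ℝ, ∃ θ : Torus L → ℝ, p ∈ hfin.toFinset → (Tendsto θ (𝓝 q) (𝓝 p) ∧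
        ∀ᶠ z : Torus L × ℝ in 𝓝 (q, p), X.flow z.2 z.1 ∈ M ↔ z.2 = θ z.1) := by
    intro p
    by_cases h : p ∈ hfin.toFinset
    · obtain ⟨-, θ, hθ⟩ := (hloc p ((hP p).1 h).1).2 ((hP p).1 h).2
      exact ⟨θ, fun _ => hθ⟩
    · exact ⟨0, fun h' => absurd h' h⟩
  choose θ hθ using hch
  refine ⟨hfin.toFinset, θ, fun p => (hP p).trans ⟨fun h => ⟨((hloc p h.1).2 h.2).1, h.2⟩,
    fun h => ⟨h.1.le, h.2⟩⟩, fun p hp => (hθ p hp).1, ?_⟩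
  have hne : ∀ p ∈ hfin.toFinset, ∀ τ, p ≠ τ → ∀ᶠ z : Torus L × ℝ in 𝓝 (q, τ), z.2 ≠ θ p z.1 := by
    intro p hp τ hpτ
    have h1 : Tendsto (fun z : Torus L × ℝ => θ p z.1) (𝓝 (q, τ)) (𝓝 p) :=
      (hθ p hp).1.comp (continuous_fst.tendsto (q, τ))
    have h2 : Tendsto (fun z : Torus L × ℝ => z.2) (𝓝 (q, τ)) (𝓝 τ) := continuous_snd.tendsto (q, τ)
    exact ((h2.sub h1).eventually_ne (sub_ne_zero.2 hpτ.symm)).mono fun z hz => sub_ne_zero.1 hz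
  have hcomp := (isCompact_Icc (a := (0 : ℝ)) (b := T)).eventually_forall_of_forall_eventually (x₀ := q)
    (P := fun x τ => X.flow τ x ∈ M ↔ ∃ p ∈ hfin.toFinset, τ = θ p x) (by
      intro τ hτ
      have hothers : ∀ᶠ z : Torus L × ℝ in 𝓝 (q, τ), ∀ p ∈ hfin.toFinset, p ≠ τ → z.2 ≠ θ p z.1 := by
        rw [Filter.eventually_all_finset]
        intro p hp
        by_cases h : p = τ
        · exact Eventually.of_forall fun z h' => absurd h h'
        · exact (hne p hp τ h).mono fun z hz _ => hz
      by_cases h : X.flow τ q ∈ M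
      · have hτP := (hP τ).2 ⟨hτ.1, h⟩
        filter_upwards [hothers, (hθ τ hτP).2] with z h1 h2
        rw [h2]
        constructor
        · intro h3; exact ⟨τ, hτP, h3⟩
        · rintro ⟨p, hp, h3⟩
          by_cases hpτ : p = τ
          · rwa [hpτ] at h3
          · exact absurd h3 (h1 p hp hpτ)
      · filter_upwards [hothers, (hloc τ hτ.1).1 h] with z h1 h2
        refine ⟨fun h3 => absurd h3 h2, ?_⟩
        rintro ⟨p, hp, h3⟩
        by_cases hpτ : p = τ
        · subst hpτ; exact absurd ((hP p).1 hp).2 h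
        · exact absurd h3 (h1 p hp hpτ))
  have hlt : ∀ᶠ x in 𝓝 q, ∀ p ∈ hfin.toFinset, θ p x < T := by
    rw [Filter.eventually_all_finset]
    intro p hp
    refine (hθ p hp).1.eventually_lt_const (not_le.1 fun h => ?_)
    exact hTM.self_of_nhds p h ((hP p).1 hp).2
  filter_upwards [hcomp, hlt, hTM] with x h1 h2 h3 τ hτ
  rcases le_or_gt τ T with h | h
  · exact h1 τ ⟨hτ, h⟩
  · refine ⟨fun h4 => absurd h4 (h3 τ h.le), ?_⟩
    rintro ⟨p, hp, rfl⟩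
    exact absurd (h2 p hp) (not_lt.2 h.le)

/-- Continuity of the crossing times in the initial point makes the signed counts of crossings locally
constant. -/
lemma eventually_count_eq {M : Set (Torus L)} {q : Torus L} {P P' : Finset ℝ} {θ : ℝ → Torus L → ℝ}
    (hθ : ∀ p ∈ P, Tendsto (θ p) (𝓝 q) (𝓝 p))
    (hM : ∀ᶠ x in 𝓝 q, ∀ τ, 0 ≤ τ → (X.flow τ x ∈ M ↔ ∃ p ∈ P, τ = θ p x))
    {rate : Torus L → ℝ} (hc : Continuous rate) (hr : ∀ p ∈ P, rate (X.flow p q) ≠ 0)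
    {I : Torus L → Set ℝ} (hI : ∀ x, I x ⊆ Ici 0) (hP' : P' ⊆ P)
    (hIP : ∀ᶠ x in 𝓝 q, ∀ p ∈ P, θ p x ∈ I x ↔ p ∈ P') :
    ∀ᶠ x in 𝓝 q, X.count M rate (I x) x = ∑ p ∈ P', (SignType.sign (rate (X.flow p q)) : ℤ) := by
  classical
  have hinj := eventually_injOn_of_tendsto hθ
  have hsign : ∀ᶠ x in 𝓝 q, ∀ p ∈ P, SignType.sign (rate (X.flow (θ p x) x)) =
      SignType.sign (rate (X.flow p q)) := by
    rw [Filter.eventually_all_finset]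
    intro p hp
    exact eventually_sign_eq ((hc.tendsto _).comp (X.tendsto_flow (hθ p hp) tendsto_id)) (hr p hp)
  filter_upwards [hM, hinj, hsign, hIP] with x h1 h2 h3 h4
  have hset : {τ | τ ∈ I x ∧ X.flow τ x ∈ M} = ((P'.image fun p => θ p x : Finset ℝ) : Set ℝ) := by
    ext τ
    simp only [mem_ofPred_eq, Finset.coe_image, mem_image, Finset.mem_coe]
    constructor
    · rintro ⟨hτ, hτM⟩
      obtain ⟨p, hp, rfl⟩ := (h1 τ (hI x hτ)).1 hτM
      exact ⟨p, (h4 p hp).1 hτ, rfl⟩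
    · rintro ⟨p, hp, rfl⟩
      have hτ := (h4 p (hP' hp)).2 hp
      exact ⟨hτ, (h1 _ (hI x hτ)).2 ⟨p, hP' hp, rfl⟩⟩
  rw [count, hset, finsum_mem_coe_finset, Finset.sum_image]
  · exact Finset.sum_congr rfl fun p hp => by rw [h3 p (hP' hp)]
  · exact fun p hp p' hp' h => h2 (hP' hp) (hP' hp') h

end CordData
/-! ### Cords that are almost tangent at their startpoint -/

namespace Knot
variable {L : ℝ} {K : Knot L}

variable (K) in
/-- A minor of the pair of vectors `γ t - γ s` and `(γ u - γ s) / (u - s)`, as a function of `((s, t), u)`. It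
vanishes when the cord `(s, t)` meets the knot in its interior at `γ u`. -/
noncomputable def minor (T V : E3) (y : (ℝ × ℝ) × ℝ) : ℝ :=
  inner ℝ V (K.lift y.1.2 - K.lift y.1.1) * inner ℝ T (K.dd (y.1.1, y.2)) -
    inner ℝ V (K.dd (y.1.1, y.2)) * inner ℝ T (K.lift y.1.2 - K.lift y.1.1)

lemma Hit.minor_eq_zero {a b x r : ℝ} (h : K.Hit (tc L (a, b)) (x : AddCircle L) r) (T V : E3) :
    K.minor T V ((a, b), x) = 0 := by
  obtain ⟨k, hk⟩ := h.exists_smul_dd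
  rw [chord_tc] at hk
  simp only at hk
  simp only [minor, hk, real_inner_smul_right]
  ring

lemma hasStrictFDerivAt_minor {s t a : ℝ} {V : E3}
    (hC : K.lift t - K.lift s = a • deriv K.lift s) (hV : inner ℝ V (deriv K.lift s) = 0) :
    HasStrictFDerivAt (K.minor (deriv K.lift s) V)
      ((inner ℝ V (deriv K.lift t) : ℝ) • (ContinuousLinearMap.snd ℝ ℝ ℝ).comp
          (ContinuousLinearMap.fst ℝ (ℝ × ℝ) ℝ) -
        (a * inner ℝ V (deriv (deriv K.lift) s) / 2 : ℝ) • ((ContinuousLinearMap.fst ℝ ℝ ℝ).comp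
        (ContinuousLinearMap.fst ℝ (ℝ × ℝ) ℝ) + ContinuousLinearMap.snd ℝ (ℝ × ℝ) ℝ)) ((s, t), s) := by
  have hch : ∀ W : E3, HasStrictFDerivAt
      (fun y : (ℝ × ℝ) × ℝ => (inner ℝ W (K.lift y.1.2 - K.lift y.1.1) : ℝ))
      ((inner ℝ W (deriv K.lift t) : ℝ) • (ContinuousLinearMap.snd ℝ ℝ ℝ).comp
          (ContinuousLinearMap.fst ℝ (ℝ × ℝ) ℝ) -
        (inner ℝ W (deriv K.lift s) : ℝ) • (ContinuousLinearMap.fst ℝ ℝ ℝ).comp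
          (ContinuousLinearMap.fst ℝ (ℝ × ℝ) ℝ)) ((s, t), s) := by
    intro W
    have h1 : HasStrictFDerivAt (fun y : (ℝ × ℝ) × ℝ => K.lift y.1.2) _ ((s, t), s) :=
      HasStrictFDerivAt.comp (g := K.lift) (f := fun y : (ℝ × ℝ) × ℝ => y.1.2) ((s, t), s)
        (K.hasStrictDerivAt_lift t).hasStrictFDerivAt
        (hasStrictFDerivAt_snd.comp ((s, t), s) hasStrictFDerivAt_fst)
    have h2 : HasStrictFDerivAt (fun y : (ℝ × ℝ) × ℝ => K.lift y.1.1) _ ((s, t), s) :=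
      HasStrictFDerivAt.comp (g := K.lift) (f := fun y : (ℝ × ℝ) × ℝ => y.1.1) ((s, t), s)
        (K.hasStrictDerivAt_lift s).hasStrictFDerivAt
        (hasStrictFDerivAt_fst.comp ((s, t), s) hasStrictFDerivAt_fst)
    refine ((innerSL ℝ W).hasStrictFDerivAt.comp ((s, t), s) (h1.sub h2)).congr_fderiv ?_
    ext <;> simp
  have hTT : inner ℝ (deriv K.lift s) (deriv K.lift s) = 1 := by
    rw [real_inner_self_eq_norm_sq, K.norm_deriv_lift]; norm_num
  refine HasStrictFDerivAt.congr_fderiv (((hch V).mul (K.hasStrictFDerivAt_inner_dd_snd (deriv K.lift s) s t)).sub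
    ((K.hasStrictFDerivAt_inner_dd_snd V s t).mul (hch (deriv K.lift s)))) ?_
  simp only [K.dd_self, hC, real_inner_smul_right, hTT, hV]
  ext <;> simp <;> ring

/-- Near a cord `(s₀, t₀)` tangent to the knot at its startpoint, the cords in `S` with the intersection point
close to the startpoint form a curve along which `s` and `u` move in opposite directions. -/
lemma Generic.hits_near_tangent (hK : K.Generic) {s t a : ℝ} (hst : (s : AddCircle L) ≠ t)
    (hC : K.lift t - K.lift s = a • deriv K.lift s) :
    ∀ᶠ z : ((ℝ × ℝ) × ℝ) × ((ℝ × ℝ) × ℝ) in 𝓝 (((s, t), s), ((s, t), s)), ∀ r r',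
      K.Hit (tc L z.1.1) (z.1.2 : AddCircle L) r → K.Hit (tc L z.2.1) (z.2.2 : AddCircle L) r' →
      |z.1.1.1 - z.2.1.1 + (z.1.2 - z.2.2)| ≤ 1 / 2 * (|z.1.1.1 - z.2.1.1| + |z.1.2 - z.2.2|) := by
  set T := deriv K.lift s with hT
  set A := deriv (deriv K.lift) s with hA
  set U := deriv K.lift t with hU
  have htr : inner ℝ (cross T A) U ≠ 0 := by
    have := hK.tangent (s : AddCircle L) t hst ⟨a, by rw [K.tan_coe]; exact hC⟩
    rwa [K.tan_coe, K.acc_coe, K.tan_coe] at this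
  have htr' : inner ℝ (cross T U) A ≠ 0 := by
    have : inner ℝ (cross T U) A = -inner ℝ (cross T A) U := by
      simp only [inner_eq_sum, cross_zero, cross_one, cross_two]; ring
    rw [this]; exact neg_ne_zero.2 htr
  have ha : a ≠ 0 := by
    rintro rfl
    rw [zero_smul] at hC
    exact K.chord_ne_zero (c := tc L (s, t)) hst hC
  have h1 := K.hasStrictFDerivAt_minor (V := cross T U) hC (by rw [real_inner_comm]; exact inner_cross_self_left _ _)
  have h2 := K.hasStrictFDerivAt_minor (V := cross T A) hC (by rw [real_inner_comm]; exact inner_cross_self_left _ _)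
  have hUU : inner ℝ (cross T U) U = 0 := by rw [real_inner_comm]; exact inner_cross_self_right _ _
  have hAA : inner ℝ (cross T A) A = 0 := by rw [real_inner_comm]; exact inner_cross_self_right _ _
  set g₁ := a * inner ℝ (cross T U) A / 2 with hg1
  set g₂ : ℝ := inner ℝ (cross T A) U with hg2
  have hg10 : 0 < |g₁| := abs_pos.2 (div_ne_zero (mul_ne_zero ha htr') two_ne_zero)
  have hg20 : 0 < |g₂| := abs_pos.2 htr
  filter_upwards [h1.isLittleO.def (c := |g₁| / 4) (by positivity),
    h2.isLittleO.def (c := |g₂| / 2) (by positivity)] with z hz1 hz2 r r' hit hit'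
  obtain ⟨⟨⟨s₁, t₁⟩, u₁⟩, ⟨⟨s₂, t₂⟩, u₂⟩⟩ := z
  rw [hit.minor_eq_zero, hit'.minor_eq_zero] at hz1 hz2
  simp only [← hA, ← hU, hUU, hAA, zero_smul, mul_zero, zero_div, sub_zero, zero_sub, norm_neg,
    Prod.mk_sub_mk, smul_apply, add_apply, neg_apply,
    ContinuousLinearMap.comp_apply, ContinuousLinearMap.coe_fst', ContinuousLinearMap.coe_snd', smul_eq_mul,
    Real.norm_eq_abs, abs_mul] at hz1 hz2
  simp only
  set x := |s₁ - s₂| + |u₁ - u₂| with hx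
  have hx0 : 0 ≤ x := by positivity
  have hnorm : ‖(((s₁ - s₂, t₁ - t₂), u₁ - u₂) : (ℝ × ℝ) × ℝ)‖ ≤ x + |t₁ - t₂| := by
    rw [Prod.norm_mk, Prod.norm_mk, Real.norm_eq_abs, Real.norm_eq_abs, Real.norm_eq_abs]
    refine max_le (max_le ?_ ?_) ?_ <;>
      linarith [abs_nonneg (s₁ - s₂), abs_nonneg (u₁ - u₂), abs_nonneg (t₁ - t₂)]
  have ht : |t₁ - t₂| ≤ x := by
    have h3 : |g₂| * |t₁ - t₂| ≤ |g₂| * ((x + |t₁ - t₂|) / 2) := by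
      calc _ ≤ _ := hz2
        _ ≤ |g₂| / 2 * (x + |t₁ - t₂|) := by gcongr
        _ = _ := by ring
    linarith [le_of_mul_le_mul_left h3 hg20]
  have h4 : |g₁| * |s₁ - s₂ + (u₁ - u₂)| ≤ |g₁| * (1 / 2 * x) := by
    calc _ ≤ _ := hz1
      _ ≤ |g₁| / 4 * (x + x) := by gcongr; exact hnorm.trans (by linarith)
      _ = _ := by ring
  exact le_of_mul_le_mul_left h4 hg10

/-- Near a cord tangent to the knot at its startpoint, a splitting at a point close to the startpoint moves the
startpoint in the direction of the cord. -/
lemma hit_direction {s t a : ℝ} (ha : a ≠ 0) (hC : K.lift t - K.lift s = a • deriv K.lift s) :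
    ∀ᶠ z : (ℝ × ℝ) × ℝ in 𝓝 ((s, t), s), ∀ r, K.Hit (tc L z.1) (z.2 : AddCircle L) r →
      0 < a * (z.2 - z.1.1) := by
  have hTT : inner ℝ (deriv K.lift s) (deriv K.lift s) = 1 := by
    rw [real_inner_self_eq_norm_sq, K.norm_deriv_lift]; norm_num
  have hlift := K.contDiff_lift.continuous
  have h1 : Continuous fun z : (ℝ × ℝ) × ℝ => inner ℝ (deriv K.lift s) (K.dd (z.1.1, z.2)) := by
    have : Continuous fun z : (ℝ × ℝ) × ℝ => K.dd (z.1.1, z.2) := K.contDiff_dd.continuous.comp (by fun_prop)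
    exact continuous_const.inner this
  have h2 : Continuous fun z : (ℝ × ℝ) × ℝ => a * inner ℝ (deriv K.lift s) (K.lift z.1.2 - K.lift z.1.1) := by
    fun_prop
  filter_upwards [h1.continuousAt.eventually (lt_mem_nhds (a := 0) (by simp only [K.dd_self, hTT, zero_lt_one])),
    h2.continuousAt.eventually (lt_mem_nhds (a := 0) (by
      simp only [hC, real_inner_smul_right, hTT, mul_one]; exact mul_self_pos.2 ha))] with z hz1 hz2 r hit
  obtain ⟨⟨b, c⟩, x⟩ := z
  have h3 := hit.sub_start
  change K.lift x - K.lift b = r • (K.lift c - K.lift b) at h3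
  rw [← K.smul_dd] at h3
  have h4 := congrArg (fun V => (inner ℝ (deriv K.lift s) V : ℝ)) h3
  simp only [real_inner_smul_right] at h4
  simp only at hz1 hz2 ⊢
  have h5 : 0 < a * (x - b) * inner ℝ (deriv K.lift s) (K.dd (b, x)) := by
    rw [mul_assoc, h4]
    have := mul_pos hit.2.1 hz2
    linarith
  exact pos_of_mul_pos_left h5 hz1.le

end Knot
/-! ### Splitting terminates -/

namespace CordData
variable {L : ℝ} {K : Knot L} (X : CordData K)

/-- A trajectory that starts in a ball where the speed is bounded below by `v₀` moves at most by the
decrease of the energy divided by `v₀`. Hence it stays in the ball if the energy does not decrease too much. -/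
lemma lflow_trapped {p₀ p : ℝ × ℝ} {ρ v₀ a τ₁ e : ℝ} (hv0 : 0 < v₀)
    (hv : ∀ x, ‖x - p₀‖ < ρ → 0 < a * (X.vel (tc L x)).1 ∧ v₀ < ‖X.vel (tc L x)‖) (hτ : 0 ≤ τ₁)
    (he : e ≤ X.E (X.flow τ₁ (tc L p))) (hp : ‖p - p₀‖ + (X.E (tc L p) - e) / v₀ < ρ) :
    ‖X.lflow τ₁ p - p‖ ≤ (X.E (tc L p) - X.E (X.flow τ₁ (tc L p))) / v₀ ∧
      0 ≤ a * ((X.lflow τ₁ p).1 - p.1) := by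
  have hball : ∀ τ ∈ Icc 0 τ₁, ‖X.lflow τ p - p‖ ≤ (X.E (tc L p) - X.E (X.flow τ (tc L p))) / v₀ →
      ‖X.lflow τ p - p₀‖ < ρ := by
    intro τ hτ' h
    have h1 : (X.E (tc L p) - X.E (X.flow τ (tc L p))) / v₀ ≤ (X.E (tc L p) - e) / v₀ := by
      gcongr
      exact he.trans (X.antitone_E_flow _ hτ'.2)
    have h2 := norm_add_le (X.lflow τ p - p) (p - p₀)
    rw [sub_add_sub_cancel] at h2
    linarith
  have hmain : ∀ τ ∈ Icc 0 τ₁, ‖X.lflow τ p - p‖ ≤ (X.E (tc L p) - X.E (X.flow τ (tc L p))) / v₀ := by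
    refine image_norm_le_of_norm_deriv_right_lt_deriv_boundary'
      (f := fun τ => X.lflow τ p - p) (f' := fun τ => X.lvel (X.lflow τ p))
      (B := fun τ => (X.E (tc L p) - X.E (X.flow τ (tc L p))) / v₀)
      (B' := fun τ => X.gradSq (X.flow τ (tc L p)) / v₀) ?_ ?_ ?_ ?_ ?_ ?_
    · exact fun τ _ => ((X.hasDerivAt_lflow p τ).sub_const p).continuousAt.continuousWithinAt
    · exact fun τ _ => ((X.hasDerivAt_lflow p τ).sub_const p).hasDerivWithinAt
    · simp [lflow_zero, flow_zero]
    · exact fun τ _ => (((X.hasDerivAt_E_flow (tc L p) τ).const_sub _).div_const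
        v₀).continuousAt.continuousWithinAt
    · intro τ _
      have := (((X.hasDerivAt_E_flow (tc L p) τ).const_sub (X.E (tc L p))).div_const v₀)
      rw [neg_neg] at this
      exact this.hasDerivWithinAt
    · intro τ hτ' h
      have h1 := (hv _ (hball τ ⟨hτ'.1, hτ'.2.le⟩ h.le)).2
      rw [← flow_tc] at h1
      change ‖X.vel (X.flow τ (tc L p))‖ < _
      rw [lt_div_iff₀ hv0]
      have h2 := X.sq_norm_vel_le (X.flow τ (tc L p))
      nlinarith
  refine ⟨hmain τ₁ ⟨hτ, le_rfl⟩, ?_⟩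
  have hd : ∀ τ, HasDerivAt (fun τ => a * ((X.lflow τ p).1 - p.1)) (a * (X.vel (tc L (X.lflow τ p))).1) τ :=
    fun τ => by
      have h : HasDerivAt (fun τ => (X.lflow τ p).1) (X.vel (tc L (X.lflow τ p))).1 τ :=
        (X.hasDerivAt_lflow p τ).fst
      exact (h.sub_const _).const_mul a
  have hmono : MonotoneOn (fun τ => a * ((X.lflow τ p).1 - p.1)) (Icc 0 τ₁) := by
    refine monotoneOn_of_hasDerivWithinAt_nonneg (convex_Icc 0 τ₁)
      (fun τ _ => (hd τ).continuousAt.continuousWithinAt) (fun τ _ => (hd τ).hasDerivWithinAt) ?_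
    intro τ hτ'
    rw [interior_Icc] at hτ'
    have hτ'' : τ ∈ Icc 0 τ₁ := ⟨hτ'.1.le, hτ'.2.le⟩
    exact (hv _ (hball τ hτ'' (hmain τ hτ''))).1.le
  have := hmono ⟨le_rfl, hτ⟩ ⟨hτ, le_rfl⟩ hτ
  simpa [lflow_zero] using this

/-- The bound for the derivatives of the perturbation is a Lipschitz constant. -/
lemma abs_h_sub_le {ε : ℝ} (hε : X.PerturbationLT ε) (s u t : AddCircle L) :
    |X.h (u, t) - X.h (s, t)| ≤ ε * ‖u - s‖ := by
  obtain ⟨a, rfl⟩ := QuotientAddGroup.mk_surjective s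
  obtain ⟨b, rfl⟩ := QuotientAddGroup.mk_surjective t
  obtain ⟨x, rfl, hx, -⟩ := exists_lift_near K.length_pos a u
  have hd : ∀ y, HasDerivAt (fun y : ℝ => X.h (tc L (y, b))) (dS X.h (tc L (y, b))) y := by
    intro y
    have h1 : HasDerivAt (fun y : ℝ => (y, b)) ((1 : ℝ), (0 : ℝ)) y :=
      (hasDerivAt_id y).prodMk (hasDerivAt_const y b)
    rw [dS_tc (X.tsmooth_h.differentiableAt _)]
    exact (X.tsmooth_h.differentiableAt (y, b)).hasFDerivAt.comp_hasDerivAt y h1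
  have := convex_univ.norm_image_sub_le_of_norm_hasDerivWithin_le (x := a) (y := x) (C := ε)
    (fun y _ => (hd y).hasDerivWithinAt) (fun y _ => (hε _).2.1.le) trivial trivial
  rw [Real.norm_eq_abs, Real.norm_eq_abs, hx] at this
  exact this

/-- If the perturbation is small, a splitting lowers the energy at least in proportion to the distance by which
the startpoint jumps. -/
lemma E_split_le {κ ℓ ε : ℝ} (hκ : ∀ s u : AddCircle L, κ * ‖u - s‖ ≤ ‖K.γ u - K.γ s‖)
    (hℓ : ∀ c ∈ K.S ∪ K.bdryS, ℓ ≤ ‖K.chord c‖) (hℓ0 : 0 < ℓ) (hε : X.PerturbationLT ε)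
    (hεle : ε ≤ κ * ℓ / 4) {w : Torus L} {u : AddCircle L} {r : ℝ} (hit : K.Hit w u r) :
    X.E (u, w.2) + κ * ℓ / 4 * ‖u - w.1‖ ≤ X.E w := by
  have h1 := hℓ w (Or.inl ⟨u, r, hit⟩)
  have h2 := hκ w.1 u
  rw [hit.sub_start, norm_smul, Real.norm_eq_abs, abs_of_pos hit.2.1] at h2
  have h3 : K.chord (u, w.2) = (1 - r) • K.chord w := hit.end_sub
  have h4 : K.energy (u, w.2) = (1 / 2) * ((1 - r) * ‖K.chord w‖) ^ 2 := by
    rw [K.energy_eq, h3, norm_smul, Real.norm_eq_abs, abs_of_pos (by linarith [hit.2.2.1])]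
  have h5 := X.abs_h_sub_le hε w.1 u w.2
  have h6 := (abs_le.1 h5).2
  have hu := norm_nonneg (u - w.1)
  have h7 : ε * ‖u - w.1‖ ≤ κ * ℓ / 4 * ‖u - w.1‖ := by gcongr
  have h8 : X.E w = (1 / 2) * ‖K.chord w‖ ^ 2 + X.h (w.1, w.2) := by rw [E, K.energy_eq]
  rw [h8, E, h4]
  set C := ‖K.chord w‖
  have hC : 0 < C := hℓ0.trans_le h1
  -- the energy itself drops by at least `r C ^ 2 / 2`, since `1 - (1 - r) ^ 2 ≥ r`
  have h9 : κ * ℓ / 2 * ‖u - w.1‖ ≤ r * C * C / 2 := by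
    have := mul_le_mul h2 h1 hℓ0.le (by have := hit.2.1; positivity)
    nlinarith
  have h10 : r * C * C / 2 ≤ (1 / 2) * C ^ 2 - (1 / 2) * ((1 - r) * C) ^ 2 := by
    have : 0 ≤ r * (1 - r) * C ^ 2 := by
      have := hit.2.1; have := hit.2.2.1
      have : 0 < 1 - r := by linarith
      positivity
    nlinarith
  linarith

/-- A chain of infinitely many splittings cannot replace the startpoint infinitely often: such cords would
accumulate at a cord that is tangent to the knot at its startpoint, and near that cord two successive
splittings contradict the shape of `S`. -/
lemma not_frequently_start_split (hK : K.Generic) {κ ℓ ε : ℝ}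
    (hκ : ∀ s u : AddCircle L, κ * ‖u - s‖ ≤ ‖K.γ u - K.γ s‖) (hκ0 : 0 < κ)
    (hℓ : ∀ c ∈ K.S ∪ K.bdryS, ℓ ≤ ‖K.chord c‖) (hℓ0 : 0 < ℓ) (hε : X.PerturbationLT ε)
    (hεle : ε ≤ κ * ℓ / 4) (hεℓ : ε ≤ ℓ) {f : ℕ → Torus L} {τ : ℕ → ℝ} {u : ℕ → AddCircle L} {r : ℕ → ℝ}
    (hτ : ∀ n, 0 < τ n) (hit : ∀ n, K.Hit (X.flow (τ n) (f n)) (u n) (r n))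
    (hf : ∀ n, f (n + 1) = ((X.flow (τ n) (f n)).1, u n) ∨ f (n + 1) = (u n, (X.flow (τ n) (f n)).2)) :
    ¬ ∃ᶠ n in atTop, f (n + 1) = (u n, (X.flow (τ n) (f n)).2) := by
  intro hfreq
  have : Fact (0 < L) := ⟨K.length_pos⟩
  set w : ℕ → Torus L := fun n => X.flow (τ n) (f n) with hw
  set κ' := κ * ℓ / 4 with hκ'
  have hκ'0 : 0 < κ' := by positivity
  have hεpos : 0 < ε := (abs_nonneg _).trans_lt (hε (f 0)).1
  -- the energy along the chain
  have hw_le : ∀ n, X.E (w n) ≤ X.E (f n) := fun n => X.E_flow_le (hτ n).le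
  have hstart : ∀ n, f (n + 1) = (u n, (w n).2) → X.E (f (n + 1)) + κ' * ‖u n - (w n).1‖ ≤ X.E (w n) := by
    intro n h
    rw [h]
    exact X.E_split_le hκ hℓ hℓ0 hε hεle (hit n)
  have hend : ∀ n, f (n + 1) = ((w n).1, u n) → X.E (f (n + 1)) + κ' * ‖u n - (w n).2‖ ≤ X.E (w n) := by
    intro n h
    rw [h]
    have h1 := X.swap.E_split_le hκ hℓ hℓ0 (X.swap_perturbationLT hε) hεle (hit n).swap
    rw [swap_E] at h1
    exact h1
  have hstep : ∀ n, X.E (f (n + 1)) ≤ X.E (w n) := by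
    intro n
    rcases hf n with h | h
    · have := hend n h
      nlinarith [norm_nonneg (u n - (w n).2)]
    · have := hstart n h
      nlinarith [norm_nonneg (u n - (w n).1)]
  have hanti : Antitone fun n => X.E (f n) := antitone_nat_of_succ_le fun n => (hstep n).trans (hw_le n)
  have hbdd : BddBelow (range fun n => X.E (f n)) := by
    obtain ⟨m, hm⟩ := (isCompact_univ.bddBelow_image (K := (univ : Set (Torus L))) X.continuous_E.continuousOn)
    exact ⟨m, by rintro _ ⟨n, rfl⟩; exact hm ⟨f n, trivial, rfl⟩⟩
  set e := ⨅ n, X.E (f n) with he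
  have hlim : Tendsto (fun n => X.E (f n)) atTop (𝓝 e) := tendsto_atTop_ciInf hanti hbdd
  have hge : ∀ n, e ≤ X.E (f n) := fun n => ciInf_le hbdd n
  have hdrop : ∀ δ, 0 < δ → ∀ᶠ n in atTop, X.E (f n) - e < δ := fun δ hδ =>
    ((hlim.sub_const e).eventually_lt_const (by simpa using hδ))
  have hjump : ∀ n, f (n + 1) = (u n, (w n).2) → ‖u n - (w n).1‖ ≤ (X.E (f n) - e) / κ' := by
    intro n h
    rw [le_div_iff₀ hκ'0]
    have := hstart n h
    linarith [hw_le n, hge (n + 1)]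
  -- an accumulation point
  obtain ⟨c, hc⟩ : ∃ c, ∀ U ∈ 𝓝 c, ∃ᶠ n in atTop, f (n + 1) = (u n, (w n).2) ∧ w n ∈ U := by
    set F := atTop ⊓ 𝓟 {n | f (n + 1) = (u n, (w n).2)} with hF
    have : NeBot F := frequently_mem_iff_neBot.1 hfreq
    obtain ⟨c, hc⟩ := exists_clusterPt_of_compactSpace (map w F)
    refine ⟨c, fun U hU => ?_⟩
    have h1 : ∃ᶠ n in F, w n ∈ U := (mapClusterPt_iff_frequently.1 hc) U hU
    rw [hF, frequently_inf_principal] at h1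
    exact h1
  have hct : c ∈ K.tangentStart := by
    by_contra hct
    obtain ⟨δ, hδ, hball⟩ := Metric.eventually_nhds_iff_ball.1 (hK.no_hit_near_start hct)
    obtain ⟨n, ⟨hn, hwn⟩, hn2⟩ := ((hc _ (Metric.ball_mem_nhds c (half_pos hδ))).and_eventually
      (hdrop (δ / 2 * κ') (by positivity))).exists
    refine hball (w n, u n) ?_ _ (hit n)
    rw [Metric.mem_ball] at hwn ⊢
    have h1 : dist (w n).1 c.1 ≤ dist (w n) c := le_max_left _ _
    have h2 : dist (u n) (w n).1 < δ / 2 := by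
      rw [dist_eq_norm]
      refine (hjump n hn).trans_lt ?_
      rwa [div_lt_iff₀ hκ'0]
    have h3 := dist_triangle (u n) (w n).1 c.1
    rw [Prod.dist_eq, max_lt_iff]
    constructor
    · simp only; linarith
    · simp only; linarith
  obtain ⟨hne, a, ha⟩ := hct
  obtain ⟨⟨s, t⟩, rfl⟩ := tc_surjective c
  have hne' : (s : AddCircle L) ≠ t := hne
  have hC : K.lift t - K.lift s = a • deriv K.lift s := by rw [← K.tan_coe]; exact ha
  have haℓ : ℓ ≤ |a| := by
    have := hℓ (tc L (s, t)) (Or.inr ⟨hne, Or.inl ⟨a, ha⟩⟩)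
    rwa [ha, norm_smul, K.norm_tan, mul_one] at this
  have ha0 : 0 < |a| := hℓ0.trans_le haℓ
  -- near the accumulation point the startpoint moves in the direction of the cord
  have hvel : 0 < a * (X.vel (tc L (s, t))).1 := by
    have h1 : (X.vel (tc L (s, t))).1 = a - dS X.h (tc L (s, t)) := by
      simp only [vel]
      rw [X.dS_E, K.dS_energy, ha, real_inner_smul_left, K.inner_tan_self]; ring
    have h2 := (hε (tc L (s, t))).2.1
    have h3 : a * dS X.h (tc L (s, t)) < |a| * |a| := by
      calc _ ≤ |a * dS X.h (tc L (s, t))| := le_abs_self _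
        _ = |a| * |dS X.h (tc L (s, t))| := abs_mul _ _
        _ < |a| * |a| := by gcongr; linarith
    rw [h1]
    nlinarith [abs_mul_abs_self a]
  set v₀ := ‖X.vel (tc L (s, t))‖ / 2 with hv₀
  have hv0 : 0 < v₀ := half_pos (norm_pos_iff.2 fun h => by rw [h] at hvel; simp at hvel)
  have hvc : Continuous fun p => X.vel (tc L p) := X.continuous_vel.comp continuous_tc
  have hev1 : ∀ᶠ p in 𝓝 (s, t), 0 < a * (X.vel (tc L p)).1 ∧ v₀ < ‖X.vel (tc L p)‖ :=
    ((continuous_const.mul (continuous_fst.comp hvc)).continuousAt.eventually (lt_mem_nhds hvel)).and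
      (hvc.norm.continuousAt.eventually (lt_mem_nhds (half_lt_self (by linarith))))
  obtain ⟨ρ₁, hρ₁, hb1⟩ := Metric.eventually_nhds_iff_ball.1 hev1
  obtain ⟨ρ₂, hρ₂, hb2⟩ := Metric.eventually_nhds_iff_ball.1 (Knot.hit_direction (abs_pos.1 ha0) hC)
  obtain ⟨ρ₃, hρ₃, hb3⟩ := Metric.eventually_nhds_iff_ball.1 (hK.hits_near_tangent hne' hC)
  obtain ⟨ρ, hρ, hρ1, hρ2, hρ3⟩ : ∃ ρ, 0 < ρ ∧ ρ ≤ ρ₁ ∧ ρ ≤ ρ₂ ∧ ρ ≤ ρ₃ :=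
    ⟨min ρ₁ (min ρ₂ ρ₃), by positivity, min_le_left _ _, (min_le_right _ _).trans (min_le_left _ _),
      (min_le_right _ _).trans (min_le_right _ _)⟩
  set B := 1 / v₀ + 1 / κ' with hB
  have hB0 : 0 < B := by positivity
  have hBv : ∀ x, 0 ≤ x → x / v₀ ≤ B * x := fun x hx => by
    rw [hB, add_mul, one_div_mul_eq_div, one_div_mul_eq_div]
    exact le_add_of_nonneg_right (by positivity)
  have hBκ : ∀ x, 0 ≤ x → x / κ' ≤ B * x := fun x hx => by
    rw [hB, add_mul, one_div_mul_eq_div, one_div_mul_eq_div]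
    exact le_add_of_nonneg_left (by positivity)
  have himg : tc L '' Metric.ball (s, t) (ρ / 4) ∈ 𝓝 (tc L (s, t)) := by
    rw [← map_tc_nhds]; exact image_mem_map (Metric.ball_mem_nhds _ (by positivity))
  obtain ⟨j, ⟨hj, p₀, hp₀, hp₀w⟩, hjd⟩ := ((hc _ himg).and_eventually
    (hdrop (ρ / 8 / B) (by positivity))).exists
  rw [lt_div_iff₀ hB0, mul_comm] at hjd
  rw [mem_ball_iff_norm] at hp₀
  -- the distance of a lift of `u n` from the given lift of an endpoint of `w n`
  have hjumpB : ∀ n, j ≤ n → ∀ y, κ' * ‖y‖ ≤ X.E (w n) - X.E (f (n + 1)) → ‖(y : AddCircle L)‖ < ρ / 8 ∧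
      ‖y‖ ≤ B * (X.E (w n) - X.E (f (n + 1))) := by
    intro n hn y hy
    have h1 : ‖y‖ ≤ B * (X.E (w n) - X.E (f (n + 1))) := by
      refine le_trans ?_ (hBκ _ (sub_nonneg.2 (hstep n)))
      rw [le_div_iff₀ hκ'0]; linarith
    refine ⟨h1.trans_lt (lt_of_le_of_lt ?_ hjd), h1⟩
    have : X.E (f n) ≤ X.E (f j) := hanti hn
    have := hw_le n
    have := hge (n + 1)
    gcongr; linarith
  obtain ⟨x₀, hx₀, hx₀n, -⟩ := exists_lift_near K.length_pos p₀.1 (u j)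
  have hwj1 : ((p₀.1 : ℝ) : AddCircle L) = (w j).1 := congrArg Prod.fst hp₀w
  have hwj2 : ((p₀.2 : ℝ) : AddCircle L) = (w j).2 := congrArg Prod.snd hp₀w
  rw [hwj1] at hx₀n
  have hx₀8 : |x₀ - p₀.1| < ρ / 8 := by
    rw [hx₀n]
    exact (hjumpB j le_rfl _ (by linarith [hstart j hj])).1
  set P : ℝ × ℝ := (x₀, p₀.2) with hP
  have hPp : ‖P - (s, t)‖ < 3 * ρ / 8 := by
    have h1 : ‖P - p₀‖ ≤ ρ / 8 := by
      rw [hP, Prod.norm_def]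
      simp only [Prod.fst_sub, Prod.snd_sub, sub_self, norm_zero, Real.norm_eq_abs]
      exact max_le hx₀8.le (by positivity)
    have h2 := norm_add_le (P - p₀) (p₀ - (s, t))
    rw [sub_add_sub_cancel] at h2
    linarith
  have hflow : ∀ m p, tc L p = f (j + 1 + m) → 0 ≤ a * (p.1 - x₀) →
      ‖p - P‖ ≤ B * (X.E (f (j + 1)) - X.E (f (j + 1 + m))) →
      ∃ p', tc L p' = w (j + 1 + m) ∧ 0 ≤ a * (p'.1 - x₀) ∧
        ‖p' - P‖ ≤ B * (X.E (f (j + 1)) - X.E (w (j + 1 + m))) := by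
    intro m p hp ha hpP
    refine ⟨X.lflow (τ (j + 1 + m)) p, by rw [← flow_tc, hp], ?_⟩
    have h0 : X.E (f (j + 1)) ≤ X.E (f j) := hanti (Nat.le_succ j)
    have hwe : e ≤ X.E (w (j + 1 + m)) := (hge _).trans (hstep _)
    obtain ⟨h1, h2⟩ := X.lflow_trapped (p₀ := (s, t)) (p := p) (ρ := ρ) (e := e) (τ₁ := τ (j + 1 + m)) hv0
      (fun x hx => hb1 x (by rw [mem_ball_iff_norm]; linarith)) (hτ _).le (by rw [hp]; exact hwe) (by
        have h3 := norm_add_le (p - P) (P - (s, t))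
        rw [sub_add_sub_cancel] at h3
        have h4 := hBv _ (sub_nonneg.2 (hge (j + 1 + m)))
        rw [hp]
        have h5 : B * (X.E (f (j + 1)) - e) ≤ B * (X.E (f j) - e) := by gcongr
        linarith)
    refine ⟨by linarith, ?_⟩
    rw [hp] at h1
    have h3 := norm_add_le (X.lflow (τ (j + 1 + m)) p - p) (p - P)
    rw [sub_add_sub_cancel] at h3
    have h4 := hBv _ (sub_nonneg.2 (hw_le (j + 1 + m)))
    linarith
  -- the bound that keeps the cords near the accumulation point
  have hnear : ∀ m p', ‖p' - P‖ ≤ B * (X.E (f (j + 1)) - X.E (w (j + 1 + m))) → ‖p' - (s, t)‖ < ρ / 2 := by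
    intro m p' h
    have h0 : X.E (f (j + 1)) ≤ X.E (f j) := hanti (Nat.le_succ j)
    have hwe : e ≤ X.E (w (j + 1 + m)) := (hge _).trans (hstep _)
    have h1 : B * (X.E (f (j + 1)) - X.E (w (j + 1 + m))) ≤ B * (X.E (f j) - e) := by gcongr
    have h3 := norm_add_le (p' - P) (P - (s, t))
    rw [sub_add_sub_cancel] at h3
    linarith
  have hdir : ∀ m p', tc L p' = w (j + 1 + m) → ‖p' - (s, t)‖ < ρ / 2 →
      f (j + 1 + m + 1) = (u (j + 1 + m), (w (j + 1 + m)).2) → ∃ x : ℝ, (x : AddCircle L) = u (j + 1 + m) ∧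
      0 < a * (x - p'.1) ∧ |x - s| < ρ ∧ |x - p'.1| ≤ B * (X.E (w (j + 1 + m)) - X.E (f (j + 1 + m + 1))) := by
    intro m p' hp' hp'n hm
    obtain ⟨x, hx, hxn, -⟩ := exists_lift_near K.length_pos p'.1 (u (j + 1 + m))
    rw [show ((p'.1 : ℝ) : AddCircle L) = (w (j + 1 + m)).1 from congrArg Prod.fst hp'] at hxn
    obtain ⟨h1, h2⟩ := hjumpB (j + 1 + m) (by omega) (u (j + 1 + m) - (w (j + 1 + m)).1)
      (by linarith [hstart _ hm])
    rw [← hxn] at h1 h2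
    have h3 : |p'.1 - s| < ρ / 2 := (norm_fst_le (p' - (s, t))).trans_lt hp'n
    have h4 : |x - s| < ρ := by
      have := abs_add_le (x - p'.1) (p'.1 - s)
      rw [sub_add_sub_cancel] at this
      linarith
    refine ⟨x, hx, hb2 (p', x) ?_ (r (j + 1 + m)) ?_, h4, h2⟩
    · rw [mem_ball_iff_norm, Prod.mk_sub_mk, Prod.norm_mk, Real.norm_eq_abs]
      exact max_lt (by linarith) (by linarith)
    · change K.Hit (tc L p') (x : AddCircle L) _
      rw [hp', hx]; exact hit _
  have hall : ∀ m, ∃ p, tc L p = f (j + 1 + m) ∧ 0 ≤ a * (p.1 - x₀) ∧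
      ‖p - P‖ ≤ B * (X.E (f (j + 1)) - X.E (f (j + 1 + m))) := by
    intro m
    induction m with
    | zero =>
      refine ⟨P, ?_, by simp [hP], by simp⟩
      rw [add_zero, hj]
      exact Prod.ext hx₀ hwj2
    | succ m ih =>
      obtain ⟨p, hp, hpa, hpP⟩ := ih
      obtain ⟨p', hp', hpa', hpP'⟩ := hflow m p hp hpa hpP
      have hclose : ∀ p'' : ℝ × ℝ, ‖p'' - p'‖ ≤ B * (X.E (w (j + 1 + m)) - X.E (f (j + 1 + m + 1))) →
          ‖p'' - P‖ ≤ B * (X.E (f (j + 1)) - X.E (f (j + 1 + m + 1))) := by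
        intro p'' h
        have h3 := norm_add_le (p'' - p') (p' - P)
        rw [sub_add_sub_cancel] at h3
        linarith
      have hB' : 0 ≤ B * (X.E (w (j + 1 + m)) - X.E (f (j + 1 + m + 1))) :=
        mul_nonneg hB0.le (sub_nonneg.2 (hstep _))
      rcases hf (j + 1 + m) with h | h
      · obtain ⟨y, hy, hyn, -⟩ := exists_lift_near K.length_pos p'.2 (u (j + 1 + m))
        rw [show ((p'.2 : ℝ) : AddCircle L) = (w (j + 1 + m)).2 from congrArg Prod.snd hp'] at hyn
        refine ⟨(p'.1, y), ?_, hpa', hclose _ ?_⟩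
        · rw [← add_assoc, h]
          exact Prod.ext (show ((p'.1 : ℝ) : AddCircle L) = (w (j + 1 + m)).1 from congrArg Prod.fst hp') hy
        · rw [Prod.norm_def]
          simp only [Prod.fst_sub, Prod.snd_sub, sub_self, norm_zero, Real.norm_eq_abs, hyn]
          exact max_le hB' (hjumpB _ (by omega) _ (by linarith [hend _ h])).2
      · obtain ⟨x, hx, hxa, -, hxn⟩ := hdir m p' hp' (hnear m p' hpP') h
        refine ⟨(x, p'.2), ?_, by simp only; linarith, hclose _ ?_⟩
        · rw [← add_assoc, h]
          exact Prod.ext hx (show ((p'.2 : ℝ) : AddCircle L) = (w (j + 1 + m)).2 from congrArg Prod.snd hp')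
        · rw [Prod.norm_def]
          simp only [Prod.fst_sub, Prod.snd_sub, sub_self, norm_zero, Real.norm_eq_abs]
          exact max_le hxn hB'
  -- the next splitting that replaces the startpoint
  obtain ⟨n, hnj, hn⟩ := (frequently_atTop.1 hfreq) (j + 1)
  obtain ⟨m, rfl⟩ := Nat.exists_eq_add_of_le hnj
  obtain ⟨p, hp, hpa, hpP⟩ := hall m
  obtain ⟨p', hp', hpa', hpP'⟩ := hflow m p hp hpa hpP
  obtain ⟨x, hx, hxa, hxs, -⟩ := hdir m p' hp' (hnear m p' hpP') hn
  have hhit1 : K.Hit (tc L p₀) (x₀ : AddCircle L) (r j) := by rw [hp₀w, hx₀]; exact hit j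
  have hhit2 : K.Hit (tc L p') (x : AddCircle L) (r (j + 1 + m)) := by rw [hp', hx]; exact hit _
  have hx₀s : |x₀ - s| < ρ := by
    have h3 : |p₀.1 - s| < ρ / 4 := (norm_fst_le (p₀ - (s, t))).trans_lt hp₀
    have := abs_add_le (x₀ - p₀.1) (p₀.1 - s)
    rw [sub_add_sub_cancel] at this
    linarith
  have hxa0 : 0 < a * (x₀ - p₀.1) := by
    refine hb2 (p₀, x₀) ?_ (r j) hhit1
    rw [mem_ball_iff_norm, Prod.mk_sub_mk, Prod.norm_mk, Real.norm_eq_abs]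
    exact max_lt (by linarith) (by linarith)
  have hmem : ∀ (p'' : ℝ × ℝ) (y : ℝ), ‖p'' - (s, t)‖ < ρ → |y - s| < ρ → ‖(p'', y) - ((s, t), s)‖ < ρ₃ :=
    fun p'' y h h' => (max_lt h h').trans_le hρ3
  -- the startpoint and the intersection point have both moved in the direction of the cord, whereas on `S` they
  -- move in opposite directions
  have hfin := hb3 ((p', x), (p₀, x₀)) (mem_ball_iff_norm.2 (max_lt
    (hmem p' x ((hnear m p' hpP').trans (half_lt_self hρ)) hxs) (hmem p₀ x₀ (by linarith) hx₀s))) _ _ hhit2 hhit1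
  simp only at hfin
  have h1 : 0 < a * (p'.1 - p₀.1) := by linarith
  have h2 : 0 < a * (x - x₀) := by linarith
  have h3 : |a| * (|p'.1 - p₀.1 + (x - x₀)|) = |a| * |p'.1 - p₀.1| + |a| * |x - x₀| := by
    rw [← abs_mul, ← abs_mul, ← abs_mul, mul_add, abs_of_pos h1, abs_of_pos h2, abs_of_pos (by linarith)]
  have h4 := mul_le_mul_of_nonneg_left hfin ha0.le
  rw [h3] at h4
  have h5 : 0 < |a| * |p'.1 - p₀.1| := by rw [← abs_mul]; exact abs_pos.2 h1.ne'
  have h6 : 0 ≤ |a| * |x - x₀| := by positivity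
  linarith

/-- For small perturbations, a cord cannot be split infinitely often. -/
lemma exists_wellFounded_split (hK : K.Generic) :
    ∃ ε : ℝ, 0 < ε ∧ ∀ X : CordData K, X.PerturbationLT ε → WellFounded fun c' c => X.Split c c' := by
  obtain ⟨κ, hκ0, hκ⟩ := K.exists_bilipschitz
  obtain ⟨ℓ, hℓ0, hℓ⟩ := hK.exists_length_lower_bound
  refine ⟨min (κ * ℓ / 4) ℓ, lt_min (by positivity) hℓ0, fun X hε => ?_⟩
  -- in an infinite chain the startpoint or the endpoint is replaced infinitely often, and the reversal of
  -- cords exchanges the two cases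
  rw [wellFounded_iff_isEmpty_descending_chain]
  refine ⟨?_⟩
  rintro ⟨f, hf⟩
  choose τ hτ u r hit hs using hf
  have h1 := X.not_frequently_start_split hK hκ hκ0 hℓ hℓ0 hε (min_le_left _ _) (min_le_right _ _) hτ hit hs
  have h2 := X.swap.not_frequently_start_split hK hκ hκ0 hℓ hℓ0 (X.swap_perturbationLT hε) (min_le_left _ _)
    (min_le_right _ _) (f := fun n => (f n).swap) hτ (fun n => by rw [swap_flow]; exact (hit n).swap)
    (fun n => by
      simp only [swap_flow]
      rcases hs n with h | h
      · right; rw [h]; rfl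
      · left; rw [h]; rfl)
  rw [not_frequently] at h1 h2
  obtain ⟨n, hn1, hn2⟩ := (h1.and h2).exists
  rcases hs n with h | h
  · apply hn2
    simp only [swap_flow]
    rw [h]; rfl
  · exact hn1 h

end CordData
/-! ### Parts of a split cord and the framing -/

namespace CordData
variable {L : ℝ} {K : Knot L} (X : CordData K)

lemma mem_Fs_iff_of_ne {c : Torus L} (hc : c.1 ≠ c.2) :
    c ∈ X.Fs ↔ 0 < inner ℝ (K.chord c) (X.ν c.1) ∧
      inner ℝ (K.chord c) (cross (K.tan c.1) (X.ν c.1)) = 0 := by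
  have h0 : 0 < (‖K.chord c‖ ^ 2)⁻¹ := by have := norm_pos_iff.2 (K.chord_ne_zero hc); positivity
  have h1 : inner ℝ (K.normalChord c) (X.ν c.1) = (‖K.chord c‖ ^ 2)⁻¹ * inner ℝ (K.chord c) (X.ν c.1) := by
    rw [Knot.normalChord, Knot.normalProj, inner_sub_left, real_inner_smul_left _ (X.ν c.1), X.inner_tan_ν,
      mul_zero, sub_zero, Knot.scaledChord, if_neg hc, real_inner_smul_left]
  have h2 : X.offS c = (‖K.chord c‖ ^ 2)⁻¹ * inner ℝ (K.chord c) (cross (K.tan c.1) (X.ν c.1)) := by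
    rw [offS, Knot.scaledChord, if_neg hc, real_inner_smul_left]
  rw [mem_Fs_iff, h1, h2, mul_pos_iff_of_pos_left h0, mul_eq_zero, or_iff_right h0.ne']

variable {X}

/-- The part of a cord at its startpoint has the same direction there, hence it is in `F^s` if the cord is. -/
lemma mem_Fs_of_hit {c : Torus L} {u : AddCircle L} {r : ℝ} (hit : K.Hit c u r) (hc : c ∈ X.Fs) :
    (c.1, u) ∈ X.Fs := by
  rw [X.mem_Fs_iff_of_ne hit.1] at hc
  rw [X.mem_Fs_iff_of_ne (c := (c.1, u)) hit.ne_start.symm]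
  have h : K.chord (c.1, u) = r • K.chord c := hit.sub_start
  rw [h, real_inner_smul_left, real_inner_smul_left]
  exact ⟨mul_pos hit.2.1 hc.1, by simp only [hc.2, mul_zero]⟩

lemma mem_Fe_of_hit {c : Torus L} {u : AddCircle L} {r : ℝ} (hit : K.Hit c u r) (hc : c ∈ X.Fe) :
    (u, c.2) ∈ X.Fe := mem_Fs_of_hit (c := c.swap) hit.swap hc

/-- If the framing vector at the splitting point is in the plane spanned by the cord and the tangent of the knot,
it points to the side of one of the two parts of the cord, which then is in `F`. Hence the exponent of `μ` in a
splitting is locally constant if the parts are not in `F`. -/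
lemma inner_ν_conormal_ne_zero {c : Torus L} {u : AddCircle L} {r : ℝ} (hit : K.Hit c u r)
    (hn : K.conormal c u ≠ 0) (h1 : (c.1, u) ∉ X.F) (h2 : (u, c.2) ∉ X.F) :
    inner ℝ (X.ν u) (K.conormal c u) ≠ 0 := by
  intro h
  have h3 : inner ℝ (K.chord c) (cross (K.tan u) (X.ν u)) = 0 := by
    have : inner ℝ (K.chord c) (cross (K.tan u) (X.ν u)) = -inner ℝ (X.ν u) (K.conormal c u) := by
      rw [Knot.conormal]
      simp only [inner_eq_sum, cross_zero, cross_one, cross_two]; ring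
    rw [this, h, neg_zero]
  rcases lt_trichotomy (inner ℝ (K.chord c) (X.ν u)) 0 with hlt | heq | hgt
  · apply h1
    right
    change (u, c.1) ∈ X.Fs
    rw [X.mem_Fs_iff_of_ne (c := (u, c.1)) hit.ne_start]
    have h4 : K.chord (u, c.1) = (-r) • K.chord c := by
      rw [neg_smul, ← hit.sub_start, Knot.chord]; abel
    rw [h4, real_inner_smul_left, real_inner_smul_left, h3, mul_zero]
    exact ⟨mul_pos_of_neg_of_neg (neg_lt_zero.2 hit.2.1) hlt, rfl⟩
  · apply hn
    have h4 := eq_of_orthonormal_frame (v := K.chord c) (K.inner_tan_self u) (X.inner_ν_self u) (X.inner_tan_ν u)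
    rw [heq, h3, zero_smul, zero_smul, add_zero, add_zero] at h4
    rw [Knot.conormal, h4, cross_smul_right]
    ext i
    fin_cases i <;> simp [cross_zero, cross_one, cross_two] <;> ring_nf <;> simp
  · apply h2
    left
    rw [X.mem_Fs_iff_of_ne (c := (u, c.2)) hit.ne_end]
    have h4 : K.chord (u, c.2) = (1 - r) • K.chord c := hit.end_sub
    rw [h4, real_inner_smul_left, real_inner_smul_left, h3, mul_zero]
    exact ⟨mul_pos (by linarith [hit.2.2.1]) hgt, rfl⟩

/-! ### The exceptional set and the uniqueness of `D̂` -/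

/-- The complement of `A` is closed under splitting, and this permits induction along the splittings. -/
lemma notMem_A_iff {c : Torus L} : c ∉ X.A ↔ ¬ X.Bad c ∧ ∀ c', X.Split c c' → c' ∉ X.A := by
  constructor
  · intro h
    exact ⟨fun hb => h ⟨c, .refl, hb⟩, fun c' hs ⟨d, hd, hb⟩ => h ⟨d, .head hs hd, hb⟩⟩
  · rintro ⟨h1, h2⟩ ⟨d, hd, hb⟩
    rcases hd.cases_head with rfl | ⟨c', hs, hd'⟩
    · exact h1 hb
    · exact h2 c' hs ⟨d, hd', hb⟩

lemma pos_of_mem_S {c : Torus L} (hc : ¬ X.Bad c) {τ : ℝ} (h0 : 0 ≤ τ) (h : X.flow τ c ∈ K.S) : 0 < τ := by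
  rcases h0.eq_or_lt with rfl | h0
  · rw [flow_zero] at h
    exact absurd (Or.inr (Or.inl (Or.inl (Or.inl h)))) hc
  · exact h0

lemma stable_unique {c d d' : Torus L} (h : c ∈ X.stable d) (h' : c ∈ X.stable d') : d = d' := by
  have : Fact (0 < L) := ⟨K.length_pos⟩
  exact tendsto_nhds_unique h h'

lemma IsDhat.unique {c : Torus L} {z z' : X.C0} (h : X.IsDhat c z) (hc : c ∉ X.A) (h' : X.IsDhat c z') :
    z = z' := by
  induction h generalizing z' with
  | intro c d P u r z₁ z₂ hd hP hu h₁ h₂ ih₁ ih₂ =>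
    cases h' with
    | intro _ d' P' u' r' z₁' z₂' hd' hP' hu' h₁' h₂' =>
      obtain rfl : d = d' := Subtype.ext (stable_unique hd hd')
      obtain rfl : P = P' := by ext τ; rw [hP, hP']
      congr 1
      refine Finset.sum_congr rfl fun τ hτ => ?_
      obtain ⟨hb, hs⟩ := notMem_A_iff.1 hc
      have hτ0 := (hP τ).1 hτ
      have hpos := pos_of_mem_S hb hτ0.1 hτ0.2
      have huu : u τ = u' τ := by
        by_contra hne
        exact hb (Or.inr (Or.inr (Or.inr ⟨τ, hτ0.1, Or.inr ⟨_, _, _, _, hu τ hτ, hu' τ hτ, hne⟩⟩)))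
      have hrr : r τ = r' τ := (hu τ hτ).ratio_unique (huu ▸ hu' τ hτ)
      have e₁ := ih₁ τ hτ (hs _ ⟨τ, hpos, _, _, hu τ hτ, Or.inl rfl⟩) (by rw [huu]; exact h₁' τ hτ)
      have e₂ := ih₂ τ hτ (hs _ ⟨τ, hpos, _, _, hu τ hτ, Or.inr rfl⟩) (by rw [huu]; exact h₂' τ hτ)
      rw [huu, hrr, e₁, e₂]

lemma IsDhat.dhat_eq {c : Torus L} {z : X.C0} (h : X.IsDhat c z) (hc : c ∉ X.A) : X.Dhat c = z :=
  IsDhat.unique (Classical.epsilon_spec ⟨z, h⟩) hc h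

end CordData

namespace Knot
variable {L : ℝ} {K : Knot L}

/-- A property that holds near the unique intersection of a cord with the knot holds for all intersections of
the nearby cords with the knot. -/
lemma Generic.eventually_of_hit (hK : K.Generic) {c₀ : Torus L} {u₀ : AddCircle L} {r₀ : ℝ} (hit : K.Hit c₀ u₀ r₀)
    (hb : c₀ ∉ K.bdryS) (h2 : c₀ ∉ K.S₂) {Q : Torus L → AddCircle L → ℝ → Prop}
    (hQ : ∀ᶠ z : Torus L × (AddCircle L × ℝ) in 𝓝 (c₀, (u₀, r₀)), Q z.1 z.2.1 z.2.2) :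
    ∀ᶠ c in 𝓝 c₀, ∀ u r, K.Hit c u r → Q c u r := by
  rw [nhds_prod_eq] at hQ
  obtain ⟨U, hU, W, hW, hUW⟩ := eventually_prod_iff.1 hQ
  obtain ⟨V, hVW, hV, hmem⟩ := mem_nhds_iff.1 hW
  have h := hK.eventually_hit_mem hb hV (fun u r hit' => by
    have huu : u = u₀ := by
      by_contra hne
      exact h2 ⟨_, _, _, _, hit', hit, hne⟩
    subst huu
    rw [hit'.ratio_unique hit]
    exact hmem)
  filter_upwards [hU, h] with c hc hc' u r hit'
  exact hUW hc (hVW (hc' u r hit'))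

end Knot
/-! ### Local constancy of `D̂` -/

namespace CordData
variable {L : ℝ} {K : Knot L} {X : CordData K}

/-- The negation of `Bad` as a list of conditions, with `F` and `B` decomposed into the parts at the startpoint and
at the endpoint. -/
lemma not_bad_iff {c : Torus L} : ¬ X.Bad c ↔
    (c ∉ X.Crit0 ∧ c ∉ X.Crit2 ∧ ∀ k ∈ X.Crit1, c ∉ X.stable k) ∧
    (c ∉ K.S ∧ c ∉ X.Fs ∧ c ∉ X.Fe ∧ c.1 ≠ 0 ∧ c.2 ≠ 0) ∧
    (X.TransB c ∧ X.TransF c ∧ X.TransS c) ∧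
    ∀ τ, 0 ≤ τ → X.flow τ c ∉ K.bdryS ∧ X.flow τ c ∉ X.bdryF ∧ X.flow τ c ∉ K.S₂ := by
  simp only [Bad, F, B, mem_union, mem_iUnion, mem_ofPred_eq, not_or, not_exists, not_and, not_not, exists_prop, and_assoc, ne_eq]
  tauto

/-- The times at which the trajectories cross `M` depend continuously on the initial point if the closure of `M`
exceeds `M` only by points that the given trajectory avoids. -/
lemma exists_crossing_times_of_closure {M N : Set (Torus L)} (hcl : closure M ⊆ M ∪ N) {q d : Torus L}
    (hd : d ∈ X.Crit0) (hq : q ∈ X.stable d) (hqN : ∀ τ, 0 ≤ τ → X.flow τ q ∉ N) (hdN : d ∉ N)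
    (hqM : q ∉ M) (hdM : d ∉ M)
    (hw : ∀ τ, 0 < τ → X.flow τ q ∈ M → LocalWall M (X.flow τ q) (X.vel (X.flow τ q))) :
    ∃ (P : Finset ℝ) (θ : ℝ → Torus L → ℝ), (∀ p, p ∈ P ↔ 0 < p ∧ X.flow p q ∈ M) ∧
      (∀ p ∈ P, Tendsto (θ p) (𝓝 q) (𝓝 p)) ∧
      ∀ᶠ x in 𝓝 q, ∀ τ, 0 ≤ τ → (X.flow τ x ∈ M ↔ ∃ p ∈ P, τ = θ p x) := by
  refine X.exists_crossing_times hd hq ?_ (fun h => (hcl h).elim hdM hdN) fun τ hτ => ?_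
  · intro h
    have := hqN 0 le_rfl
    rw [flow_zero] at this
    exact (hcl h).elim hqM this
  · by_cases h : X.flow τ q ∈ M
    · exact Or.inr ⟨h, hw τ hτ h⟩
    · exact Or.inl fun h' => (hcl h').elim h (hqN τ hτ.le)

/-- If a trajectory is transverse to `M`, the signed numbers of crossings of `M`, during all times or up to a
time that depends continuously on the initial point, are locally constant, and the nearby trajectories are also
transverse to `M`. -/
lemma count_locally_constant {M N : Set (Torus L)} (hcl : closure M ⊆ M ∪ N) {q d : Torus L}
    (hd : d ∈ X.Crit0) (hq : q ∈ X.stable d) (hqN : ∀ τ, 0 ≤ τ → X.flow τ q ∉ N) (hdN : d ∉ N)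
    (hqM : q ∉ M) (hdM : d ∉ M) {rate : Torus L → ℝ} (hc : Continuous rate)
    (hr : ∀ τ, 0 ≤ τ → X.flow τ q ∈ M → rate (X.flow τ q) ≠ 0)
    (hw : ∀ c ∈ M, rate c ≠ 0 → LocalWall M c (X.vel c)) :
    (∃ n, ∀ᶠ x in 𝓝 q, X.count M rate (Ici 0) x = n) ∧
    (∀ (p' : ℝ) (θ' : Torus L → ℝ), Tendsto θ' (𝓝 q) (𝓝 p') → X.flow p' q ∉ M →
      ∃ n, ∀ᶠ x in 𝓝 q, X.count M rate (Ico 0 (θ' x)) x = n) ∧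
    ∀ᶠ x in 𝓝 q, ∀ τ, 0 ≤ τ → X.flow τ x ∈ M → rate (X.flow τ x) ≠ 0 := by
  classical
  obtain ⟨P, θ, hP, hθ, hM⟩ := exists_crossing_times_of_closure hcl hd hq hqN hdN hqM hdM
    fun τ hτ h => hw _ h (hr τ hτ.le h)
  have hr' : ∀ p ∈ P, rate (X.flow p q) ≠ 0 := fun p hp => hr p ((hP p).1 hp).1.le ((hP p).1 hp).2
  have hpos : ∀ᶠ x in 𝓝 q, ∀ p ∈ P, 0 < θ p x := by
    rw [Filter.eventually_all_finset]
    exact fun p hp => (hθ p hp).eventually_const_lt ((hP p).1 hp).1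
  refine ⟨⟨_, X.eventually_count_eq hθ hM hc hr' (I := fun _ => Ici 0) (fun _ => le_rfl) subset_rfl ?_⟩, ?_, ?_⟩
  · filter_upwards [hpos] with x hx p hp
    exact iff_of_true (hx p hp).le hp
  · intro p' θ' hθ' hp'
    refine ⟨_, X.eventually_count_eq hθ hM hc hr' (I := fun x => Ico 0 (θ' x)) (fun _ _ h => h.1)
      (P' := P.filter (· < p')) (Finset.filter_subset _ _) ?_⟩
    have hcmp : ∀ᶠ x in 𝓝 q, ∀ p ∈ P, θ p x < θ' x ↔ p < p' := by
      rw [Filter.eventually_all_finset]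
      intro p hp
      rcases lt_trichotomy p p' with h | h | h
      · filter_upwards [(hθ p hp).eventually_lt hθ' h] with x hx
        exact iff_of_true hx h
      · rw [← h] at hp'
        exact absurd ((hP p).1 hp).2 hp'
      · filter_upwards [hθ'.eventually_lt (hθ p hp) h] with x hx
        exact iff_of_false hx.not_gt h.not_gt
    filter_upwards [hpos, hcmp] with x h1 h2 p hp
    rw [Finset.mem_filter, ← h2 p hp]
    exact ⟨fun h => ⟨hp, h.2⟩, fun h => ⟨(h1 p hp).le, h.2⟩⟩
  · have hne : ∀ᶠ x in 𝓝 q, ∀ p ∈ P, rate (X.flow (θ p x) x) ≠ 0 := by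
      rw [Filter.eventually_all_finset]
      intro p hp
      exact ((hc.tendsto _).comp (X.tendsto_flow (hθ p hp) tendsto_id)).eventually_ne (hr' p hp)
    filter_upwards [hM, hne] with x h1 h2 τ hτ h
    obtain ⟨p, hp, rfl⟩ := (h1 τ hτ).1 h
    exact h2 p hp

/-- The contribution of a splitting to `D̂` is locally constant. -/
lemma eventually_splitTerm_eq (hK : K.Generic) {q : Torus L} {p : ℝ} {θ : Torus L → ℝ}
    (hθ : Tendsto θ (𝓝 q) (𝓝 p)) {u₀ : AddCircle L} {r₀ : ℝ} (hit : K.Hit (X.flow p q) u₀ r₀)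
    (hb : X.flow p q ∉ K.bdryS) (h2 : X.flow p q ∉ K.S₂) (hcr : X.crossRate (X.flow p q) u₀ r₀ ≠ 0)
    (hν : inner ℝ (X.ν u₀) (K.conormal (X.flow p q) u₀) ≠ 0) {z₁ z₂ : X.C0} {l r : X.C0ˣ}
    (g₁ : ∀ᶠ y in 𝓝 ((X.flow p q).1, u₀), y ∉ X.A ∧ X.IsDhat y z₁)
    (g₂ : ∀ᶠ y in 𝓝 (u₀, (X.flow p q).2), y ∉ X.A ∧ X.IsDhat y z₂)
    (hl : ∀ᶠ x in 𝓝 q, X.left (Ico 0 (θ x)) x = l) (hr : ∀ᶠ x in 𝓝 q, X.right (Ico 0 (θ x)) x = r) :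
    ∃ t, ∀ᶠ x in 𝓝 q, ∀ u ρ, K.Hit (X.flow (θ x) x) u ρ → X.crossRate (X.flow (θ x) x) u ρ ≠ 0 ∧
      (((X.flow (θ x) x).1, u) ∉ X.A ∧ X.IsDhat ((X.flow (θ x) x).1, u) z₁) ∧
      ((u, (X.flow (θ x) x).2) ∉ X.A ∧ X.IsDhat (u, (X.flow (θ x) x).2) z₂) ∧
      X.splitTerm x (θ x) u ρ z₁ z₂ = t := by
  set c₀ := X.flow p q with hc₀
  refine ⟨X.splitSign c₀ u₀ r₀ • ((l : X.C0) * z₁ * ((X.mu ^ X.splitExp c₀ u₀ : X.C0ˣ) : X.C0) * z₂ * (r : X.C0)), ?_⟩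
  have hconor : Continuous fun z : Torus L × (AddCircle L × ℝ) => K.conormal z.1 z.2.1 := by
    have h1 : Continuous fun z : Torus L × (AddCircle L × ℝ) => K.tan z.2.1 :=
      K.continuous_tan.comp (continuous_fst.comp continuous_snd)
    have h2 : Continuous fun z : Torus L × (AddCircle L × ℝ) => K.chord z.1 :=
      K.continuous_chord.comp continuous_fst
    exact continuous_cross.comp (h1.prodMk h2)
  have hrate : Continuous fun z : Torus L × (AddCircle L × ℝ) => X.crossRate z.1 z.2.1 z.2.2 := by
    have h1 : Continuous fun z : Torus L × (AddCircle L × ℝ) => X.vel z.1 := X.continuous_vel.comp continuous_fst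
    have h2 : Continuous fun z : Torus L × (AddCircle L × ℝ) => z.2.2 := continuous_snd.comp continuous_snd
    have h3 : Continuous fun z : Torus L × (AddCircle L × ℝ) => K.tan z.1.1 :=
      K.continuous_tan.comp (continuous_fst.comp continuous_fst)
    have h4 : Continuous fun z : Torus L × (AddCircle L × ℝ) => K.tan z.1.2 :=
      K.continuous_tan.comp (continuous_snd.comp continuous_fst)
    exact ((((continuous_const.sub h2).mul h1.fst).smul h3).add ((h2.mul h1.snd).smul h4)).inner hconor
  have hνc : Continuous fun z : Torus L × (AddCircle L × ℝ) => (inner ℝ (X.ν z.2.1) (K.conormal z.1 z.2.1) : ℝ) :=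
    (X.continuous_ν.comp (continuous_fst.comp continuous_snd)).inner hconor
  have hp1 : Tendsto (fun z : Torus L × (AddCircle L × ℝ) => (z.1.1, z.2.1)) (𝓝 (c₀, (u₀, r₀))) (𝓝 (c₀.1, u₀)) :=
    (show Continuous fun z : Torus L × (AddCircle L × ℝ) => (z.1.1, z.2.1) by fun_prop).tendsto' _ _ rfl
  have hp2 : Tendsto (fun z : Torus L × (AddCircle L × ℝ) => (z.2.1, z.1.2)) (𝓝 (c₀, (u₀, r₀))) (𝓝 (u₀, c₀.2)) :=
    (show Continuous fun z : Torus L × (AddCircle L × ℝ) => (z.2.1, z.1.2) by fun_prop).tendsto' _ _ rfl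
  have hev := hK.eventually_of_hit hit hb h2
    (Q := fun c u ρ => X.crossRate c u ρ ≠ 0 ∧ ((c.1, u) ∉ X.A ∧ X.IsDhat (c.1, u) z₁) ∧
      ((u, c.2) ∉ X.A ∧ X.IsDhat (u, c.2) z₂) ∧ X.splitSign c u ρ = X.splitSign c₀ u₀ r₀ ∧
      X.splitExp c u = X.splitExp c₀ u₀) (by
    filter_upwards [hrate.continuousAt.eventually_ne hcr, hp1.eventually g₁, hp2.eventually g₂,
      eventually_sign_eq (hrate.tendsto (c₀, (u₀, r₀))) hcr,
      eventually_sign_eq (hνc.tendsto (c₀, (u₀, r₀))) hν] with z h1 h3 h4 h5 h6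
    refine ⟨h1, h3, h4, by rw [splitSign, splitSign, h5], ?_⟩
    have h7 : 0 < (inner ℝ (X.ν z.2.1) (K.conormal z.1 z.2.1) : ℝ) ↔
        0 < (inner ℝ (X.ν u₀) (K.conormal c₀ u₀) : ℝ) := by
      rw [← sign_eq_one_iff, h6, sign_eq_one_iff]
    simp only [splitExp, h7])
  have ht : Tendsto (fun x => X.flow (θ x) x) (𝓝 q) (𝓝 c₀) := X.tendsto_flow hθ tendsto_id
  filter_upwards [ht.eventually hev, hl, hr] with x h1 hlx hrx u ρ hx
  obtain ⟨a1, a2, a3, a4, a5⟩ := h1 u ρ hx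
  exact ⟨a1, a2, a3, by rw [splitTerm, a4, a5, hlx, hrx]⟩

/-- The inductive step of the local constancy of `D̂`: it holds at a cord if it holds at the parts into which
the cord is split on its way. -/
lemma eventually_isDhat (hK : K.Generic) (hX : X.Generic) {q : Torus L} (hq : q ∉ X.A)
    (ih : ∀ c', X.Split q c' → c' ∉ X.A → ∃ z, ∀ᶠ y in 𝓝 c', y ∉ X.A ∧ X.IsDhat y z) :
    ∃ z, ∀ᶠ x in 𝓝 q, x ∉ X.A ∧ X.IsDhat x z := by
  classical
  have : Fact (0 < L) := ⟨K.length_pos⟩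
  obtain ⟨hbad, hsplit⟩ := notMem_A_iff.1 hq
  obtain ⟨⟨hq0, hq2, hq1⟩, ⟨hqS, hqFs, hqFe, hqB1, hqB2⟩, ⟨htB, htF, htS⟩, hbd⟩ := not_bad_iff.1 hbad
  obtain ⟨d, hd, hqd⟩ := hX.tendsto_crit0 hq2 hq1
  have hdis : d ∉ B ∪ X.F ∪ K.S := fun h => disjoint_left.1 hX.disjoint (Or.inl hd) h
  simp only [B, F, mem_union, mem_ofPred_eq, not_or] at hdis
  obtain ⟨⟨⟨hdB1, hdB2⟩, hdFs, hdFe⟩, hdS⟩ := hdis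
  have hdb : d ∉ K.bdryS := hX.notMem_bdryS hd.1
  have hqb : ∀ τ, 0 ≤ τ → X.flow τ q ∉ K.bdryS := fun τ hτ => (hbd τ hτ).1
  -- the closures of the walls
  have clB1 : closure {x : Torus L | x.1 = 0} ⊆ {x : Torus L | x.1 = 0} ∪ K.bdryS := by
    rw [(isClosed_eq continuous_fst continuous_const).closure_eq]; exact subset_union_left
  have clB2 : closure {x : Torus L | x.2 = 0} ⊆ {x : Torus L | x.2 = 0} ∪ K.bdryS := by
    rw [(isClosed_eq continuous_snd continuous_const).closure_eq]; exact subset_union_left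
  have clFs : closure X.Fs ⊆ X.Fs ∪ K.bdryS := (closure_Fs_subset hK).trans
    (union_subset_union_right _ (by rw [Knot.bdryS_eq]; exact subset_union_left))
  have clFe : closure X.Fe ⊆ X.Fe ∪ K.bdryS := (closure_Fe_subset hK).trans
    (union_subset_union_right _ (by rw [Knot.bdryS_eq]; exact subset_union_right))
  have clS : closure K.S ⊆ K.S ∪ K.bdryS := closure_minimal subset_union_left hK.isClosed_S_union
  have clb : closure K.bdryS ⊆ K.bdryS ∪ ∅ := by rw [hK.isClosed_bdryS.closure_eq]; exact subset_union_left
  -- the crossings of the base point and of the framing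
  obtain ⟨⟨nB1, cB1⟩, cB1', tB1⟩ := count_locally_constant clB1 hd hqd hqb hdb hqB1 hdB1
    (rate := fun x => (X.vel x).1) X.continuous_vel.fst (fun τ hτ => (htB τ hτ).1)
    (fun c hc hv => localWall_base K.length_pos hc hv)
  obtain ⟨⟨nB2, cB2⟩, cB2', tB2⟩ := count_locally_constant clB2 hd hqd hqb hdb hqB2 hdB2
    (rate := fun x => (X.vel x).2) X.continuous_vel.snd (fun τ hτ => (htB τ hτ).2)
    (fun c hc hv => (localWall_base (c := c.swap) (v := (X.vel c).swap) K.length_pos hc hv).swap)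
  obtain ⟨⟨nFs, cFs⟩, cFs', tFs⟩ := count_locally_constant clFs hd hqd hqb hdb hqFs hdFs
    X.continuous_along_offS (fun τ hτ => (htF τ hτ).1) (fun c hc hv => localWall_Fs hc hv)
  obtain ⟨⟨nFe, cFe⟩, cFe', tFe⟩ := count_locally_constant clFe hd hqd hqb hdb hqFe hdFe
    X.continuous_along_offE (fun τ hτ => (htF τ hτ).2) (fun c hc hv => localWall_Fe hc hv)
  -- the crossings of `S` and of its boundary
  have hwS : ∀ τ, 0 ≤ τ → X.flow τ q ∈ K.S → LocalWall K.S (X.flow τ q) (X.vel (X.flow τ q)) ∧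
      ∀ᶠ c in 𝓝 (X.flow τ q), c ∉ K.S₂ := by
    rintro τ hτ ⟨u, r, hit⟩
    exact hK.localWall_S hit (hbd τ hτ).2.2 (hqb τ hτ) (htS τ hτ u r hit)
  obtain ⟨P, θ, hP, hθ, hPS⟩ := exists_crossing_times_of_closure clS hd hqd hqb hdb hqS hdS
    fun τ hτ h => (hwS τ hτ.le h).1
  obtain ⟨P', θ', hP', -, hPb⟩ := exists_crossing_times_of_closure clb hd hqd (fun _ _ => notMem_empty _)
    (notMem_empty _) (by have := hqb 0 le_rfl; rwa [flow_zero] at this) hdb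
    fun τ hτ h => absurd h (hqb τ hτ.le)
  have hbx : ∀ᶠ x in 𝓝 q, ∀ τ, 0 ≤ τ → X.flow τ x ∉ K.bdryS := by
    filter_upwards [hPb] with x hx τ hτ h
    obtain ⟨p, hp, -⟩ := (hx τ hτ).1 h
    exact hqb p ((hP' p).1 hp).1.le ((hP' p).1 hp).2
  -- the splittings
  have hterm : ∀ p : ℝ, ∃ (z₁ z₂ t : X.C0), p ∈ P → ∀ᶠ x in 𝓝 q, ∀ u ρ, K.Hit (X.flow (θ p x) x) u ρ →
      X.crossRate (X.flow (θ p x) x) u ρ ≠ 0 ∧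
      (((X.flow (θ p x) x).1, u) ∉ X.A ∧ X.IsDhat ((X.flow (θ p x) x).1, u) z₁) ∧
      ((u, (X.flow (θ p x) x).2) ∉ X.A ∧ X.IsDhat (u, (X.flow (θ p x) x).2) z₂) ∧
      X.splitTerm x (θ p x) u ρ z₁ z₂ = t := by
    intro p
    by_cases hp : p ∈ P
    swap
    · exact ⟨0, 0, 0, fun h => absurd h hp⟩
    obtain ⟨hp0, u₀, r₀, hit⟩ := (hP p).1 hp
    have s₁ : X.Split q ((X.flow p q).1, u₀) := ⟨p, hp0, u₀, r₀, hit, Or.inl rfl⟩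
    have s₂ : X.Split q (u₀, (X.flow p q).2) := ⟨p, hp0, u₀, r₀, hit, Or.inr rfl⟩
    have n₁ := hsplit _ s₁
    have n₂ := hsplit _ s₂
    obtain ⟨z₁, g₁⟩ := ih _ s₁ n₁
    obtain ⟨z₂, g₂⟩ := ih _ s₂ n₂
    have b₁ := (not_bad_iff.1 (notMem_A_iff.1 n₁).1).2.1
    have b₂ := (not_bad_iff.1 (notMem_A_iff.1 n₂).1).2.1
    have hcr := htS p hp0.le u₀ r₀ hit
    have hν : inner ℝ (X.ν u₀) (K.conormal (X.flow p q) u₀) ≠ 0 := by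
      refine inner_ν_conormal_ne_zero hit (fun h => ?_) (fun h => h.elim b₁.2.1 b₁.2.2.1)
        (fun h => h.elim b₂.2.1 b₂.2.2.1)
      rw [crossRate, h, inner_zero_right] at hcr
      exact hcr rfl
    -- at a time of splitting the cord crosses neither the base point nor the framing, as its parts do not
    obtain ⟨mB1, eB1⟩ := cB1' p (θ p) (hθ p hp) b₁.2.2.2.1
    obtain ⟨mB2, eB2⟩ := cB2' p (θ p) (hθ p hp) b₂.2.2.2.2
    obtain ⟨mFs, eFs⟩ := cFs' p (θ p) (hθ p hp) fun h => b₁.2.1 (mem_Fs_of_hit hit h)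
    obtain ⟨mFe, eFe⟩ := cFe' p (θ p) (hθ p hp) fun h => b₂.2.2.1 (mem_Fe_of_hit hit h)
    obtain ⟨t, ht⟩ := eventually_splitTerm_eq hK (hθ p hp) hit (hqb p hp0.le) (hbd p hp0.le).2.2 hcr hν g₁ g₂
      (l := X.lam ^ mB1 * X.mu ^ mFs) (r := X.lam ^ (-mB2) * X.mu ^ (-mFe))
      (by filter_upwards [eB1, eFs] with x h1 h2; rw [left, h1, h2])
      (by filter_upwards [eB2, eFe] with x h1 h2; rw [right, h1, h2])
    exact ⟨z₁, z₂, t, fun _ => ht⟩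
  choose z₁ z₂ t hterm using hterm
  have hsp := (Filter.eventually_all_finset P).2 hterm
  have hS2 : ∀ᶠ x in 𝓝 q, ∀ p ∈ P, X.flow (θ p x) x ∉ K.S₂ := by
    rw [Filter.eventually_all_finset]
    intro p hp
    obtain ⟨hp0, hpS⟩ := (hP p).1 hp
    exact (X.tendsto_flow (hθ p hp) tendsto_id).eventually (hwS p hp0.le hpS).2
  have hpos : ∀ᶠ x in 𝓝 q, ∀ p ∈ P, 0 < θ p x := by
    rw [Filter.eventually_all_finset]
    exact fun p hp => (hθ p hp).eventually_const_lt ((hP p).1 hp).1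
  have hinj := eventually_injOn_of_tendsto hθ
  have hqd' : q ≠ d := fun h => hq0 (h ▸ hd)
  have hoff : ∀ {M : Set (Torus L)}, closure M ⊆ M ∪ K.bdryS → q ∉ M → ∀ᶠ x in 𝓝 q, x ∉ M := by
    intro M hcl hM
    have hqM : q ∉ closure M := fun h => (hcl h).elim hM (by have := hqb 0 le_rfl; rwa [flow_zero] at this)
    have hev : ∀ᶠ x in 𝓝 q, x ∈ (closure M)ᶜ := isClosed_closure.isOpen_compl.mem_nhds hqM
    exact hev.mono fun x hx h => hx (subset_closure h)
  refine ⟨((X.lam ^ nB1 * X.mu ^ nFs : X.C0ˣ) : X.C0) * X.gen (Gen.cord ⟨d, hd⟩) * ((X.lam ^ (-nB2) * X.mu ^ (-nFe) : X.C0ˣ) : X.C0)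
    + ∑ p ∈ P, t p, ?_⟩
  filter_upwards [X.stable_mem_nhds hd hqd, isOpen_ne.mem_nhds hqd', cB1, cB2, cFs, cFe, tB1.and tB2, tFs.and tFe,
    hPS, hbx, hsp, hS2, hpos, hinj, hoff clS hqS, (hoff clFs hqFs).and (hoff clFe hqFe),
    (hoff clB1 hqB1).and (hoff clB2 hqB2)]
    with x xd xne xB1 xB2 xFs xFe xtB xtF xS xb xsp xS2 xpos hInjOn xoS xoF xoB
  have hcrit : ¬ IsCrit X.E x := by
    intro h
    have hxx : x ∈ X.stable x := by
      have : (fun τ => X.flow τ x) = fun _ => x := funext fun τ => X.flow_of_isCrit h τ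
      rw [stable, mem_ofPred_eq, this]
      exact tendsto_const_nhds
    exact xne (stable_unique hxx xd)
  constructor
  · refine notMem_A_iff.2 ⟨not_bad_iff.2 ⟨⟨fun h => hcrit h.1, fun h => hcrit h.1, fun k hk h => ?_⟩,
      ⟨xoS, xoF.1, xoF.2, xoB.1, xoB.2⟩, ⟨fun τ hτ => ⟨xtB.1 τ hτ, xtB.2 τ hτ⟩,
      fun τ hτ => ⟨xtF.1 τ hτ, xtF.2 τ hτ⟩, fun τ hτ u r hit => ?_⟩, fun τ hτ => ⟨xb τ hτ,
      fun h => xb τ hτ (bdryF_subset hK h), fun h => ?_⟩⟩, ?_⟩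
    · have hkd := stable_unique h xd
      rw [hkd] at hk
      exact lt_asymm hk.2 hd.2.det_pos
    · obtain ⟨p, hp, rfl⟩ := (xS τ hτ).1 ⟨u, r, hit⟩
      exact (xsp p hp u r hit).1
    · obtain ⟨u, r, u', r', hit, hit', hne⟩ := h
      obtain ⟨p, hp, rfl⟩ := (xS τ hτ).1 ⟨u, r, hit⟩
      exact xS2 p hp ⟨u, r, u', r', hit, hit', hne⟩
    · rintro c' ⟨τ, hτ, u, r, hit, hc'⟩
      obtain ⟨p, hp, rfl⟩ := (xS τ hτ.le).1 ⟨u, r, hit⟩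
      rcases hc' with rfl | rfl
      · exact (xsp p hp u r hit).2.1.1
      · exact (xsp p hp u r hit).2.2.1.1
  · have hmemP : ∀ τ, τ ∈ P.image (fun p => θ p x) ↔ 0 ≤ τ ∧ X.flow τ x ∈ K.S := by
      intro τ
      rw [Finset.mem_image]
      constructor
      · rintro ⟨p, hp, rfl⟩
        exact ⟨(xpos p hp).le, (xS _ (xpos p hp).le).2 ⟨p, hp, rfl⟩⟩
      · rintro ⟨h0, h⟩
        obtain ⟨p, hp, rfl⟩ := (xS τ h0).1 h
        exact ⟨p, hp, rfl⟩
    have hhit : ∀ τ, ∃ u r, τ ∈ P.image (fun p => θ p x) → K.Hit (X.flow τ x) u r := by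
      intro τ
      by_cases h : τ ∈ P.image (fun p => θ p x)
      · obtain ⟨u, r, hit⟩ := ((hmemP τ).1 h).2
        exact ⟨u, r, fun _ => hit⟩
      · exact ⟨0, 0, fun h' => absurd h' h⟩
    choose u r hhit using hhit
    -- the inverse of the injection `p ↦ θ p x`
    set φ := Function.invFunOn (fun p => θ p x) (P : Set ℝ) with hφ
    have hφθ : ∀ p ∈ P, φ (θ p x) = p := fun p hp => hInjOn.leftInvOn_invFunOn hp
    have hpart : ∀ p ∈ P, _ := fun p hp => xsp p hp (u (θ p x)) (r (θ p x))
      (hhit _ (Finset.mem_image_of_mem (fun p => θ p x) hp))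
    have key := IsDhat.intro x ⟨d, hd⟩ (P.image (fun p => θ p x)) u r (fun τ => z₁ (φ τ)) (fun τ => z₂ (φ τ)) xd
      hmemP (fun τ hτ => hhit τ hτ)
      (by
        intro τ hτ
        obtain ⟨p, hp, rfl⟩ := Finset.mem_image.1 hτ
        simp only [hφθ p hp]
        exact (hpart p hp).2.1.2)
      (by
        intro τ hτ
        obtain ⟨p, hp, rfl⟩ := Finset.mem_image.1 hτ
        simp only [hφθ p hp]
        exact (hpart p hp).2.2.1.2)
    rw [Finset.sum_image hInjOn] at key
    have hsum : ∑ p ∈ P, X.splitTerm x (θ p x) (u (θ p x)) (r (θ p x)) (z₁ (φ (θ p x))) (z₂ (φ (θ p x))) =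
        ∑ p ∈ P, t p := Finset.sum_congr rfl fun p hp => by
      rw [hφθ p hp]; exact (hpart p hp).2.2.2
    rw [bdryTerm, left, right, xB1, xB2, xFs, xFe, hsum] at key
    exact key

end CordData
end CordAlgebra

theorem mainTheorem4 {L : ℝ} (K : CordAlgebra.Knot L) (hK : K.Generic) :
    ∃ ε : ℝ, 0 < ε ∧ ∀ X : CordAlgebra.CordData K, X.Generic → X.PerturbationLT ε →
      ∀ q : CordAlgebra.Torus L, q ∉ X.A →
        ∃ V : Set (CordAlgebra.Torus L), IsOpen V ∧ q ∈ V ∧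
          ∀ x ∈ V, x ∉ X.A ∧ (∃! z, X.IsDhat x z) ∧ X.Dhat x = X.Dhat q := by
  obtain ⟨ε, hε, hwf⟩ := CordAlgebra.CordData.exists_wellFounded_split hK
  refine ⟨ε, hε, fun X hX hXε q hq => ?_⟩
  have hgood : ∀ c, c ∉ X.A → ∃ z, ∀ᶠ x in 𝓝 c, x ∉ X.A ∧ X.IsDhat x z := by
    intro c
    induction c using (hwf X hXε).induction with
    | _ c ih => exact fun hc => CordAlgebra.CordData.eventually_isDhat hK hX hc ih
  obtain ⟨z, hz⟩ := hgood q hq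
  obtain ⟨V, hV, hVo, hqV⟩ := mem_nhds_iff.1 hz
  refine ⟨V, hVo, hqV, fun x hx => ?_⟩
  obtain ⟨hxA, hxz⟩ := hV hx
  refine ⟨hxA, ⟨z, hxz, fun z' hz' => hz'.unique hxA hxz⟩, ?_⟩
  rw [hxz.dhat_eq hxA, (hV hqV).2.dhat_eq hq]
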